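/- **Rings.** Let $\mathcal D$ be the set of prime powers $q=p^e$ ($e\ge 1$). Let $\mathcal Z$ be the ring of families $x=(x_q)_{q\in\mathcal D}$ of integers for which there is $d\ge 0$ with $|x_q|\le q^d$ for all $q$. Let $\mathcal I\subset\mathcal Z$ be the ideal of those $x$ for which there is $N\ge1$ with $x_q=0$ for all $q$ with $\gcd(q,N)=1$. Put $\mathcal Z^\flat=\mathcal Z/\mathcal I$, write $\mathbf q=(q)_q$, and put $\mathcal Q=\mathcal Z[\mathbf q^{-1}]$ and $\mathcal Q^\flat=\mathcal Z^\flat[\mathbf q^{-1}]$. Elements of $\mathcal Q$ are regarded as families of rational numbers; elements of $\mathcal Q$ and their images in $\mathcal Q^\flat$ are denoted alike. The superscript $*$ stands for $\flat$ or for no decoration. Write $\langle S\rangle$ for the $\mathbf Z[\mathbf q^{\pm1}]$-submodule of $\mathcal Q^*$ generated by $S$. **Module representations.** A finite free module representation (over $\mathbf Z$) is a homomorphism $\theta\colon M\to\operatorname{Hom}(V,W)$ with $M,V,W$ free $\mathbf Z$-modules of finite rank; put $x*a=x(a\theta)$ for $x\in V$, $a\in M$ (maps act on the right). It is immersive if it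 is injective with free cokernel, and alternating if $V=M$ and $a*a=0$ for all $a\in M$. Let ${}^m\theta\colon M\to\operatorname{Hom}(V^m,W^m)$, $a\mapsto(a\theta)^{\oplus m}$. Let $$\mathsf{ask}(\theta)=\Bigl(\tfrac1{\#(M\otimes\mathbf F_q)}\sum_{a\in M\otimes\mathbf F_q}\#\operatorname{Ker}(a\theta^{\mathbf F_q})\Bigr)_{q\in\mathcal D}\in\mathcal Q,$$ where $\theta^{\mathbf F_q}$ is the base change of $\theta$ to $\mathbf F_q$. Define - ${}^m\mathfrak A^*=\langle\mathsf{ask}({}^m\theta):\theta\text{ finite free}\rangle$ and ${}^m\mathfrak A^*_{\rightarrowtail}=\langle\mathsf{ask}({}^m\theta):\theta\text{ immersive}\rangle$ (with $\mathfrak A^*={}^1\mathfrak A^*$ and $\mathfrak A^*_{\rightarrowtail}={}^1\mathfrak A^*_{\rightarrowtail}$), - ${}^-\mathfrak A^*=\langle\mathsf{ask}(\theta):\theta\text{ alternating and finite free}\rangle$, - $\mathfrak X^*=\langle(\#X(\mathbf F_q))_q: X\text{ a separated scheme of finite type over }\mathbf Z\rangle$. **Groups.** For a finite free $\theta\colon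 M\to\operatorname{Mat}_{d\times e}(\mathbf Z)=\operatorname{Hom}(\mathbf Z^d,\mathbf Z^e)$, let $\mathsf M_\theta(R)=M\otimes R$ be the additive group acting on $R^{d+e}=R^d\oplus R^e$ by $(x,y)a=(x,x*a+y)$. For a finite free $\theta$, let $\mathsf H_\theta(R)$ be the group of formal matrices $\left[\begin{smallmatrix}1&v&w\\0&1&a\\0&0&1\end{smallmatrix}\right]$ with $a\in M\otimes R$, $v\in V\otimes R$, $w\in W\otimes R$, multiplied using $*$. For an alternating finite free $\theta$, let $\mathsf G_\theta$ be its Baer group scheme: $\mathsf G_\theta(R)=(M\otimes R)\times(W\otimes R)$ with product $(a,y)(a',y')=(a+a',\,y+y'+\beta(a,a'))$, where, for a $\mathbf Z$-basis $b_1,b_2,\dotsc$ of $M$, $\beta$ is the bilinear map with $\beta(b_i,b_j)=b_i*b_j$ for $j<i$ and $\beta(b_i,b_j)=0$ otherwise; its commutators are $[(a,y),(a',y')]=(0,a*a')$. Let $k(G)$ be the number of conjugacy classes of a finite group $G$, and put $\mathsf k(G)=(k(G(\mathbf F_q)))_q$ for a group scheme $G$. A linear algebraic group over $\mathbf Q$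 is a closed subgroup scheme $G_0\le\operatorname{GL}_n\otimes\mathbf Q$; let $G\le\operatorname{GL}_n$ be its scheme-theoretic closure over $\mathbf Z$. Write $\#(\mathbf A^n_{\mathbf Q}/G_0)$ and $\mathsf k(G_0)$ for the images in $\mathcal Q^\flat$ of the families $(\#(\mathbf F_q^n/G(\mathbf F_q)))_q$ (row vectors, right multiplication) and $(k(G(\mathbf F_q)))_q$. Let $\mathrm U_n\le\operatorname{GL}_n$ be the group scheme of upper unitriangular matrices. **Proposition.** For all $m\ge0$, the modules ${}^m\mathfrak A^*$, ${}^m\mathfrak A^*_{\rightarrowtail}$, ${}^-\mathfrak A^*$ and $\mathfrak X^*$ are $\mathbf Z[\mathbf q^{\pm1}]$-subalgebras of $\mathcal Q^*$, and: 1. ${}^m\mathfrak A^*_{\rightarrowtail}\subset{}^m\mathfrak A^*\subset\mathfrak A^*\subset\mathfrak X^*$ for all $m\ge1$. 2. $\mathfrak A^*=\langle(\#(\mathbf F_q^{d+e}/\mathsf M_\theta(\mathbf F_q)))_q:\ d,e\ge0,\ \theta\colon M\to\operatorname{Mat}_{d\times e}(\mathbf Z)\text{ finite free}\rangle$, and $\mathfrak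 A^*_{\rightarrowtail}$ is generated in the same way using only immersive $\theta$. 3. ${}^2\mathfrak A^*=\langle\mathsf k(\mathsf H_\theta):\theta\text{ a finite free module representation}\rangle$. 4. ${}^-\mathfrak A^*=\langle\mathsf k(\mathsf G_\theta):\theta\text{ an alternating finite free module representation}\rangle$. 5. ${}^2\mathfrak A^*\subset{}^-\mathfrak A^*$. 6. $\mathfrak A^\flat=\langle\#(\mathbf A^n_{\mathbf Q}/G_0): n\ge 0,\ G_0\le\mathrm U_n\otimes\mathbf Q\text{ a closed subgroup scheme}\rangle$, and the same holds when only commutative $G_0$ are used. 7. ${}^-\mathfrak A^\flat=\langle\mathsf k(G_0): G_0\text{ a unipotent linear algebraic group over }\mathbf Q\rangle$, and the same holds when only $G_0$ of nilpotency class at most $2$ are used. -/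

import Mathlib

open scoped TensorProduct Matrix
open CategoryTheory AlgebraicGeometry

set_option linter.unusedSectionVars false

noncomputable section

namespace OrbitEnum

/-! ### Prime powers and finite fields -/

/-- The set of prime powers `p ^ e`, `e ≥ 1`. -/
abbrev PP : Type := {q : ℕ // IsPrimePow q}

instance (q : PP) : Fact (Nat.minFac q.1).Prime := ⟨Nat.minFac_prime q.2.ne_one⟩

/-- The finite field with `q` elements. -/
abbrev Fq (q : PP) : Type := GaloisField (Nat.minFac q.1) (q.1.factorization (Nat.minFac q.1))

theorem card_Fq (q : PP) : Nat.card (Fq q) = q.1 := by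
  have h := q.2.minFac_pow_factorization_eq
  rw [GaloisField.card, h]
  intro h0
  rw [h0, pow_zero] at h
  exact q.2.ne_one h.symm

theorem PP.two_le (q : PP) : 2 ≤ q.1 := q.2.two_le

/-! ### The rings `𝒵`, `𝒵♭`, `𝒬`, `𝒬♭` -/

/-- `x_q` is bounded by a fixed power of `q`. -/
def PolyBdd (x : PP → ℤ) : Prop := ∃ d : ℕ, ∀ q : PP, |x q| ≤ (q.1 : ℤ) ^ d

/-- The ring `𝒵` of polynomially bounded integer families indexed by the prime powers. -/
def ZZ : Subring (PP → ℤ) where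
  carrier := {x | PolyBdd x}
  zero_mem' := ⟨0, fun q => by simp⟩
  one_mem' := ⟨0, fun q => by simp⟩
  neg_mem' := by
    rintro x ⟨d, h⟩
    exact ⟨d, fun q => by simpa using h q⟩
  mul_mem' := by
    rintro x y ⟨d, h⟩ ⟨e, k⟩
    refine ⟨d + e, fun q => ?_⟩
    rw [Pi.mul_apply, abs_mul, pow_add]
    exact mul_le_mul (h q) (k q) (abs_nonneg _) (by positivity)
  add_mem' := by
    rintro x y ⟨d, h⟩ ⟨e, k⟩
    refine ⟨max d e + 1, fun q => ?_⟩
    have hq : (2 : ℤ) ≤ q.1 := by exact_mod_cast q.two_le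
    have h1 : (q.1 : ℤ) ^ d ≤ (q.1 : ℤ) ^ max d e :=
      pow_le_pow_right₀ (by linarith) (le_max_left _ _)
    have h2 : (q.1 : ℤ) ^ e ≤ (q.1 : ℤ) ^ max d e :=
      pow_le_pow_right₀ (by linarith) (le_max_right _ _)
    have h3 : (0 : ℤ) ≤ (q.1 : ℤ) ^ max d e := by positivity
    have h4 := abs_add_le (x q) (y q)
    have h5 := h q
    have h6 := k q
    rw [Pi.add_apply, pow_succ]
    nlinarith

/-- The element of `𝒵` given by a polynomially bounded family of natural numbers. -/
def ofCount (f : PP → ℕ) (h : ∃ d : ℕ, ∀ q : PP, f q ≤ q.1 ^ d) : ZZ :=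
  ⟨fun q => (f q : ℤ), by
    obtain ⟨d, h⟩ := h
    refine ⟨d, fun q => ?_⟩
    change |(f q : ℤ)| ≤ _
    rw [abs_of_nonneg (by positivity)]
    exact_mod_cast h q⟩

/-- The family `(q)_q`, an element of `𝒵`. -/
def qZ : ZZ := ofCount (fun q => q.1) ⟨1, fun q => by simp⟩

/-- The ideal of all families that vanish outside of finitely many characteristics. -/
def smallPrimes : Ideal ZZ where
  carrier := {x | ∃ N : ℕ, 1 ≤ N ∧ ∀ q : PP, Nat.gcd q.1 N = 1 → x.1 q = 0}
  zero_mem' := ⟨1, le_rfl, fun q _ => rfl⟩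
  add_mem' := by
    rintro x y ⟨N, hN, h⟩ ⟨K, hK, k⟩
    refine ⟨N * K, Nat.mul_pos hN hK, fun q hq => ?_⟩
    have h1 : Nat.Coprime q.1 (N * K) := hq
    have h2 := h q (Nat.Coprime.coprime_mul_right_right h1)
    have h3 := k q (Nat.Coprime.coprime_mul_left_right h1)
    change x.1 q + y.1 q = 0
    rw [h2, h3, add_zero]
  smul_mem' := by
    rintro c x ⟨N, hN, h⟩
    refine ⟨N, hN, fun q hq => ?_⟩
    change c.1 q * x.1 q = 0
    rw [h q hq, mul_zero]

/-- `𝒵♭`, the quotient of `𝒵` that discards finitely many characteristics. -/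
abbrev ZZflat : Type := ZZ ⧸ smallPrimes

/-- `𝒬 = 𝒵[q⁻¹]`. -/
abbrev QQ : Type := Localization.Away qZ

/-- `𝒬♭ = 𝒵♭[q⁻¹]`. -/
abbrev QQflat : Type := Localization.Away (Ideal.Quotient.mk smallPrimes qZ)

/-- The natural map `𝒬 → 𝒬♭`. -/
def toFlat : QQ →+* QQflat := Localization.awayMap (Ideal.Quotient.mk smallPrimes) qZ

/-- The element `q` of `𝒬`. -/
def qQ : QQ := algebraMap ZZ QQ qZ

/-- The element `q⁻¹` of `𝒬`. -/
def qInv : QQ := IsLocalization.Away.invSelf (S := QQ) qZ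

/-- The value at `q` of an element of `𝒬`, viewed as a family of rational numbers. -/
def evalQ (q : PP) : QQ →+* ℚ :=
  IsLocalization.Away.lift (S := QQ) qZ
    (g := ((Int.castRingHom ℚ).comp (Pi.evalRingHom (fun _ : PP => ℤ) q)).comp ZZ.subtype)
    (isUnit_iff_ne_zero.mpr (by
      have := q.two_le
      change ((q.1 : ℤ) : ℚ) ≠ 0
      exact_mod_cast (by omega : q.1 ≠ 0)))

theorem evalQ_algebraMap (q : PP) (x : ZZ) : evalQ q (algebraMap ZZ QQ x) = (x.1 q : ℚ) :=
  IsLocalization.Away.lift_eq _ _ _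

theorem evalQ_qInv (q : PP) : evalQ q qInv = (q.1 : ℚ)⁻¹ := by
  have h := congrArg (evalQ q) (IsLocalization.Away.mul_invSelf (S := QQ) qZ)
  rw [map_mul, evalQ_algebraMap, map_one] at h
  exact eq_inv_of_mul_eq_one_right h

/-- The decoration `*`: either absent or `♭`. -/
inductive Deco : Type
  | none
  | flat

/-- `𝒬*`, i.e. `𝒬` or `𝒬♭`. -/
def Deco.Q : Deco → Type
  | .none => QQ
  | .flat => QQflat

instance Deco.instCommRing : (s : Deco) → CommRing s.Q
  | .none => inferInstanceAs (CommRing QQ)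
  | .flat => inferInstanceAs (CommRing QQflat)

/-- The natural map `𝒬 → 𝒬*`. Elements of `𝒬♭` such as point counts are images of elements
of `𝒬` under this map. -/
def Deco.proj : (s : Deco) → QQ →+* s.Q
  | .none => RingHom.id QQ
  | .flat => toFlat

/-- The subring `ℤ[q, q⁻¹]` of `𝒬*`. -/
abbrev Laurent (s : Deco) : Subalgebra ℤ s.Q := Algebra.adjoin ℤ {s.proj qQ, s.proj qInv}

/-- The `ℤ[q, q⁻¹]`-submodule of `𝒬*` generated by (the images of) a set of elements of `𝒬`. -/
def laurentSpan (s : Deco) (S : Set QQ) : Submodule (Laurent s) s.Q :=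
  Submodule.span (Laurent s) (s.proj '' S)

/-- The submodule `A` of `𝒬*` is a `ℤ[q, q⁻¹]`-subalgebra. -/
def IsSubalg {s : Deco} (A : Submodule (Laurent s) s.Q) : Prop :=
  ∃ B : Subalgebra (Laurent s) s.Q, Subalgebra.toSubmodule B = A

/-! ### Module representations -/

section Modules

variable {R : Type} [CommRing R] {M V W : Type} [AddCommGroup M] [AddCommGroup V] [AddCommGroup W]

/-- The sum of the sizes of the kernels of the maps parameterised by `θ`. -/
def kerSum [Module R M] [Module R V] [Module R W] (θ : M →ₗ[R] V →ₗ[R] W) : ℕ :=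
  ∑ᶠ a : M, Nat.card (LinearMap.ker (θ a))

/-- The average size of the kernels of the maps parameterised by `θ` (for finite `M` and `V`). -/
def ask [Module R M] [Module R V] [Module R W] (θ : M →ₗ[R] V →ₗ[R] W) : ℚ :=
  (kerSum θ : ℚ) / (Nat.card M : ℚ)

/-- The Heisenberg-like group of all formal matrices `[1, v, w; 0, 1, a; 0, 0, 1]`, where the
product `V × M → W` is the bilinear map `(v, a) ↦ θ a v`. -/
@[ext] structure Heis [Module R M] [Module R V] [Module R W] (θ : M →ₗ[R] V →ₗ[R] W) : Type where
  a : M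
  v : V
  w : W

instance [Module R M] [Module R V] [Module R W] (θ : M →ₗ[R] V →ₗ[R] W) : Group (Heis θ) where
  mul g h := ⟨g.a + h.a, g.v + h.v, h.w + θ h.a g.v + g.w⟩
  one := ⟨0, 0, 0⟩
  inv g := ⟨-g.a, -g.v, θ g.a g.v - g.w⟩
  mul_assoc g h k := by
    change (Heis.mk _ _ _ : Heis θ) = Heis.mk _ _ _
    ext
    · exact add_assoc _ _ _
    · exact add_assoc _ _ _
    · change k.w + θ k.a (g.v + h.v) + (h.w + θ h.a g.v + g.w) =
        k.w + θ k.a h.v + h.w + θ (h.a + k.a) g.v + g.w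
      rw [map_add, map_add, LinearMap.add_apply]
      abel
  one_mul g := by
    change (Heis.mk _ _ _ : Heis θ) = g
    ext
    · exact zero_add _
    · exact zero_add _
    · change g.w + θ g.a 0 + 0 = g.w
      simp
  mul_one g := by
    change (Heis.mk _ _ _ : Heis θ) = g
    ext
    · exact add_zero _
    · exact add_zero _
    · change 0 + θ 0 g.v + g.w = g.w
      simp
  inv_mul_cancel g := by
    change (Heis.mk _ _ _ : Heis θ) = Heis.mk _ _ _
    congr 1
    · exact neg_add_cancel _
    · exact neg_add_cancel _
    · change g.w + θ g.a (-g.v) + (θ g.a g.v - g.w) = 0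
      rw [map_neg]
      abel

/-- The group on `M × W` with product `(a, y) (a', y') = (a + a', y + y' + β a a')`. -/
@[ext] structure Baer [Module R M] [Module R W] (β : M →ₗ[R] M →ₗ[R] W) : Type where
  a : M
  y : W

instance [Module R M] [Module R W] (β : M →ₗ[R] M →ₗ[R] W) : Group (Baer β) where
  mul g h := ⟨g.a + h.a, g.y + h.y + β g.a h.a⟩
  one := ⟨0, 0⟩
  inv g := ⟨-g.a, β g.a g.a - g.y⟩
  mul_assoc g h k := by
    change (Baer.mk _ _ : Baer β) = Baer.mk _ _
    ext
    · exact add_assoc _ _ _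
    · change g.y + h.y + β g.a h.a + k.y + β (g.a + h.a) k.a =
        g.y + (h.y + k.y + β h.a k.a) + β g.a (h.a + k.a)
      rw [map_add, map_add, LinearMap.add_apply]
      abel
  one_mul g := by
    change (Baer.mk _ _ : Baer β) = g
    ext
    · exact zero_add _
    · change 0 + g.y + β 0 g.a = g.y
      simp
  mul_one g := by
    change (Baer.mk _ _ : Baer β) = g
    ext
    · exact add_zero _
    · change g.y + 0 + β g.a 0 = g.y
      simp
  inv_mul_cancel g := by
    change (Baer.mk _ _ : Baer β) = Baer.mk _ _
    congr 1
    · exact neg_add_cancel _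
    · change β g.a g.a - g.y + g.y + β (-g.a) g.a = 0
      rw [map_neg, LinearMap.neg_apply]
      abel

/-- The base change `θ^S` of a module representation over `ℤ`. -/
def bc (S : Type) [CommRing S] (θ : M →ₗ[ℤ] V →ₗ[ℤ] W) :
    (S ⊗[ℤ] M) →ₗ[S] (S ⊗[ℤ] V) →ₗ[S] (S ⊗[ℤ] W) :=
  LinearMap.liftBaseChange S ((LinearMap.baseChangeHom ℤ S V W) ∘ₗ θ)

theorem bc_tmul (S : Type) [CommRing S] (θ : M →ₗ[ℤ] V →ₗ[ℤ] W) (s t : S) (a : M) (x : V) :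
    bc S θ (s ⊗ₜ a) (t ⊗ₜ x) = (s * t) ⊗ₜ θ a x := by
  simp [bc, TensorProduct.smul_tmul']

/-- The module representation `ᵐθ`, with `a` acting as the `m`-fold direct sum of `θ a`. -/
def mfold (m : ℕ) (θ : M →ₗ[ℤ] V →ₗ[ℤ] W) : M →ₗ[ℤ] (Fin m → V) →ₗ[ℤ] (Fin m → W) :=
  LinearMap.mk₂ ℤ (fun a x i => θ a (x i))
    (fun a b x => by ext i; simp) (fun c a x => by ext i; simp)
    (fun a x y => by ext i; simp) (fun c a x => by ext i; simp)

/-- A (finite free) module representation over `ℤ` is immersive if it is injective and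
has free cokernel. -/
def Immersive (θ : M →ₗ[ℤ] V →ₗ[ℤ] W) : Prop :=
  Function.Injective θ ∧ Module.Free ℤ ((V →ₗ[ℤ] W) ⧸ LinearMap.range θ)

/-- For `θ : M → Hom(ℤ^d, ℤ^e)` this is the orbit relation of the additive group `M ⊗ S` on
`S^(d+e) = S^d ⊕ S^e`. Two points `(x, y)` and `(x', y')` of `(V ⊗ S) ⊕ (W ⊗ S)` are related if they lie in the same
orbit under the action `(x, y) a = (x, x * a + y)` of the additive group `M ⊗ S`. -/
def transvSetoid (S : Type) [CommRing S] (θ : M →ₗ[ℤ] V →ₗ[ℤ] W) :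
    Setoid ((S ⊗[ℤ] V) × (S ⊗[ℤ] W)) where
  r p p' := ∃ a : S ⊗[ℤ] M, (p.1, bc S θ a p.1 + p.2) = p'
  iseqv := by
    refine ⟨fun p => ⟨0, by simp⟩, ?_, ?_⟩
    · rintro p _ ⟨a, rfl⟩
      exact ⟨-a, by simp⟩
    · rintro p _ _ ⟨a, rfl⟩ ⟨b, rfl⟩
      exact ⟨b + a, by simp [add_assoc]⟩

variable [Module.Free ℤ M] [Module.Finite ℤ M] [Module.Free ℤ V] [Module.Finite ℤ V]
  [Module.Free ℤ W] [Module.Finite ℤ W]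

instance (q : PP) : Finite (Fq q ⊗[ℤ] M) := Module.finite_of_finite (Fq q)

theorem card_tensor (q : PP) : Nat.card (Fq q ⊗[ℤ] M) = q.1 ^ Module.finrank ℤ M := by
  rw [Module.natCard_eq_pow_finrank (K := Fq q), Module.finrank_baseChange, card_Fq]

theorem kerSum_bc_le (θ : M →ₗ[ℤ] V →ₗ[ℤ] W) : ∃ d : ℕ, ∀ q : PP,
    kerSum (bc (Fq q) θ) ≤ q.1 ^ d := by
  refine ⟨Module.finrank ℤ M + Module.finrank ℤ V, fun q => ?_⟩
  have := Fintype.ofFinite (Fq q ⊗[ℤ] M)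
  rw [kerSum, finsum_eq_sum_of_fintype, pow_add, ← card_tensor (M := M), ← card_tensor (M := V),
    Nat.card_eq_fintype_card (α := Fq q ⊗[ℤ] M), ← smul_eq_mul, ← Finset.card_univ]
  refine Finset.sum_le_card_nsmul _ _ _ fun a _ => ?_
  exact Nat.card_le_card_of_injective _ Subtype.val_injective

/-- The element `(ask (θ^{F_q}))_q` of `𝒬`. -/
def askSym (θ : M →ₗ[ℤ] V →ₗ[ℤ] W) : QQ :=
  algebraMap ZZ QQ (ofCount (fun q => kerSum (bc (Fq q) θ)) (kerSum_bc_le θ)) *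
    qInv ^ Module.finrank ℤ M

theorem evalQ_askSym (θ : M →ₗ[ℤ] V →ₗ[ℤ] W) (q : PP) :
    evalQ q (askSym θ) = ask (bc (Fq q) θ) := by
  rw [askSym, map_mul, map_pow, evalQ_algebraMap, evalQ_qInv, ask, card_tensor, inv_pow,
    div_eq_mul_inv]
  simp [ofCount]

theorem transv_le (θ : M →ₗ[ℤ] V →ₗ[ℤ] W) : ∃ d : ℕ, ∀ q : PP,
    Nat.card (Quotient (transvSetoid (Fq q) θ)) ≤ q.1 ^ d := by
  refine ⟨Module.finrank ℤ V + Module.finrank ℤ W, fun q => ?_⟩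
  rw [pow_add, ← card_tensor (M := V), ← card_tensor (M := W), ← Nat.card_prod]
  exact Nat.card_le_card_of_surjective _ Quotient.mk_surjective

/-- The element of `𝒬` given by the numbers of orbits of `M ⊗ F_q` on
`(V ⊗ F_q) ⊕ (W ⊗ F_q)`. -/
def transvOrbits (θ : M →ₗ[ℤ] V →ₗ[ℤ] W) : QQ :=
  algebraMap ZZ QQ (ofCount (fun q => Nat.card (Quotient (transvSetoid (Fq q) θ))) (transv_le θ))

theorem heis_le (θ : M →ₗ[ℤ] V →ₗ[ℤ] W) : ∃ d : ℕ, ∀ q : PP,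
    Nat.card (ConjClasses (Heis (bc (Fq q) θ))) ≤ q.1 ^ d := by
  refine ⟨Module.finrank ℤ M + (Module.finrank ℤ V + Module.finrank ℤ W), fun q => ?_⟩
  rw [pow_add, pow_add, ← card_tensor (M := V), ← card_tensor (M := W), ← card_tensor (M := M),
    ← Nat.card_prod, ← Nat.card_prod]
  exact Nat.card_le_card_of_surjective
    (fun t => ConjClasses.mk (⟨t.1, t.2.1, t.2.2⟩ : Heis (bc (Fq q) θ)))
    (fun c => by
      obtain ⟨g, rfl⟩ := ConjClasses.mk_surjective c
      exact ⟨(g.a, g.v, g.w), rfl⟩)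

/-- The element of `𝒬` given by the class numbers of the groups `H_θ(F_q)`. -/
def heisClasses (θ : M →ₗ[ℤ] V →ₗ[ℤ] W) : QQ :=
  algebraMap ZZ QQ (ofCount (fun q => Nat.card (ConjClasses (Heis (bc (Fq q) θ)))) (heis_le θ))

/-- For an alternating bilinear map `a * a' = θ a' a`, the bilinear map `β` with
`β (b i) (b j) = b i * b j` for `j < i` and `β (b i) (b j) = 0` for `i ≤ j`, where `b` is a basis
of `M`. It satisfies `β a a' - β a' a = a * a'`. -/
def baerCocycle (θ : M →ₗ[ℤ] M →ₗ[ℤ] W) : M →ₗ[ℤ] M →ₗ[ℤ] W :=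
  (Module.finBasis ℤ M).constr ℤ fun i => (Module.finBasis ℤ M).constr ℤ fun j =>
    if j < i then θ (Module.finBasis ℤ M j) (Module.finBasis ℤ M i) else 0

theorem baerCocycle_sub (θ : M →ₗ[ℤ] M →ₗ[ℤ] W) (hθ : ∀ a, θ a a = 0) :
    baerCocycle θ - (baerCocycle θ).flip = θ.flip := by
  have hs : ∀ a b, θ a b = - θ b a := fun a b => by
    have h := hθ (a + b)
    simp only [map_add, LinearMap.add_apply, hθ] at h
    rw [zero_add, add_zero] at h
    exact eq_neg_of_add_eq_zero_right h
  refine (Module.finBasis ℤ M).ext fun i => (Module.finBasis ℤ M).ext fun j => ?_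
  simp only [baerCocycle, LinearMap.sub_apply, LinearMap.flip_apply, Module.Basis.constr_basis]
  rcases lt_trichotomy i j with h | h | h
  · rw [if_neg (not_lt.mpr h.le), if_pos h, zero_sub, ← hs]
  · subst h
    simp [hθ]
  · rw [if_pos h, if_neg (not_lt.mpr h.le), sub_zero]

/-- The group `G_θ(S)` of `S`-points of the Baer group scheme of an alternating `θ`. -/
abbrev BaerPts (S : Type) [CommRing S] (θ : M →ₗ[ℤ] M →ₗ[ℤ] W) : Type :=
  Baer (bc S (baerCocycle θ))

/-- Commutators in `G_θ(S)`: `[(a, y), (a', y')] = (0, a * a')`. -/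
theorem BaerPts.commutator (S : Type) [CommRing S] (θ : M →ₗ[ℤ] M →ₗ[ℤ] W)
    (hθ : ∀ a, θ a a = 0) (g h : BaerPts S θ) :
    g⁻¹ * h⁻¹ * g * h = ⟨0, bc S θ h.a g.a⟩ := by
  have key : ∀ x y : S ⊗[ℤ] M, bc S (baerCocycle θ) x y - bc S (baerCocycle θ) y x =
      bc S θ y x := by
    intro x y
    induction x using TensorProduct.induction_on with
    | zero => simp
    | add x x' hx hx' =>
      simp only [map_add, LinearMap.add_apply] at *
      rw [← hx, ← hx']
      abel
    | tmul s a =>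
      induction y using TensorProduct.induction_on with
      | zero => simp
      | add y y' hy hy' =>
        simp only [map_add, LinearMap.add_apply] at *
        rw [← hy, ← hy']
        abel
      | tmul t b =>
        have h := congrArg (fun f => f a b) (baerCocycle_sub θ hθ)
        simp only [LinearMap.sub_apply, LinearMap.flip_apply] at h
        rw [bc_tmul, bc_tmul, bc_tmul, mul_comm t s, ← TensorProduct.tmul_sub, h]
  change (Baer.mk _ _ : Baer (bc S (baerCocycle θ))) = Baer.mk _ _
  congr 1
  · change -g.a + -h.a + g.a + h.a = 0
    abel
  · rw [← key]
    set B := bc S (baerCocycle θ)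
    change B g.a g.a - g.y + (B h.a h.a - h.y) + B (-g.a) (-h.a) + g.y + B (-g.a + -h.a) g.a +
      h.y + B (-g.a + -h.a + g.a) h.a = _
    simp only [map_add, map_neg, LinearMap.add_apply, LinearMap.neg_apply]
    abel

theorem baer_le (θ : M →ₗ[ℤ] M →ₗ[ℤ] W) : ∃ d : ℕ, ∀ q : PP,
    Nat.card (ConjClasses (BaerPts (Fq q) θ)) ≤ q.1 ^ d := by
  refine ⟨Module.finrank ℤ M + Module.finrank ℤ W, fun q => ?_⟩
  rw [pow_add, ← card_tensor (M := W), ← card_tensor (M := M), ← Nat.card_prod]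
  exact Nat.card_le_card_of_surjective
    (fun t => ConjClasses.mk (⟨t.1, t.2⟩ : BaerPts (Fq q) θ))
    (fun c => by
      obtain ⟨g, rfl⟩ := ConjClasses.mk_surjective c
      exact ⟨(g.a, g.y), rfl⟩)

/-- The element of `𝒬` given by the class numbers of the groups `G_θ(F_q)`. -/
def baerClasses (θ : M →ₗ[ℤ] M →ₗ[ℤ] W) : QQ :=
  algebraMap ZZ QQ (ofCount (fun q => Nat.card (ConjClasses (BaerPts (Fq q) θ))) (baer_le θ))

end Modules

/-- A finite free module representation `M → Hom(V, W)` over `ℤ`. -/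
structure FreeRep : Type 1 where
  M : Type
  V : Type
  W : Type
  [groupM : AddCommGroup M]
  [groupV : AddCommGroup V]
  [groupW : AddCommGroup W]
  [freeM : Module.Free ℤ M]
  [freeV : Module.Free ℤ V]
  [freeW : Module.Free ℤ W]
  [finM : Module.Finite ℤ M]
  [finV : Module.Finite ℤ V]
  [finW : Module.Finite ℤ W]
  θ : M →ₗ[ℤ] V →ₗ[ℤ] W

/-- An alternating finite free module representation `M → Hom(M, W)` over `ℤ`. -/
structure AltRep : Type 1 where
  M : Type
  W : Type
  [groupM : AddCommGroup M]
  [groupW : AddCommGroup W]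
  [freeM : Module.Free ℤ M]
  [freeW : Module.Free ℤ W]
  [finM : Module.Finite ℤ M]
  [finW : Module.Finite ℤ W]
  θ : M →ₗ[ℤ] M →ₗ[ℤ] W
  alt : ∀ a, θ a a = 0

/-- A finite free module representation `M → Mat_{d×e}(ℤ) = Hom(ℤ^d, ℤ^e)`. -/
structure MatRep : Type 1 where
  d : ℕ
  e : ℕ
  M : Type
  [groupM : AddCommGroup M]
  [freeM : Module.Free ℤ M]
  [finM : Module.Finite ℤ M]
  θ : M →ₗ[ℤ] (Fin d → ℤ) →ₗ[ℤ] (Fin e → ℤ)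

attribute [instance] FreeRep.groupM FreeRep.groupV FreeRep.groupW FreeRep.freeM FreeRep.freeV
  FreeRep.freeW FreeRep.finM FreeRep.finV FreeRep.finW AltRep.groupM AltRep.groupW AltRep.freeM
  AltRep.freeW AltRep.finM AltRep.finW MatRep.groupM MatRep.freeM MatRep.finM

/-- `ᵐ𝔄*`; in particular, `𝔄* = ¹𝔄*`. -/
def algA (s : Deco) (m : ℕ) : Submodule (Laurent s) s.Q :=
  laurentSpan s {x | ∃ T : FreeRep, x = askSym (mfold m T.θ)}

/-- The immersive variant of `ᵐ𝔄*`. -/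
def algAimm (s : Deco) (m : ℕ) : Submodule (Laurent s) s.Q :=
  laurentSpan s {x | ∃ T : FreeRep, Immersive T.θ ∧ x = askSym (mfold m T.θ)}

/-- `⁻𝔄*`. -/
def algAalt (s : Deco) : Submodule (Laurent s) s.Q :=
  laurentSpan s {x | ∃ T : AltRep, x = askSym T.θ}

/-! ### Schemes of finite type -/

/-- A separated scheme of finite type over `ℤ`. -/
structure FTScheme : Type 1 where
  X : Scheme.{0}
  sep : IsSeparated (specZIsTerminal.from X)
  ft : LocallyOfFiniteType (specZIsTerminal.from X)
  qc : QuasiCompact (specZIsTerminal.from X)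

/-- The set `X(S)` of `S`-points. -/
abbrev FTScheme.Pts (X : FTScheme) (S : Type) [CommRing S] : Type := Spec (CommRingCat.of S) ⟶ X.X

theorem hom_finite_le (A : CommRingCat.{0}) (h : Algebra.FiniteType ℤ A) : ∃ n : ℕ, ∀ q : PP,
    Finite (A ⟶ CommRingCat.of (Fq q)) ∧ Nat.card (A ⟶ CommRingCat.of (Fq q)) ≤ q.1 ^ n := by
  obtain ⟨n, f, hf⟩ := Algebra.FiniteType.iff_quotient_mvPolynomial''.mp h
  refine ⟨n, fun q => ?_⟩
  let r : (A ⟶ CommRingCat.of (Fq q)) → (Fin n → Fq q) := fun φ i => φ.hom (f (MvPolynomial.X i))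
  have hr : Function.Injective r := by
    intro φ ψ e
    ext a
    obtain ⟨p, rfl⟩ := hf a
    have : φ.hom.comp f.toRingHom = ψ.hom.comp f.toRingHom := by
      apply MvPolynomial.ringHom_ext
      · intro z; simp
      · intro i; exact congrFun e i
    exact congrArg (fun g => g p) this
  refine ⟨Finite.of_injective r hr, ?_⟩
  refine (Nat.card_le_card_of_injective r hr).trans ?_
  rw [Nat.card_fun, card_Fq, Nat.card_eq_fintype_card, Fintype.card_fin]

theorem FTScheme.pts_le (X : FTScheme) : ∃ d : ℕ, ∀ q : PP, Nat.card (X.Pts (Fq q)) ≤ q.1 ^ d := by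
  have := X.ft
  have : CompactSpace X.X := (quasiCompact_iff_compactSpace (specZIsTerminal.from X.X)).mp X.qc
  let U := X.X.affineCover.finiteSubcover
  have hU : ∀ j, IsAffine (U.X j) := fun j => inferInstance
  have hA : ∀ j, Algebra.FiniteType ℤ Γ(U.X j, ⊤) := by
    intro j
    have h1 : LocallyOfFiniteType ((U.X j).isoSpec.inv ≫ U.f j ≫ specZIsTerminal.from X.X) :=
      inferInstance
    have h2 := Spec.map_surjective ((U.X j).isoSpec.inv ≫ U.f j ≫ specZIsTerminal.from X.X)
    obtain ⟨g, hg⟩ := h2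
    rw [← hg, HasRingHomProperty.Spec_iff (P := @LocallyOfFiniteType)] at h1
    have h3 : g.hom = algebraMap ℤ Γ(U.X j, ⊤) := RingHom.ext_int _ _
    rw [h3] at h1
    exact (RingHom.finiteType_algebraMap).mp h1
  choose n hn using fun j => hom_finite_le _ (hA j)
  refine ⟨Fintype.card U.I₀ + ∑ j, n j, fun q => ?_⟩
  have hfin := fun j => (hn j q).1
  let σ : (Σ j, (Γ(U.X j, ⊤) ⟶ CommRingCat.of (Fq q))) → X.Pts (Fq q) :=
    fun t => Spec.map t.2 ≫ (U.X t.1).isoSpec.inv ≫ U.f t.1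
  have hσ : Function.Surjective σ := by
    intro φ
    let x : Spec (CommRingCat.of (Fq q)) := IsLocalRing.closedPoint (Fq q)
    obtain ⟨j, y, hy⟩ := U.exists_eq (φ x)
    have hle : Set.range φ ⊆ Set.range (U.f j) := by
      rintro _ ⟨z, rfl⟩
      have : z = x := Subsingleton.elim (α := PrimeSpectrum (Fq q)) _ _
      rw [this]
      exact ⟨y, hy⟩
    obtain ⟨g, hg⟩ := Spec.map_surjective (IsOpenImmersion.lift (U.f j) φ hle ≫ (U.X j).isoSpec.hom)
    refine ⟨⟨j, g⟩, ?_⟩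
    change Spec.map g ≫ (U.X j).isoSpec.inv ≫ U.f j = φ
    rw [hg]
    simp
  refine (Nat.card_le_card_of_surjective σ hσ).trans ?_
  rw [Nat.card_sigma, pow_add]
  calc ∑ j, Nat.card (Γ(U.X j, ⊤) ⟶ CommRingCat.of (Fq q))
      ≤ ∑ _j : U.I₀, q.1 ^ (∑ j, n j) := by
        refine Finset.sum_le_sum fun j _ => (hn j q).2.trans ?_
        exact Nat.pow_le_pow_right (by have := q.two_le; omega)
          (Finset.single_le_sum (fun _ _ => Nat.zero_le _) (Finset.mem_univ j))
    _ = Fintype.card U.I₀ * q.1 ^ (∑ j, n j) := by simp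
    _ ≤ q.1 ^ Fintype.card U.I₀ * q.1 ^ (∑ j, n j) :=
        Nat.mul_le_mul_right _ (Nat.lt_pow_self (by have := q.two_le; omega)).le

/-- The element `(#X(F_q))_q` of `𝒬`. -/
def FTScheme.count (X : FTScheme) : QQ :=
  algebraMap ZZ QQ (ofCount (fun q => Nat.card (X.Pts (Fq q))) X.pts_le)

/-- `𝔛*`. -/
def algX (s : Deco) : Submodule (Laurent s) s.Q :=
  laurentSpan s {x | ∃ X : FTScheme, x = X.count}

/-! ### Linear algebraic groups over `ℚ` -/

section LinearGroups

variable {n : ℕ}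

/-- Evaluation of a polynomial in the matrix entries at an invertible matrix. -/
abbrev evalMat (k : Type) [CommRing k] {S : Type} [CommRing S] [Algebra k S]
    (g : GL (Fin n) S) : MvPolynomial (Fin n × Fin n) k →ₐ[k] S :=
  MvPolynomial.aeval fun ij => (g : Matrix (Fin n) (Fin n) S) ij.1 ij.2

/-- A closed subgroup scheme of `GL_n ⊗ ℚ`, given by equations in the matrix entries. -/
structure LinAlgGroup (n : ℕ) : Type where
  I : Ideal (MvPolynomial (Fin n × Fin n) ℚ)
  one_mem' : ∀ (R : Type) [CommRing R] [Algebra ℚ R], ∀ f ∈ I,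
    evalMat ℚ (1 : GL (Fin n) R) f = 0
  mul_mem' : ∀ (R : Type) [CommRing R] [Algebra ℚ R] (g h : GL (Fin n) R),
    (∀ f ∈ I, evalMat ℚ g f = 0) → (∀ f ∈ I, evalMat ℚ h f = 0) →
      ∀ f ∈ I, evalMat ℚ (g * h) f = 0
  inv_mem' : ∀ (R : Type) [CommRing R] [Algebra ℚ R] (g : GL (Fin n) R),
    (∀ f ∈ I, evalMat ℚ g f = 0) → ∀ f ∈ I, evalMat ℚ g⁻¹ f = 0

namespace LinAlgGroup

variable (G : LinAlgGroup n)

/-- The group `G(R)` of points over a `ℚ`-algebra `R`. -/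
def pts (R : Type) [CommRing R] [Algebra ℚ R] : Subgroup (GL (Fin n) R) where
  carrier := {g | ∀ f ∈ G.I, evalMat ℚ g f = 0}
  one_mem' := G.one_mem' R
  mul_mem' := fun {g h} hg hh => G.mul_mem' R g h hg hh
  inv_mem' := fun {g} hg => G.inv_mem' R g hg

/-- The integral polynomials in the matrix entries that vanish on `G`. -/
def intIdeal : Ideal (MvPolynomial (Fin n × Fin n) ℤ) where
  carrier := {f | ∀ (R : Type) [CommRing R] [Algebra ℚ R], ∀ g ∈ G.pts R, evalMat ℤ g f = 0}
  zero_mem' := fun R _ _ g _ => map_zero _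
  add_mem' := fun {f f'} hf hf' R _ _ g hg => by rw [map_add, hf R g hg, hf' R g hg, add_zero]
  smul_mem' := fun c f hf R _ _ g hg => by rw [smul_eq_mul, map_mul, hf R g hg, mul_zero]

theorem evalMat_map {k S T : Type} [CommRing k] [CommRing S] [CommRing T] [Algebra k S]
    [Algebra k T] (φ : S →ₐ[k] T) (g : GL (Fin n) S) (f : MvPolynomial (Fin n × Fin n) k) :
    evalMat k (Matrix.GeneralLinearGroup.map φ.toRingHom g) f = φ (evalMat k g f) := by
  rw [← AlgHom.comp_apply]
  congr 1
  apply MvPolynomial.algHom_ext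
  intro ij
  simp [evalMat]

theorem map_mem_pts {R R' : Type} [CommRing R] [CommRing R'] [Algebra ℚ R] [Algebra ℚ R']
    (φ : R →+* R') {g : GL (Fin n) R} (hg : g ∈ G.pts R) :
    Matrix.GeneralLinearGroup.map φ g ∈ G.pts R' := by
  intro f hf
  have h := evalMat_map φ.toRatAlgHom g f
  rw [hg f hf, map_zero] at h
  exact h

theorem exists_generic : ∃ (C : Type) (_ : CommRing C) (_ : Algebra ℚ C) (u : GL (Fin n) C),
    u ∈ G.pts C ∧ ∀ f, evalMat ℤ u f = 0 → f ∈ G.intIdeal := by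
  classical
  have h : ∀ f : {f // f ∉ G.intIdeal}, ∃ (R : Type) (_ : CommRing R) (_ : Algebra ℚ R)
      (g : GL (Fin n) R), g ∈ G.pts R ∧ evalMat ℤ g f.1 ≠ 0 := by
    rintro ⟨f, hf⟩
    by_contra hcon
    push Not at hcon
    exact hf fun R i j g hg => hcon R i j g hg
  choose R i j g hg hne using h
  have key : ∀ (A B : Matrix (Fin n) (Fin n) (∀ f, R f)) (a b f),
      (A * B) a b f = ∑ c, A a c f * B c b f := by
    intro A B a b f
    rw [Matrix.mul_apply, Finset.sum_apply]
    rfl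
  let u : GL (Fin n) (∀ f, R f) :=
    { val := fun a b f => (g f).1 a b
      inv := fun a b f => (g f)⁻¹.1 a b
      val_inv := by
        refine Matrix.ext fun a b => funext fun f => ?_
        have := congrFun (congrFun (g f).val_inv a) b
        rw [Matrix.mul_apply] at this
        refine (key _ _ a b f).trans (this.trans ?_)
        by_cases hab : a = b <;> simp [Matrix.one_apply, hab]
      inv_val := by
        refine Matrix.ext fun a b => funext fun f => ?_
        have := congrFun (congrFun (g f).inv_val a) b
        rw [Matrix.mul_apply] at this
        refine (key _ _ a b f).trans (this.trans ?_)
        by_cases hab : a = b <;> simp [Matrix.one_apply, hab] }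
  have hu : ∀ f, Matrix.GeneralLinearGroup.map (Pi.evalRingHom R f) u = g f := fun f => by
    ext a b
    rfl
  refine ⟨∀ f, R f, inferInstance, inferInstance, u, ?_, ?_⟩
  · intro p hp
    funext f
    have e : Matrix.GeneralLinearGroup.map (Pi.evalAlgHom ℚ R f).toRingHom u = g f := hu f
    have h := evalMat_map (Pi.evalAlgHom ℚ R f) u p
    rw [e, hg f p hp] at h
    exact h.symm
  · intro p hp
    by_contra hcon
    refine hne ⟨p, hcon⟩ ?_
    let φ : (∀ f, R f) →ₐ[ℤ] R ⟨p, hcon⟩ := (Pi.evalRingHom R ⟨p, hcon⟩).toIntAlgHom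
    have e : Matrix.GeneralLinearGroup.map φ.toRingHom u = g ⟨p, hcon⟩ := hu _
    have h := evalMat_map φ u p
    rw [e] at h
    exact h.trans ((congrArg φ hp).trans (map_zero φ))

theorem closure_mul {S : Type} [CommRing S] (g h : GL (Fin n) S)
    (hg : ∀ f ∈ G.intIdeal, evalMat ℤ g f = 0) (hh : ∀ f ∈ G.intIdeal, evalMat ℤ h f = 0) :
    ∀ f ∈ G.intIdeal, evalMat ℤ (g * h) f = 0 := by
  intro f hf
  obtain ⟨C, _, _, u, hu, hI⟩ := G.exists_generic
  let B := MvPolynomial (Fin n × Fin n) ℤ ⧸ G.intIdeal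
  let ι : B →ₐ[ℤ] C := Ideal.Quotient.liftₐ G.intIdeal (evalMat ℤ u) fun p hp => hp C u hu
  have hι : Function.Injective ι := by
    rw [injective_iff_map_eq_zero]
    intro b hb
    obtain ⟨p, rfl⟩ := Ideal.Quotient.mk_surjective b
    exact Ideal.Quotient.eq_zero_iff_mem.mpr (hI p hb)
  have : Module.IsTorsionFree ℤ C := by
    have : Module.IsTorsionFree ℚ C := inferInstance
    exact Module.IsTorsionFree.trans ℚ
  have : Module.IsTorsionFree ℤ B := hι.moduleIsTorsionFree ι (fun c x => map_zsmul ι c x)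
  let x : Fin n → Fin n → B := fun i j => Ideal.Quotient.mk _ (MvPolynomial.X (i, j))
  let D : MvPolynomial (Fin n × Fin n) ℤ →ₐ[ℤ] (B ⊗[ℤ] B) :=
    MvPolynomial.aeval fun ij => ∑ k, x ij.1 k ⊗ₜ[ℤ] x k ij.2
  let ιι : B ⊗[ℤ] B →ₐ[ℤ] C ⊗[ℤ] C := Algebra.TensorProduct.map ι ι
  have hιι : Function.Injective ιι :=
    TensorProduct.map_injective_of_flat_flat ι.toLinearMap ι.toLinearMap hι hι
  let u₁ := Matrix.GeneralLinearGroup.map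
    (Algebra.TensorProduct.includeLeft : C →ₐ[ℤ] C ⊗[ℤ] C).toRingHom u
  let u₂ := Matrix.GeneralLinearGroup.map
    (Algebra.TensorProduct.includeRight : C →ₐ[ℤ] C ⊗[ℤ] C).toRingHom u
  have hu12 : u₁ * u₂ ∈ G.pts (C ⊗[ℤ] C) :=
    mul_mem (G.map_mem_pts _ hu) (G.map_mem_pts _ hu)
  have hιx : ∀ i j, ι (x i j) = u.1 i j := fun i j => by
    change evalMat ℤ u (MvPolynomial.X (i, j)) = _
    simp [evalMat]
  have e1 : ιι.comp D = evalMat ℤ (u₁ * u₂) := by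
    apply MvPolynomial.algHom_ext
    rintro ⟨i, j⟩
    simp [D, ιι, evalMat, u₁, u₂, Matrix.mul_apply, hιx]
  have hD : D f = 0 := by
    apply hιι
    rw [map_zero, ← AlgHom.comp_apply, e1]
    exact hf _ _ hu12
  let βg : B →ₐ[ℤ] S := Ideal.Quotient.liftₐ G.intIdeal (evalMat ℤ g) hg
  let βh : B →ₐ[ℤ] S := Ideal.Quotient.liftₐ G.intIdeal (evalMat ℤ h) hh
  have hgx : ∀ i j, βg (x i j) = g.1 i j := fun i j => by
    change evalMat ℤ g (MvPolynomial.X (i, j)) = _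
    simp [evalMat]
  have hhx : ∀ i j, βh (x i j) = h.1 i j := fun i j => by
    change evalMat ℤ h (MvPolynomial.X (i, j)) = _
    simp [evalMat]
  have e2 : (Algebra.TensorProduct.productMap βg βh).comp D = evalMat ℤ (g * h) := by
    apply MvPolynomial.algHom_ext
    rintro ⟨i, j⟩
    simp [D, evalMat, Matrix.mul_apply, hgx, hhx]
  rw [← e2, AlgHom.comp_apply, hD, map_zero]

theorem exists_inv_poly (f : MvPolynomial (Fin n × Fin n) ℤ) :
    ∃ (N : ℕ) (f' : MvPolynomial (Fin n × Fin n) ℤ), ∀ (S : Type) [CommRing S]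
      (g : GL (Fin n) S), evalMat ℤ g f' =
        (g : Matrix (Fin n) (Fin n) S).det ^ N * evalMat ℤ g⁻¹ f := by
  let X : Matrix (Fin n) (Fin n) (MvPolynomial (Fin n × Fin n) ℤ) :=
    Matrix.of fun i j => MvPolynomial.X (i, j)
  have hX : ∀ (S : Type) [CommRing S] (g : GL (Fin n) S),
      (evalMat ℤ g).mapMatrix X = (g : Matrix (Fin n) (Fin n) S) := by
    intro S _ g
    ext i j
    simp [X, evalMat]
  have hdet : ∀ (S : Type) [CommRing S] (g : GL (Fin n) S),
      evalMat ℤ g X.det = (g : Matrix (Fin n) (Fin n) S).det := by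
    intro S _ g
    rw [AlgHom.map_det, hX]
  have hadj : ∀ (S : Type) [CommRing S] (g : GL (Fin n) S) (i j : Fin n),
      evalMat ℤ g (X.adjugate i j) = (g : Matrix (Fin n) (Fin n) S).det *
        (g⁻¹ : GL (Fin n) S).1 i j := by
    intro S _ g i j
    have h1 : (evalMat ℤ g).mapMatrix X.adjugate = (g : Matrix (Fin n) (Fin n) S).adjugate := by
      rw [AlgHom.map_adjugate, hX]
    have h2 : (g : Matrix (Fin n) (Fin n) S).adjugate =
        (g : Matrix (Fin n) (Fin n) S).det • (g⁻¹ : GL (Fin n) S).1 := by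
      calc (g : Matrix (Fin n) (Fin n) S).adjugate
          = (g⁻¹ : GL (Fin n) S).1 * (g.1 * g.1.adjugate) := by
            rw [← mul_assoc, Units.inv_mul, one_mul]
        _ = _ := by rw [Matrix.mul_adjugate, mul_smul_comm, mul_one]
    have h3 := congrFun (congrFun (h1.trans h2) i) j
    exact h3
  induction f using MvPolynomial.induction_on with
  | C z => exact ⟨0, MvPolynomial.C z, fun S _ g => by simp [evalMat]⟩
  | add p p' hp hp' =>
    obtain ⟨N, r, hr⟩ := hp
    obtain ⟨N', r', hr'⟩ := hp'
    refine ⟨N + N', X.det ^ N' * r + X.det ^ N * r', fun S _ g => ?_⟩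
    rw [map_add, map_mul, map_mul, map_pow, map_pow, hdet, hr, hr', map_add]
    ring
  | mul_X p ij hp =>
    obtain ⟨N, r, hr⟩ := hp
    refine ⟨N + 1, r * X.adjugate ij.1 ij.2, fun S _ g => ?_⟩
    rw [map_mul, hr, hadj, map_mul]
    simp only [evalMat, MvPolynomial.aeval_X]
    ring

/-- The group of `S`-points, for an arbitrary ring `S`, of the scheme-theoretic closure of `G`
in the group scheme `GL_n` over `ℤ`. -/
def closurePts (S : Type) [CommRing S] : Subgroup (GL (Fin n) S) where
  carrier := {g | ∀ f ∈ G.intIdeal, evalMat ℤ g f = 0}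
  one_mem' := by
    intro f hf
    have h := hf ℚ 1 (one_mem _)
    have h1 : (algebraMap ℤ ℚ) (evalMat ℤ (1 : GL (Fin n) ℤ) f) = 0 := by
      rw [← h, ← map_one (Matrix.GeneralLinearGroup.map (Algebra.ofId ℤ ℚ).toRingHom),
        evalMat_map]
      rfl
    have h2 := evalMat_map (Algebra.ofId ℤ S) (1 : GL (Fin n) ℤ) f
    rw [map_one, (map_eq_zero_iff _ (algebraMap ℤ ℚ).injective_int).mp h1, map_zero] at h2
    exact h2
  mul_mem' := fun {g h} hg hh => G.closure_mul g h hg hh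
  inv_mem' := by
    intro g hg f hf
    obtain ⟨N, f', hf'⟩ := exists_inv_poly f
    have h1 : f' ∈ G.intIdeal := fun R _ _ v hv => by
      rw [hf', hf R v⁻¹ (inv_mem hv), mul_zero]
    have h2 := hg f' h1
    rw [hf'] at h2
    have h3 : IsUnit ((g : Matrix (Fin n) (Fin n) S).det ^ N) :=
      ((Matrix.isUnit_iff_isUnit_det _).mp g.isUnit).pow N
    exact (h3.mul_right_eq_zero).mp h2

/-- `G` is contained in `U_n ⊗ ℚ`, the group of upper unitriangular matrices. -/
def LeUni : Prop :=
  ∀ (R : Type) [CommRing R] [Algebra ℚ R], ∀ g ∈ G.pts R, ∀ i j : Fin n,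
    (j < i → (g : Matrix (Fin n) (Fin n) R) i j = 0) ∧ (g : Matrix (Fin n) (Fin n) R) i i = 1

/-- `G` is unipotent: all its points are unipotent matrices. -/
def IsUnip : Prop :=
  ∀ (R : Type) [CommRing R] [Algebra ℚ R], ∀ g ∈ G.pts R,
    IsNilpotent ((g : Matrix (Fin n) (Fin n) R) - 1)

/-- `G` is commutative. -/
def IsComm : Prop :=
  ∀ (R : Type) [CommRing R] [Algebra ℚ R], ∀ g ∈ G.pts R, ∀ h ∈ G.pts R, g * h = h * g

/-- `G` is nilpotent of class at most `2`, i.e. commutators are central. -/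
def ClassLeTwo : Prop :=
  ∀ (R : Type) [CommRing R] [Algebra ℚ R], ∀ g ∈ G.pts R, ∀ h ∈ G.pts R, ∀ k ∈ G.pts R,
    g * h * g⁻¹ * h⁻¹ * k = k * (g * h * g⁻¹ * h⁻¹)

/-- The orbit relation of a group of matrices acting on row vectors by right multiplication. -/
def orbitSetoid {S : Type} [CommRing S] (H : Subgroup (GL (Fin n) S)) : Setoid (Fin n → S) where
  r v w := ∃ g ∈ H, v ᵥ* (g : Matrix (Fin n) (Fin n) S) = w
  iseqv := by
    refine ⟨fun v => ⟨1, one_mem _, by simp⟩, ?_, ?_⟩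
    · rintro v _ ⟨g, hg, rfl⟩
      refine ⟨g⁻¹, inv_mem hg, ?_⟩
      rw [Matrix.vecMul_vecMul, Units.mul_inv, Matrix.vecMul_one]
    · rintro v _ _ ⟨g, hg, rfl⟩ ⟨h, hh, rfl⟩
      refine ⟨g * h, mul_mem hg hh, ?_⟩
      rw [Matrix.vecMul_vecMul, Units.val_mul]

theorem orbits_le : ∃ d : ℕ, ∀ q : PP,
    Nat.card (Quotient (orbitSetoid (G.closurePts (Fq q)))) ≤ q.1 ^ d := by
  refine ⟨n, fun q => ?_⟩
  have h : Nat.card (Fin n → Fq q) = q.1 ^ n := by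
    rw [Nat.card_fun, card_Fq, Nat.card_eq_fintype_card, Fintype.card_fin]
  rw [← h]
  exact Nat.card_le_card_of_surjective _ Quotient.mk_surjective

/-- The numbers of orbits of `G(F_q)` on `F_q ^ n`, as an element of `𝒬`. The element of `𝒬♭`
attached to `G` is its image. -/
def orbits : QQ :=
  algebraMap ZZ QQ (ofCount
    (fun q => Nat.card (Quotient (orbitSetoid (G.closurePts (Fq q))))) G.orbits_le)

theorem classes_le : ∃ d : ℕ, ∀ q : PP,
    Nat.card (ConjClasses (G.closurePts (Fq q))) ≤ q.1 ^ d := by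
  refine ⟨n * n, fun q => ?_⟩
  have h : Nat.card (Matrix (Fin n) (Fin n) (Fq q)) = q.1 ^ (n * n) := by
    change Nat.card (Fin n → Fin n → Fq q) = _
    rw [Nat.card_fun, Nat.card_fun, card_Fq, Nat.card_eq_fintype_card, Fintype.card_fin, pow_mul]
  rw [← h]
  have : Finite (Matrix (Fin n) (Fin n) (Fq q)) := inferInstanceAs (Finite (Fin n → Fin n → Fq q))
  have : Finite (GL (Fin n) (Fq q)) := Finite.of_injective _ Units.val_injective
  refine (Nat.card_le_card_of_surjective _ ConjClasses.mk_surjective).trans ?_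
  refine (Nat.card_le_card_of_injective _ Subtype.val_injective).trans ?_
  exact Nat.card_le_card_of_injective
    (fun g : GL (Fin n) (Fq q) => g.1) Units.val_injective

/-- The class numbers of the groups `G(F_q)`, as an element of `𝒬`. The element of `𝒬♭`
attached to `G` is its image. -/
def classes : QQ :=
  algebraMap ZZ QQ (ofCount (fun q => Nat.card (ConjClasses (G.closurePts (Fq q)))) G.classes_le)

end LinAlgGroup

end LinearGroups

end OrbitEnum

end

open OrbitEnum

namespace OrbitEnum

/-! ### Families of rational numbers and spans -/

/-! Elements of `𝒬` are determined by their values at prime powers, and elements of `𝒬♭` by their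
values outside finitely many characteristics (`QQ_ext`, `toFlat_ext`). An inclusion between spans
therefore reduces to counting over `F_q`, up to powers of `q`, and every invariant in sight counts
pairs. The average kernel size counts pairs `(a, x)` with `x * a = 0`; these are points of an affine
scheme over `ℤ`. Burnside's lemma turns the orbit numbers of `M_θ` into the same count. The product
of `k(G)` and the order of `G` counts commuting pairs, and in `G_θ` two elements commute exactly
when `a * a' = 0`.

For `H_θ` the commuting condition `v * a' = v' * a` is the vanishing of an alternating form on `M ⊕
V`, whence `²𝔄 ⊂ ⁻𝔄`. Detecting the same condition by additive characters yields the sum of squared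
kernel sizes of the dual representation `W* → Hom(V, M*)` (`quadCard_tform`). Duality is an
involution, so class numbers of Heisenberg groups span `²𝔄`.

Spans are algebras because the generators contain 1 and are closed under products: direct sums of
representations, fibre products of schemes. The immersive case follows from `(x, c) * a = (x * a, c
a)`: this extension is always immersive and changes the kernel only at `a = 0`, so the average moves
by an element of `ℤ[q, q⁻¹]` (`askSym_mfold_extRep`).

For unipotent `G` over `ℚ`, the exponential identifies the Lie algebra with `G`. A tangent vector
has its exponential in `G` because every equation of `G`, evaluated on `exp(XY)`, satisfies a
differential equation that kills all its coefficients (`IsTangent.X_pow_dvd`). Conversely, powers of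
a point give a polynomial curve through infinitely many points of `G`, so its logarithm is tangent
(`HasPt.isTangent_logA`). Rescaled by `N!`, both series have integral coefficients. With a basis of
a saturated lattice in the Lie algebra they parameterise the closure over finite fields in which
`N!` is nonzero (`exists_exp_parametrisation`). There, fixed vectors of `exp Y` form the kernel of
`Y`, and exponentials commute exactly when the tangent vectors do. So orbit numbers are kernel
averages, and class numbers are kernel averages of the alternating commutator map.

For the converse inclusions, extended representations are realised by groups `[1, a; 0, 1]` and Baer
groups by `[1, a, y; 0, 1, b(a); 0, 0, 1]`. Their points over every ring are described by the same
linear forms (`LinearSubgroup.mem_closurePts_iff`). -/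

theorem evalQ_qQ (q : PP) : evalQ q qQ = q.1 := by
  rw [qQ, evalQ_algebraMap]
  simp [qZ, ofCount]

theorem PP.ne_zero (q : PP) : (q.1 : ℚ) ≠ 0 := by
  have := q.two_le
  exact_mod_cast (by omega : q.1 ≠ 0)

theorem qQ_mul_qInv : qQ * qInv = 1 := IsLocalization.Away.mul_invSelf (S := QQ) qZ

theorem exists_eq_mul_qInv_pow (x : QQ) : ∃ (a : ZZ) (n : ℕ), x = algebraMap ZZ QQ a * qInv ^ n := by
  obtain ⟨n, a, h⟩ := IsLocalization.Away.surj (S := QQ) qZ x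
  refine ⟨a, n, ?_⟩
  rw [← h]
  change x = x * qQ ^ n * qInv ^ n
  rw [mul_assoc, ← mul_pow, qQ_mul_qInv, one_pow, mul_one]

theorem evalQ_mul_qInv_pow (q : PP) (a : ZZ) (n : ℕ) :
    evalQ q (algebraMap ZZ QQ a * qInv ^ n) = a.1 q / (q.1 : ℚ) ^ n := by
  rw [map_mul, map_pow, evalQ_algebraMap, evalQ_qInv, inv_pow, div_eq_mul_inv]

theorem qZ_pow_mul_sub_apply {q : PP} {a b : ZZ} {m n : ℕ}
    (h : evalQ q (algebraMap ZZ QQ a * qInv ^ n) = evalQ q (algebraMap ZZ QQ b * qInv ^ m)) :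
    (a * qZ ^ m - b * qZ ^ n).1 q = 0 := by
  rw [evalQ_mul_qInv_pow, evalQ_mul_qInv_pow, div_eq_div_iff (pow_ne_zero _ q.ne_zero)
    (pow_ne_zero _ q.ne_zero)] at h
  change a.1 q * (q.1 : ℤ) ^ m - b.1 q * (q.1 : ℤ) ^ n = 0
  have : a.1 q * (q.1 : ℤ) ^ m = b.1 q * (q.1 : ℤ) ^ n := by exact_mod_cast h
  rw [this, sub_self]

theorem mul_qInv_pow_eq {R : Type*} [CommRing R] {Q Q' a b : R} {m n : ℕ} (hQ : Q * Q' = 1)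
    (h : a * Q ^ m - b * Q ^ n = 0) : a * Q' ^ n = b * Q' ^ m := by
  have h1 : Q ^ m * Q' ^ m = 1 := by rw [← mul_pow, hQ, one_pow]
  have h2 : Q ^ n * Q' ^ n = 1 := by rw [← mul_pow, hQ, one_pow]
  linear_combination Q' ^ n * Q' ^ m * h - a * Q' ^ n * h1 + b * Q' ^ m * h2

/-- After multiplication by a power of `q` both sides lie in `𝒵`, where families are compared
entrywise. Later identities in `𝒬` are proved one `q` at a time. -/
theorem QQ_ext {x y : QQ} (h : ∀ q, evalQ q x = evalQ q y) : x = y := by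
  obtain ⟨a, n, rfl⟩ := exists_eq_mul_qInv_pow x
  obtain ⟨b, m, rfl⟩ := exists_eq_mul_qInv_pow y
  have h0 : a * qZ ^ m - b * qZ ^ n = 0 := Subtype.ext (funext fun q => qZ_pow_mul_sub_apply (h q))
  have h1 := congrArg (algebraMap ZZ QQ) h0
  simp only [map_sub, map_mul, map_pow, map_zero] at h1
  exact mul_qInv_pow_eq qQ_mul_qInv h1

/-- The difference, cleared of denominators, vanishes for all `q` prime to `N` and so lies in
`smallPrimes`. -/
theorem toFlat_ext {x y : QQ} (N : ℕ) (hN : 1 ≤ N)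
    (h : ∀ q : PP, Nat.gcd q.1 N = 1 → evalQ q x = evalQ q y) : toFlat x = toFlat y := by
  obtain ⟨a, n, rfl⟩ := exists_eq_mul_qInv_pow x
  obtain ⟨b, m, rfl⟩ := exists_eq_mul_qInv_pow y
  have h0 : a * qZ ^ m - b * qZ ^ n ∈ smallPrimes :=
    ⟨N, hN, fun q hq => qZ_pow_mul_sub_apply (h q hq)⟩
  have h1 : toFlat (algebraMap ZZ QQ (a * qZ ^ m - b * qZ ^ n)) = 0 := by
    have h2 : toFlat (algebraMap ZZ QQ (a * qZ ^ m - b * qZ ^ n)) =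
        algebraMap ZZflat QQflat (Ideal.Quotient.mk smallPrimes (a * qZ ^ m - b * qZ ^ n)) := by
      unfold toFlat Localization.awayMap IsLocalization.Away.map
      exact IsLocalization.map_eq (S := QQ) _ _
    rw [h2, Ideal.Quotient.eq_zero_iff_mem.mpr h0, RingHom.map_zero]
  rw [RingHom.map_sub, RingHom.map_mul, RingHom.map_mul, RingHom.map_pow, RingHom.map_pow,
    RingHom.map_sub, RingHom.map_mul, RingHom.map_mul, RingHom.map_pow, RingHom.map_pow] at h1
  rw [RingHom.map_mul, RingHom.map_mul, RingHom.map_pow, RingHom.map_pow]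
  refine mul_qInv_pow_eq (Q := toFlat qQ) ?_ h1
  rw [← RingHom.map_mul, qQ_mul_qInv, RingHom.map_one]

section Span

variable {s : Deco}

theorem smul_mem_laurentSpan {S : Set QQ} {u x : QQ} (hu : s.proj u ∈ Laurent s)
    (hx : s.proj x ∈ laurentSpan s S) : s.proj (u * x) ∈ laurentSpan s S := by
  rw [map_mul]
  exact Submodule.smul_mem _ (⟨s.proj u, hu⟩ : Laurent s) hx

theorem proj_qQ_mem : s.proj qQ ∈ Laurent s := Algebra.subset_adjoin (by simp)

theorem proj_qInv_mem : s.proj qInv ∈ Laurent s := Algebra.subset_adjoin (by simp)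

theorem proj_qQ_pow_mul_qInv_pow_mem (i j : ℕ) : s.proj (qQ ^ i * qInv ^ j) ∈ Laurent s := by
  rw [map_mul, map_pow, map_pow]
  exact mul_mem (pow_mem proj_qQ_mem i) (pow_mem proj_qInv_mem j)

theorem proj_mem_laurentSpan {S : Set QQ} {x : QQ} (hx : x ∈ S) : s.proj x ∈ laurentSpan s S :=
  Submodule.subset_span ⟨x, hx, rfl⟩

theorem laurentSpan_le {S : Set QQ} {A : Submodule (Laurent s) s.Q}
    (h : ∀ x ∈ S, s.proj x ∈ A) : laurentSpan s S ≤ A := by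
  refine Submodule.span_le.mpr ?_
  rintro _ ⟨x, hx, rfl⟩
  exact h x hx

/-- A family whose values are those of a generator up to a fixed power of `q`, in almost all
characteristics, lies in the span. -/
theorem proj_mem_of_evalQ {S : Set QQ} {x t : QQ} (ht : t ∈ S) (i j : ℕ)
    (h : ∀ q : PP, (q.1 : ℚ) ^ j * evalQ q x = (q.1 : ℚ) ^ i * evalQ q t) :
    s.proj x ∈ laurentSpan s S := by
  have : x = qQ ^ i * qInv ^ j * t := by
    refine QQ_ext fun q => ?_
    simp only [map_mul, map_pow, evalQ_qQ, evalQ_qInv]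
    have h1 : (q.1 : ℚ) ^ j * (q.1 : ℚ)⁻¹ ^ j = 1 := by
      rw [← mul_pow, mul_inv_cancel₀ q.ne_zero, one_pow]
    linear_combination (q.1 : ℚ)⁻¹ ^ j * h q - evalQ q x * h1
  rw [this]
  exact smul_mem_laurentSpan (proj_qQ_pow_mul_qInv_pow_mem i j) (proj_mem_laurentSpan ht)

/-- The form needed for unipotent groups, whose exponential is only available for `q` prime to some
`N`. -/
theorem proj_mem_of_evalQ_flat {S : Set QQ} {x t : QQ} (ht : t ∈ S) (i j N : ℕ) (hN : 1 ≤ N)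
    (h : ∀ q : PP, Nat.gcd q.1 N = 1 →
      (q.1 : ℚ) ^ j * evalQ q x = (q.1 : ℚ) ^ i * evalQ q t) :
    Deco.flat.proj x ∈ laurentSpan .flat S := by
  have : Deco.flat.proj x = Deco.flat.proj (qQ ^ i * qInv ^ j * t) := by
    refine toFlat_ext N hN fun q hq => ?_
    simp only [map_mul, map_pow, evalQ_qQ, evalQ_qInv]
    have h1 : (q.1 : ℚ) ^ j * (q.1 : ℚ)⁻¹ ^ j = 1 := by
      rw [← mul_pow, mul_inv_cancel₀ q.ne_zero, one_pow]
    linear_combination (q.1 : ℚ)⁻¹ ^ j * h q hq - evalQ q x * h1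
  rw [this]
  exact smul_mem_laurentSpan (proj_qQ_pow_mul_qInv_pow_mem i j) (proj_mem_laurentSpan ht)

/-- The image of `S` is already a multiplicative monoid, so the algebra it generates is no larger
than its linear span. -/
theorem isSubalg_laurentSpan {S : Set QQ} (h1 : 1 ∈ S) (hmul : ∀ x ∈ S, ∀ y ∈ S, x * y ∈ S) :
    IsSubalg (laurentSpan s S) := by
  refine ⟨Algebra.adjoin (Laurent s) (s.proj '' S), ?_⟩
  let P : Submonoid QQ := { carrier := S, one_mem' := h1, mul_mem' := fun {x y} hx hy => hmul x hx y hy }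
  have : Submonoid.closure (s.proj '' S) = P.map s.proj := by
    have e : s.proj '' S = (P.map s.proj : Submonoid s.Q) := rfl
    rw [e, Submonoid.closure_eq]
  rw [Algebra.adjoin_eq_span, this]
  rfl

end Span

end OrbitEnum

namespace OrbitEnum

/-! ### Kernel sums -/

section KerSum

variable {R : Type} [CommRing R] {M V W : Type} [AddCommGroup M] [AddCommGroup V] [AddCommGroup W]
  [Module R M] [Module R V] [Module R W]

/-- The count of pairs through which kernel sums meet fixed points, commuting pairs and points of
schemes. -/
theorem kerSum_eq_card [Finite M] [Finite V] (θ : M →ₗ[R] V →ₗ[R] W) :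
    kerSum θ = Nat.card {p : M × V // θ p.1 p.2 = 0} := by
  have := Fintype.ofFinite M
  rw [kerSum, finsum_eq_sum_of_fintype, ← Nat.card_sigma]
  exact Nat.card_congr
    { toFun := fun t => ⟨(t.1, t.2.1), t.2.2⟩
      invFun := fun p => ⟨p.1.1, p.1.2, p.2⟩
      left_inv := fun _ => rfl
      right_inv := fun _ => rfl }

/-- Only the vanishing of products matters: bare bijections suffice, the two base rings may differ,
and the targets need not be related. -/
theorem kerSum_congr {R' : Type} [CommRing R'] {M' V' W' : Type} [AddCommGroup M']
    [AddCommGroup V'] [AddCommGroup W'] [Module R' M'] [Module R' V'] [Module R' W']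
    (θ : M →ₗ[R] V →ₗ[R] W) (θ' : M' →ₗ[R'] V' →ₗ[R'] W') (eM : M ≃ M') (eV : V ≃ V')
    (h : ∀ a x, θ a x = 0 ↔ θ' (eM a) (eV x) = 0) : kerSum θ = kerSum θ' := by
  refine finsum_eq_of_bijective eM eM.bijective fun a => ?_
  exact Nat.card_congr (eV.subtypeEquiv fun x => h a x)

/-- The bilinear map with given structure constants. -/
def tform (R : Type) [CommRing R] {ι κ μ : Type} [Fintype ι] [Fintype κ] (c : ι → κ → μ → ℤ) :
    (ι → R) →ₗ[R] (κ → R) →ₗ[R] (μ → R) :=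
  LinearMap.mk₂ R (fun a x l => ∑ i, ∑ j, (c i j l : R) * (a i * x j))
    (fun a b x => by ext l; simp [add_mul, mul_add, Finset.sum_add_distrib])
    (fun r a x => by
      ext l
      simp only [Pi.smul_apply, smul_eq_mul, Finset.mul_sum]
      exact Finset.sum_congr rfl fun i _ => Finset.sum_congr rfl fun j _ => by ring)
    (fun a x y => by ext l; simp [mul_add, Finset.sum_add_distrib])
    (fun r a x => by
      ext l
      simp only [Pi.smul_apply, smul_eq_mul, Finset.mul_sum]
      exact Finset.sum_congr rfl fun i _ => Finset.sum_congr rfl fun j _ => by ring)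

theorem tform_apply {ι κ μ : Type} [Fintype ι] [Fintype κ] (c : ι → κ → μ → ℤ) (a : ι → R)
    (x : κ → R) (l : μ) : tform R c a x l = ∑ i, ∑ j, (c i j l : R) * (a i * x j) := rfl

theorem tform_single {ι κ μ : Type} [Fintype ι] [Fintype κ] [DecidableEq ι] [DecidableEq κ]
    (c : ι → κ → μ → ℤ) (i : ι) (j : κ) (l : μ) :
    tform R c (Pi.single i 1) (Pi.single j 1) l = c i j l := by
  rw [tform_apply, Finset.sum_eq_single i, Finset.sum_eq_single j]
  · simp
  · intro b _ hb
    simp [hb]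
  · simp
  · intro b _ hb
    simp [hb]
  · simp

end KerSum

/-! ### Base change in coordinates -/

section BaseChange

variable {M V W : Type} [AddCommGroup M] [AddCommGroup V] [AddCommGroup W]

/-- Coordinates on a base change. -/
noncomputable def coords {ι : Type} [Finite ι] (b : Module.Basis ι ℤ M) (S : Type) [CommRing S] :
    (S ⊗[ℤ] M) ≃ₗ[S] (ι → S) := (b.baseChange S).equivFun

theorem coords_tmul {ι : Type} [Finite ι] (b : Module.Basis ι ℤ M) (S : Type) [CommRing S] (s : S)
    (m : M) (i : ι) : coords b S (s ⊗ₜ m) i = b.repr m i * s := by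
  simp [coords, Module.Basis.equivFun_apply]

/-- The structure constants of a module representation. -/
noncomputable def strConst {ι κ μ : Type} (bM : Module.Basis ι ℤ M) (bV : Module.Basis κ ℤ V)
    (bW : Module.Basis μ ℤ W) (θ : M →ₗ[ℤ] V →ₗ[ℤ] W) : ι → κ → μ → ℤ :=
  fun i j l => bW.repr (θ (bM i) (bV j)) l

/-- The structure constants are integers fixed once over `ℤ`; every base change is the same bilinear
form with its coefficients read in `S`. It is enough to compare both sides on basis vectors. -/
theorem coords_bc {ι κ μ : Type} [Fintype ι] [Fintype κ] [Finite μ] (bM : Module.Basis ι ℤ M)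
    (bV : Module.Basis κ ℤ V) (bW : Module.Basis μ ℤ W) (θ : M →ₗ[ℤ] V →ₗ[ℤ] W) (S : Type)
    [CommRing S] (a : S ⊗[ℤ] M) (x : S ⊗[ℤ] V) :
    coords bW S (bc S θ a x) =
      tform S (strConst bM bV bW θ) (coords bM S a) (coords bV S x) := by
  classical
  have h : (bc S θ).compr₂ (coords bW S).toLinearMap =
      (tform S (strConst bM bV bW θ)).compl₁₂ (coords bM S).toLinearMap
        (coords bV S).toLinearMap := by
    refine LinearMap.ext_basis (bM.baseChange S) (bV.baseChange S) fun i j => ?_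
    have hM : coords bM S (bM.baseChange S i) = Pi.single i 1 := by
      rw [coords]; ext k; simp [Finsupp.single_apply, Pi.single_apply, eq_comm]
    have hV : coords bV S (bV.baseChange S j) = Pi.single j 1 := by
      rw [coords]; ext k; simp [Finsupp.single_apply, Pi.single_apply, eq_comm]
    ext l
    simp only [LinearMap.compr₂_apply, LinearMap.compl₁₂_apply, LinearEquiv.coe_coe]
    rw [hM, hV, tform_single, Module.Basis.baseChange_apply, Module.Basis.baseChange_apply,
      bc_tmul, coords_tmul]
    simp [strConst]
  exact congrArg (fun f => f a x) h

theorem kerSum_bc_eq_tform {ι κ μ : Type} [Fintype ι] [Fintype κ] [Finite μ]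
    (bM : Module.Basis ι ℤ M) (bV : Module.Basis κ ℤ V) (bW : Module.Basis μ ℤ W)
    (θ : M →ₗ[ℤ] V →ₗ[ℤ] W) (S : Type) [CommRing S] :
    kerSum (bc S θ) = kerSum (tform S (strConst bM bV bW θ)) :=
  kerSum_congr _ _ (coords bM S).toEquiv (coords bV S).toEquiv fun a x => by
    change _ ↔ tform S _ (coords bM S a) (coords bV S x) = 0
    rw [← coords_bc, LinearEquiv.map_eq_zero_iff]

theorem strConst_tform {ι κ μ : Type} [Fintype ι] [Fintype κ] [Finite μ]
    (c : ι → κ → μ → ℤ) :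
    strConst (Pi.basisFun ℤ ι) (Pi.basisFun ℤ κ) (Pi.basisFun ℤ μ) (tform ℤ c) = c := by
  classical
  ext i j l
  simp [strConst, tform_single]

theorem kerSum_bc_tform {ι κ μ : Type} [Fintype ι] [Fintype κ] [Finite μ]
    (c : ι → κ → μ → ℤ) (S : Type) [CommRing S] :
    kerSum (bc S (tform ℤ c)) = kerSum (tform S c) := by
  rw [kerSum_bc_eq_tform (Pi.basisFun ℤ ι) (Pi.basisFun ℤ κ) (Pi.basisFun ℤ μ), strConst_tform]

/-! ### Multiples, direct sums and extensions of module representations -/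

theorem piRight_bc_mfold (S : Type) [CommRing S] (m : ℕ) (θ : M →ₗ[ℤ] V →ₗ[ℤ] W)
    (a : S ⊗[ℤ] M) (x : S ⊗[ℤ] (Fin m → V)) (r : Fin m) :
    TensorProduct.piRight ℤ S S (fun _ : Fin m => W) (bc S (mfold m θ) a x) r =
      bc S θ a (TensorProduct.piRight ℤ S S (fun _ : Fin m => V) x r) := by
  induction a using TensorProduct.induction_on with
  | zero => simp
  | add a b ha hb => simp only [map_add, LinearMap.add_apply, Pi.add_apply, ha, hb]
  | tmul s a =>
    induction x using TensorProduct.induction_on with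
    | zero => simp
    | add x y hx hy => simp only [map_add, Pi.add_apply, hx, hy]
    | tmul t x =>
      rw [bc_tmul]
      simp only [TensorProduct.piRight_apply, TensorProduct.piRightHom_tmul]
      rw [bc_tmul]
      rfl

/-- The size of the kernel of the map given by `a`. -/
noncomputable def kerCard {R : Type} [CommRing R] [Module R M] [Module R V] [Module R W]
    (θ : M →ₗ[R] V →ₗ[R] W) (a : M) : ℕ := Nat.card (LinearMap.ker (θ a))

/-- The kernel of an `m`-fold direct sum is the `m`-th power of the kernel, so `ask (ᵐθ)` is the
`m`-th moment of the kernel size. -/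
theorem kerCard_bc_mfold (S : Type) [CommRing S] (m : ℕ) (θ : M →ₗ[ℤ] V →ₗ[ℤ] W)
    (a : S ⊗[ℤ] M) : kerCard (bc S (mfold m θ)) a = kerCard (bc S θ) a ^ m := by
  have e : LinearMap.ker (bc S (mfold m θ) a) ≃ (Fin m → LinearMap.ker (bc S θ a)) :=
    ((TensorProduct.piRight ℤ S S (fun _ : Fin m => V)).toEquiv.subtypeEquiv
      (q := fun f : Fin m → S ⊗[ℤ] V => ∀ r, bc S θ a (f r) = 0) (fun x => by
        change bc S (mfold m θ) a x = 0 ↔ ∀ r, bc S θ a (TensorProduct.piRight ℤ S S _ x r) = 0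
        simp_rw [← piRight_bc_mfold]
        rw [← funext_iff (g := fun _ => 0)]
        exact (LinearEquiv.map_eq_zero_iff _).symm)).trans
      (Equiv.subtypePiEquivPi (p := fun _ y => bc S θ a y = 0))
  rw [kerCard, Nat.card_congr e, Nat.card_fun, Nat.card_eq_fintype_card (α := Fin m),
    Fintype.card_fin, kerCard]

variable {M' V' W' : Type} [AddCommGroup M'] [AddCommGroup V'] [AddCommGroup W']

/-- The direct sum of two module representations. -/
def prodRep (θ : M →ₗ[ℤ] V →ₗ[ℤ] W) (θ' : M' →ₗ[ℤ] V' →ₗ[ℤ] W') :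
    (M × M') →ₗ[ℤ] (V × V') →ₗ[ℤ] (W × W') :=
  LinearMap.mk₂ ℤ (fun a x => (θ a.1 x.1, θ' a.2 x.2))
    (fun a b x => by simp) (fun c a x => by simp) (fun a x y => by simp) (fun c a x => by simp)

theorem prodRight_bc_prodRep (S : Type) [CommRing S] (θ : M →ₗ[ℤ] V →ₗ[ℤ] W)
    (θ' : M' →ₗ[ℤ] V' →ₗ[ℤ] W') (a : S ⊗[ℤ] (M × M')) (x : S ⊗[ℤ] (V × V')) :
    TensorProduct.prodRight ℤ S S W W' (bc S (prodRep θ θ') a x) =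
      (bc S θ (TensorProduct.prodRight ℤ S S M M' a).1 (TensorProduct.prodRight ℤ S S V V' x).1,
        bc S θ' (TensorProduct.prodRight ℤ S S M M' a).2
          (TensorProduct.prodRight ℤ S S V V' x).2) := by
  induction a using TensorProduct.induction_on with
  | zero => simp [Prod.mk_zero_zero]
  | add a b ha hb => simp only [map_add, LinearMap.add_apply, Prod.fst_add, Prod.snd_add, ha, hb,
      Prod.mk_add_mk]
  | tmul s a =>
    induction x using TensorProduct.induction_on with
    | zero => simp [Prod.mk_zero_zero]
    | add x y hx hy => simp only [map_add, Prod.fst_add, Prod.snd_add, hx, hy, Prod.mk_add_mk]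
    | tmul t x =>
      rw [bc_tmul]
      simp only [TensorProduct.prodRight_tmul]
      rw [bc_tmul, bc_tmul]
      rfl

theorem kerCard_bc_prodRep (S : Type) [CommRing S] (θ : M →ₗ[ℤ] V →ₗ[ℤ] W)
    (θ' : M' →ₗ[ℤ] V' →ₗ[ℤ] W') (a : S ⊗[ℤ] (M × M')) :
    kerCard (bc S (prodRep θ θ')) a =
      kerCard (bc S θ) (TensorProduct.prodRight ℤ S S M M' a).1 *
        kerCard (bc S θ') (TensorProduct.prodRight ℤ S S M M' a).2 := by
  rw [kerCard, kerCard, kerCard, ← Nat.card_prod]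
  refine Nat.card_congr (((TensorProduct.prodRight ℤ S S V V').toEquiv.subtypeEquiv
      (q := fun f : (S ⊗[ℤ] V) × (S ⊗[ℤ] V') =>
        bc S θ (TensorProduct.prodRight ℤ S S M M' a).1 f.1 = 0 ∧
        bc S θ' (TensorProduct.prodRight ℤ S S M M' a).2 f.2 = 0) (fun x => ?_)).trans
      (Equiv.subtypeProdEquivProd
        (p := fun y => bc S θ (TensorProduct.prodRight ℤ S S M M' a).1 y = 0)
        (q := fun y => bc S θ' (TensorProduct.prodRight ℤ S S M M' a).2 y = 0)))
  change bc S (prodRep θ θ') a x = 0 ↔ _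
  rw [← LinearEquiv.map_eq_zero_iff (TensorProduct.prodRight ℤ S S W W'), prodRight_bc_prodRep]
  exact Prod.mk_eq_zero

/-- The extension `(x, c) * a = (x * a, c a)` of a module representation. -/
def extRep (θ : M →ₗ[ℤ] V →ₗ[ℤ] W) : M →ₗ[ℤ] (V × ℤ) →ₗ[ℤ] (W × M) :=
  LinearMap.mk₂ ℤ (fun a x => (θ a x.1, x.2 • a))
    (fun a b x => by simp) (fun c a x => Prod.ext (by simp) (smul_comm _ _ _))
    (fun a x y => by simp [add_smul]) (fun c a x => Prod.ext (by simp) (mul_smul _ _ _))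

theorem prodRight_bc_extRep (S : Type) [CommRing S] (θ : M →ₗ[ℤ] V →ₗ[ℤ] W)
    (a : S ⊗[ℤ] M) (x : S ⊗[ℤ] (V × ℤ)) :
    TensorProduct.prodRight ℤ S S W M (bc S (extRep θ) a x) =
      (bc S θ a (TensorProduct.prodRight ℤ S S V ℤ x).1,
        TensorProduct.rid ℤ S (TensorProduct.prodRight ℤ S S V ℤ x).2 • a) := by
  induction a using TensorProduct.induction_on with
  | zero => simp [Prod.mk_zero_zero]
  | add a b ha hb => simp only [map_add, LinearMap.add_apply, smul_add, ha, hb, Prod.mk_add_mk]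
  | tmul s a =>
    induction x using TensorProduct.induction_on with
    | zero => simp [Prod.mk_zero_zero]
    | add x y hx hy => simp only [map_add, Prod.fst_add, Prod.snd_add, hx, hy, Prod.mk_add_mk,
        add_smul]
    | tmul t x =>
      rw [bc_tmul]
      simp only [TensorProduct.prodRight_tmul]
      rw [bc_tmul]
      refine Prod.ext rfl ?_
      change (s * t) ⊗ₜ (x.2 • a) = _
      simp only [TensorProduct.rid_tmul]
      rw [TensorProduct.tmul_smul, TensorProduct.smul_tmul', TensorProduct.smul_tmul']
      congr 1
      simp only [zsmul_eq_mul, smul_eq_mul]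
      ring

/-- Over a field, `c • a = 0` forces `c = 0` unless `a = 0`. The additional coordinate is thus
invisible except at the zero map, where it is free. -/
theorem kerCard_bc_extRep (F : Type) [Field F] (θ : M →ₗ[ℤ] V →ₗ[ℤ] W) (a : F ⊗[ℤ] M)
    [Decidable (a = 0)] :
    kerCard (bc F (extRep θ)) a = kerCard (bc F θ) a * (if a = 0 then Nat.card F else 1) := by
  have e : LinearMap.ker (bc F (extRep θ) a) ≃ LinearMap.ker (bc F θ a) × {c : F // c • a = 0} :=
    (((TensorProduct.prodRight ℤ F F V ℤ).toEquiv.trans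
      ((Equiv.refl _).prodCongr (TensorProduct.rid ℤ F).toEquiv)).subtypeEquiv
      (q := fun f : (F ⊗[ℤ] V) × F => bc F θ a f.1 = 0 ∧ f.2 • a = 0) (fun x => by
        change bc F (extRep θ) a x = 0 ↔ _
        rw [← LinearEquiv.map_eq_zero_iff (TensorProduct.prodRight ℤ F F W M), prodRight_bc_extRep]
        exact Prod.mk_eq_zero)).trans
      (Equiv.subtypeProdEquivProd (p := fun y => bc F θ a y = 0) (q := fun c => c • a = 0))
  rw [kerCard, Nat.card_congr e, Nat.card_prod, kerCard]
  congr 1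
  split_ifs with h
  · subst h
    exact Nat.card_congr (Equiv.subtypeUnivEquiv fun c => smul_zero c)
  · refine Nat.card_eq_one_iff_unique.mpr ⟨⟨fun x y => Subtype.ext ?_⟩, ⟨0, zero_smul _ _⟩⟩
    rw [(smul_eq_zero.mp x.2).resolve_right h, (smul_eq_zero.mp y.2).resolve_right h]

end BaseChange

end OrbitEnum

namespace OrbitEnum

/-! ### Orbits and conjugacy classes -/

/-- Burnside's lemma, stated for a right action. -/
theorem card_quotient_mul_card {X H : Type} [Finite X] [Group H] [Finite H] (r : Setoid X)
    (act : H → X → X) (h1 : ∀ x, act 1 x = x) (hmul : ∀ g h x, act (g * h) x = act h (act g x))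
    (hr : ∀ x y, r x y ↔ ∃ g, act g x = y) :
    Nat.card (Quotient r) * Nat.card H = Nat.card {p : H × X // act p.1 p.2 = p.2} := by
  classical
  -- Inverting the group element turns the right action into a left one with the same orbits.
  let _ : MulAction H X :=
    { smul := fun g x => act g⁻¹ x
      one_smul := fun x => by change act 1⁻¹ x = x; rw [inv_one, h1]
      mul_smul := fun g h x => by
        change act (g * h)⁻¹ x = act g⁻¹ (act h⁻¹ x)
        rw [mul_inv_rev, hmul] }
  have hsmul : ∀ (g : H) (x : X), g • x = act g⁻¹ x := fun _ _ => rfl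
  have hrel : r = MulAction.orbitRel H X := by
    ext x y
    rw [hr, MulAction.orbitRel_apply, MulAction.mem_orbit_iff]
    constructor
    · rintro ⟨g, rfl⟩
      exact ⟨g, by rw [hsmul, ← hmul, mul_inv_cancel, h1]⟩
    · rintro ⟨g, rfl⟩
      exact ⟨g, by rw [hsmul, ← hmul, inv_mul_cancel, h1]⟩
  have := Fintype.ofFinite H
  have := Fintype.ofFinite X
  have h := MulAction.sum_card_fixedBy_eq_card_orbits_mul_card_group H X
  rw [hrel, Nat.card_eq_fintype_card, Nat.card_eq_fintype_card, ← h, ← Fintype.card_sigma,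
    ← Nat.card_eq_fintype_card]
  exact Nat.card_congr
    { toFun := fun t => ⟨(t.1⁻¹, t.2.1), t.2.2⟩
      invFun := fun p => ⟨p.1.1⁻¹, p.1.2, by
        change act p.1.1⁻¹⁻¹ p.1.2 = p.1.2
        rw [inv_inv, p.2]⟩
      left_inv := fun t => Sigma.subtype_ext (inv_inv _) rfl
      right_inv := fun p => by simp }

/-! ### Class numbers and orbit numbers as counts of pairs -/

section Counts

variable {R : Type} [CommRing R] {M V W : Type} [AddCommGroup M] [AddCommGroup V] [AddCommGroup W]
  [Module R M] [Module R V] [Module R W]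

/-- The number of commuting pairs in the Heisenberg-like group, up to central factors. -/
noncomputable def quadCard (θ : M →ₗ[R] V →ₗ[R] W) : ℕ :=
  Nat.card {p : (M × V) × (M × V) // θ p.2.1 p.1.2 = θ p.1.1 p.2.2}

theorem heis_mul (θ : M →ₗ[R] V →ₗ[R] W) (g h : Heis θ) :
    g * h = ⟨g.a + h.a, g.v + h.v, h.w + θ h.a g.v + g.w⟩ := rfl

theorem heis_commute_iff (θ : M →ₗ[R] V →ₗ[R] W) (g h : Heis θ) :
    Commute g h ↔ θ h.a g.v = θ g.a h.v := by
  rw [commute_iff_eq, heis_mul, heis_mul, Heis.mk.injEq]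
  constructor
  · rintro ⟨-, -, h3⟩
    have h4 : θ h.a g.v + (h.w + g.w) = θ g.a h.v + (h.w + g.w) := by
      calc _ = h.w + θ h.a g.v + g.w := by abel
        _ = _ := h3
        _ = _ := by abel
    exact add_right_cancel h4
  · intro h3
    refine ⟨add_comm _ _, add_comm _ _, ?_⟩
    rw [h3]
    abel

/-- The class number times the group order is the number of commuting pairs, and commutation ignores
the two central coordinates `w`. -/
theorem card_conjClasses_heis (θ : M →ₗ[R] V →ₗ[R] W) :
    Nat.card (ConjClasses (Heis θ)) * (Nat.card M * (Nat.card V * Nat.card W)) =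
      quadCard θ * (Nat.card W * Nat.card W) := by
  have e : Heis θ ≃ M × V × W :=
    { toFun := fun g => (g.a, g.v, g.w)
      invFun := fun t => ⟨t.1, t.2.1, t.2.2⟩
      left_inv := fun _ => rfl
      right_inv := fun _ => rfl }
  have h := card_comm_eq_card_conjClasses_mul_card (Heis θ)
  rw [Nat.card_congr e, Nat.card_prod, Nat.card_prod] at h
  rw [← h, quadCard, ← Nat.card_prod, ← Nat.card_prod]
  exact Nat.card_congr
    { toFun := fun p => (⟨((p.1.1.a, p.1.1.v), (p.1.2.a, p.1.2.v)),
        (heis_commute_iff θ _ _).mp p.2⟩, (p.1.1.w, p.1.2.w))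
      invFun := fun p => ⟨(⟨p.1.1.1.1, p.1.1.1.2, p.2.1⟩, ⟨p.1.1.2.1, p.1.1.2.2, p.2.2⟩),
        (heis_commute_iff θ _ _).mpr p.1.2⟩
      left_inv := fun _ => rfl
      right_inv := fun _ => rfl }

theorem card_conjClasses_baer (S : Type) [CommRing S] {M W : Type} [AddCommGroup M]
    [AddCommGroup W] [Module.Free ℤ M] [Module.Finite ℤ M] [Module.Free ℤ W] [Module.Finite ℤ W]
    [Finite S] (θ : M →ₗ[ℤ] M →ₗ[ℤ] W) (hθ : ∀ a, θ a a = 0) :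
    Nat.card (ConjClasses (BaerPts S θ)) * (Nat.card (S ⊗[ℤ] M) * Nat.card (S ⊗[ℤ] W)) =
      kerSum (bc S θ) * (Nat.card (S ⊗[ℤ] W) * Nat.card (S ⊗[ℤ] W)) := by
  have : Finite (S ⊗[ℤ] M) := Module.finite_of_finite S
  have hc : ∀ g h : BaerPts S θ, Commute g h ↔ bc S θ h.a g.a = 0 := by
    intro g h
    have h1 := BaerPts.commutator S θ hθ g h
    have h2 : Commute g h ↔ g⁻¹ * h⁻¹ * g * h = 1 := by
      rw [commute_iff_eq, ← mul_inv_rev, mul_assoc, inv_mul_eq_one, eq_comm]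
    rw [h2, h1]
    change (Baer.mk _ _ : BaerPts S θ) = Baer.mk _ _ ↔ _
    rw [Baer.mk.injEq]
    exact and_iff_right rfl
  have e : BaerPts S θ ≃ (S ⊗[ℤ] M) × (S ⊗[ℤ] W) :=
    { toFun := fun g => (g.a, g.y)
      invFun := fun t => ⟨t.1, t.2⟩
      left_inv := fun _ => rfl
      right_inv := fun _ => rfl }
  have h := card_comm_eq_card_conjClasses_mul_card (BaerPts S θ)
  rw [Nat.card_congr e, Nat.card_prod] at h
  rw [← h, kerSum_eq_card, ← Nat.card_prod, ← Nat.card_prod]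
  exact Nat.card_congr
    { toFun := fun p => (⟨(p.1.2.a, p.1.1.a), (hc _ _).mp p.2⟩, (p.1.1.y, p.1.2.y))
      invFun := fun p => ⟨(⟨p.1.1.2, p.2.1⟩, ⟨p.1.1.1, p.2.2⟩), (hc _ _).mpr p.1.2⟩
      left_inv := fun _ => rfl
      right_inv := fun _ => rfl }

/-- In Burnside's lemma, `a` fixes `(x, y)` exactly when `x * a = 0`, and `y` remains free. -/
theorem card_transv (S : Type) [CommRing S] [Finite S] {M V W : Type} [AddCommGroup M]
    [AddCommGroup V] [AddCommGroup W] [Module.Finite ℤ M] [Module.Finite ℤ V] [Module.Finite ℤ W]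
    (θ : M →ₗ[ℤ] V →ₗ[ℤ] W) :
    Nat.card (Quotient (transvSetoid S θ)) * Nat.card (S ⊗[ℤ] M) =
      kerSum (bc S θ) * Nat.card (S ⊗[ℤ] W) := by
  have : Finite (S ⊗[ℤ] M) := Module.finite_of_finite S
  have : Finite (S ⊗[ℤ] V) := Module.finite_of_finite S
  have : Finite (S ⊗[ℤ] W) := Module.finite_of_finite S
  have h := card_quotient_mul_card (H := Multiplicative (S ⊗[ℤ] M)) (transvSetoid S θ)
    (fun a p => (p.1, bc S θ a.toAdd p.1 + p.2)) (fun p => by simp)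
    (fun a b p => by simp [add_comm, add_left_comm]) (fun x y => Iff.rfl)
  rw [Nat.card_congr (Multiplicative.toAdd (α := S ⊗[ℤ] M))] at h
  rw [h, kerSum_eq_card, ← Nat.card_prod]
  exact Nat.card_congr
    { toFun := fun p => (⟨(p.1.1.toAdd, p.1.2.1), by
        simpa using congrArg Prod.snd p.2⟩, p.1.2.2)
      invFun := fun p => ⟨(Multiplicative.ofAdd p.1.1.1, (p.1.1.2, p.2)),
        Prod.ext rfl (by
          change bc S θ p.1.1.1 p.1.1.2 + p.2 = p.2
          rw [p.1.2, zero_add])⟩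
      left_inv := fun _ => rfl
      right_inv := fun _ => rfl }

theorem quadCard_congr {R' : Type} [CommRing R'] {M' V' W' : Type} [AddCommGroup M']
    [AddCommGroup V'] [AddCommGroup W'] [Module R' M'] [Module R' V'] [Module R' W']
    (θ : M →ₗ[R] V →ₗ[R] W) (θ' : M' →ₗ[R'] V' →ₗ[R'] W') (eM : M ≃ M') (eV : V ≃ V')
    (eW : W ≃ W') (h : ∀ a x, eW (θ a x) = θ' (eM a) (eV x)) : quadCard θ = quadCard θ' :=
  Nat.card_congr (((eM.prodCongr eV).prodCongr (eM.prodCongr eV)).subtypeEquiv fun p => by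
    change _ ↔ θ' (eM p.2.1) (eV p.1.2) = θ' (eM p.1.1) (eV p.2.2)
    rw [← h, ← h, eW.apply_eq_iff_eq])

end Counts

/-! ### Duality -/

section Duality

variable {F : Type} [Field F] [Finite F]

/-- Orthogonality of characters: a nonzero coordinate of `w` makes `φ ↦ ψ (φ ⬝ᵥ w)` nontrivial,
since `ψ` is primitive. -/
theorem sum_addChar_dotProduct {μ : Type} [Fintype μ] [Fintype F] [DecidableEq μ]
    {ψ : AddChar F ℂ} (hψ : ψ.IsPrimitive) (w : μ → F) [Decidable (w = 0)] :
    ∑ φ : μ → F, ψ (φ ⬝ᵥ w) = if w = 0 then (Fintype.card (μ → F) : ℂ) else 0 := by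
  let χ : AddChar (μ → F) ℂ := ψ.compAddMonoidHom
    { toFun := fun φ => φ ⬝ᵥ w, map_zero' := zero_dotProduct _, map_add' := fun x y => add_dotProduct x y w }
  have hχ : ∀ φ, χ φ = ψ (φ ⬝ᵥ w) := fun _ => rfl
  split_ifs with h
  · subst h
    simp
  · refine AddChar.sum_eq_zero_of_ne_one (ψ := χ) fun hχ1 => h (funext fun l => ?_)
    by_contra hl
    refine hψ hl (DFunLike.ext _ _ fun x => ?_)
    have h2 := DFunLike.congr_fun hχ1 (Pi.single l x)
    rw [hχ, single_dotProduct] at h2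
    rw [AddChar.mulShift_apply, mul_comm]
    exact h2

/-- The structure constants of the dual module representation `W* → Hom(V, M*)`. -/
def dualConst {ι κ μ : Type} (c : ι → κ → μ → ℤ) : μ → κ → ι → ℤ := fun l j i => c i j l

theorem dotProduct_tform {ι κ μ : Type} [Fintype ι] [Fintype κ] [Fintype μ]
    (c : ι → κ → μ → ℤ) (φ : μ → F) (a : ι → F) (v : κ → F) :
    φ ⬝ᵥ tform F c a v = a ⬝ᵥ tform F (dualConst c) φ v := by
  simp only [dotProduct, tform_apply, dualConst, Finset.mul_sum]
  rw [Finset.sum_comm]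
  refine Finset.sum_congr rfl fun i _ => Finset.sum_congr rfl fun l _ =>
    Finset.sum_congr rfl fun j _ => by ring

/-- The equation `v * a' = v' * a` is detected by summing characters over all functionals `φ` on the
target. For fixed `φ` the sum splits into one over `(a', v)` and one over `(a, v')`. Summing over
`a` first, each equals the size of the space of the `a` times the kernel size of `φ` in the dual
representation. Hence the square on the right. -/
theorem quadCard_tform {ι κ μ : Type} [Fintype ι] [Fintype κ] [Fintype μ]
    (c : ι → κ → μ → ℤ) :
    Nat.card (μ → F) * quadCard (tform F c) = Nat.card (ι → F) ^ 2 *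
      ∑ᶠ φ : μ → F, kerCard (tform F (dualConst c)) φ ^ 2 := by
  classical
  have := Fintype.ofFinite F
  rw [finsum_eq_sum_of_fintype]
  let ψ := AddChar.FiniteField.primitiveChar_to_Complex F
  have hψ : ψ.IsPrimitive := AddChar.FiniteField.primitiveChar_to_Complex_isPrimitive F
  -- The scalar `s` is used for `1` and `-1`, the signs of the two sides of the equation.
  have key : ∀ (φ : μ → F) (s : F), s ≠ 0 →
      ∑ p : (ι → F) × (κ → F), ψ (s * (φ ⬝ᵥ tform F c p.1 p.2)) =
        (Fintype.card (ι → F) : ℂ) * kerCard (tform F (dualConst c)) φ := by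
    intro φ s hs
    rw [Fintype.sum_prod_type, Finset.sum_comm]
    have : ∀ v : κ → F, ∑ a : ι → F, ψ (s * (φ ⬝ᵥ tform F c a v)) =
        if tform F (dualConst c) φ v = 0 then (Fintype.card (ι → F) : ℂ) else 0 := by
      intro v
      have h := sum_addChar_dotProduct hψ (s • tform F (dualConst c) φ v)
      simp only [dotProduct_smul, smul_eq_mul, ← dotProduct_tform, smul_eq_zero, hs, false_or] at h
      exact h
    rw [Finset.sum_congr rfl fun v _ => this v, Finset.sum_ite, Finset.sum_const_zero, add_zero,
      Finset.sum_const, nsmul_eq_mul, mul_comm, kerCard]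
    congr 2
    rw [Nat.card_eq_fintype_card, ← Fintype.card_subtype]
    exact Fintype.card_congr (Equiv.refl _)
  have main : ((Fintype.card (μ → F) * quadCard (tform F c) : ℕ) : ℂ) =
      ((Fintype.card (ι → F) ^ 2 * ∑ φ : μ → F, kerCard (tform F (dualConst c)) φ ^ 2 : ℕ) : ℂ) := by
    calc ((Fintype.card (μ → F) * quadCard (tform F c) : ℕ) : ℂ)
        = ∑ p : ((ι → F) × (κ → F)) × ((ι → F) × (κ → F)), ∑ φ : μ → F,
            ψ (φ ⬝ᵥ (tform F c p.2.1 p.1.2 - tform F c p.1.1 p.2.2)) := by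
          simp_rw [sum_addChar_dotProduct hψ, sub_eq_zero]
          rw [Finset.sum_ite, Finset.sum_const_zero, add_zero, Finset.sum_const, nsmul_eq_mul,
            quadCard, Nat.card_eq_fintype_card, Fintype.card_subtype]
          push_cast
          ring
      _ = ∑ φ : μ → F, (∑ p : (ι → F) × (κ → F), ψ (1 * (φ ⬝ᵥ tform F c p.1 p.2))) *
            ∑ p : (ι → F) × (κ → F), ψ ((-1) * (φ ⬝ᵥ tform F c p.1 p.2)) := by
          rw [Finset.sum_comm]
          refine Finset.sum_congr rfl fun φ _ => ?_
          rw [Finset.sum_mul_sum, ← Fintype.sum_prod_type']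
          -- Regrouping puts `a'` with `v` and `a` with `v'`, the variables that occur in a common
          -- term.
          let e : ((ι → F) × (κ → F)) × ((ι → F) × (κ → F)) ≃
              ((ι → F) × (κ → F)) × ((ι → F) × (κ → F)) :=
            { toFun := fun p => ((p.2.1, p.1.2), (p.1.1, p.2.2))
              invFun := fun p => ((p.2.1, p.1.2), (p.1.1, p.2.2))
              left_inv := fun _ => rfl
              right_inv := fun _ => rfl }
          refine Fintype.sum_equiv e _ _ fun p => ?_
          rw [← AddChar.map_add_eq_mul, dotProduct_sub]
          congr 1
          change _ = 1 * (φ ⬝ᵥ tform F c p.2.1 p.1.2) + -1 * (φ ⬝ᵥ tform F c p.1.1 p.2.2)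
          ring
      _ = _ := by
          push_cast
          rw [Finset.mul_sum]
          refine Finset.sum_congr rfl fun φ _ => ?_
          rw [key φ 1 one_ne_zero, key φ (-1) (neg_ne_zero.mpr one_ne_zero)]
          ring
  rw [Nat.card_eq_fintype_card, Nat.card_eq_fintype_card]
  exact_mod_cast main

end Duality

end OrbitEnum

namespace OrbitEnum

/-! ### The algebras generated by average sizes of kernels -/

section Values

variable {M V W : Type} [AddCommGroup M] [AddCommGroup V] [AddCommGroup W]
  [Module.Free ℤ M] [Module.Finite ℤ M] [Module.Free ℤ V] [Module.Finite ℤ V]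
  [Module.Free ℤ W] [Module.Finite ℤ W]

theorem evalQ_askSym_mul (θ : M →ₗ[ℤ] V →ₗ[ℤ] W) (q : PP) :
    evalQ q (askSym θ) * (q.1 : ℚ) ^ Module.finrank ℤ M = kerSum (bc (Fq q) θ) := by
  rw [evalQ_askSym, ask, card_tensor, Nat.cast_pow]
  exact div_mul_cancel₀ _ (pow_ne_zero _ q.ne_zero)

theorem kerSum_bc_mfold (S : Type) [CommRing S] (m : ℕ) (θ : M →ₗ[ℤ] V →ₗ[ℤ] W) :
    kerSum (bc S (mfold m θ)) = ∑ᶠ a, kerCard (bc S θ) a ^ m :=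
  finsum_congr fun a => kerCard_bc_mfold S m θ a

theorem evalQ_askSym_congr {M' V' W' : Type} [AddCommGroup M'] [AddCommGroup V'] [AddCommGroup W']
    [Module.Free ℤ M'] [Module.Finite ℤ M'] [Module.Free ℤ V'] [Module.Finite ℤ V']
    [Module.Free ℤ W'] [Module.Finite ℤ W'] (θ : M →ₗ[ℤ] V →ₗ[ℤ] W)
    (θ' : M' →ₗ[ℤ] V' →ₗ[ℤ] W') (hr : Module.finrank ℤ M = Module.finrank ℤ M') (q : PP)
    (h : kerSum (bc (Fq q) θ) = kerSum (bc (Fq q) θ')) :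
    evalQ q (askSym θ) = evalQ q (askSym θ') := by
  rw [evalQ_askSym, evalQ_askSym, ask, ask, card_tensor, card_tensor, hr, h]

theorem askSym_mfold_one (θ : M →ₗ[ℤ] V →ₗ[ℤ] W) : askSym (mfold 1 θ) = askSym θ :=
  QQ_ext fun q => evalQ_askSym_congr _ _ rfl q (by
    rw [kerSum_bc_mfold]
    exact finsum_congr fun a => pow_one _)

theorem finrank_prod_int {M' : Type} [AddCommGroup M'] [Module.Free ℤ M'] [Module.Finite ℤ M'] :
    Module.finrank ℤ (M × M') = Module.finrank ℤ M + Module.finrank ℤ M' :=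
  Module.finrank_prod

theorem kerSum_bc_mfold_prodRep (q : PP) (m : ℕ) {M' V' W' : Type} [AddCommGroup M']
    [AddCommGroup V'] [AddCommGroup W'] [Module.Free ℤ M'] [Module.Finite ℤ M']
    [Module.Free ℤ V'] [Module.Finite ℤ V'] [Module.Free ℤ W'] [Module.Finite ℤ W']
    (θ : M →ₗ[ℤ] V →ₗ[ℤ] W) (θ' : M' →ₗ[ℤ] V' →ₗ[ℤ] W') :
    kerSum (bc (Fq q) (mfold m (prodRep θ θ'))) =
      kerSum (bc (Fq q) (mfold m θ)) * kerSum (bc (Fq q) (mfold m θ')) := by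
  have := Fintype.ofFinite (Fq q ⊗[ℤ] M)
  have := Fintype.ofFinite (Fq q ⊗[ℤ] M')
  have := Fintype.ofFinite (Fq q ⊗[ℤ] (M × M'))
  rw [kerSum_bc_mfold, kerSum_bc_mfold, kerSum_bc_mfold, finsum_eq_sum_of_fintype,
    finsum_eq_sum_of_fintype, finsum_eq_sum_of_fintype, Finset.sum_mul_sum,
    ← Fintype.sum_prod_type']
  exact Fintype.sum_equiv (TensorProduct.prodRight ℤ (Fq q) (Fq q) M M').toEquiv _ _ fun a => by
    rw [kerCard_bc_prodRep, mul_pow]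
    rfl

theorem askSym_mfold_mul (m : ℕ) {M' V' W' : Type} [AddCommGroup M']
    [AddCommGroup V'] [AddCommGroup W'] [Module.Free ℤ M'] [Module.Finite ℤ M']
    [Module.Free ℤ V'] [Module.Finite ℤ V'] [Module.Free ℤ W'] [Module.Finite ℤ W']
    (θ : M →ₗ[ℤ] V →ₗ[ℤ] W) (θ' : M' →ₗ[ℤ] V' →ₗ[ℤ] W') :
    askSym (mfold m θ) * askSym (mfold m θ') = askSym (mfold m (prodRep θ θ')) := by
  refine QQ_ext fun q => ?_
  rw [map_mul, evalQ_askSym, evalQ_askSym, evalQ_askSym, ask, ask, ask, kerSum_bc_mfold_prodRep,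
    card_tensor, card_tensor, card_tensor, finrank_prod_int, pow_add, div_mul_div_comm]
  push_cast
  rfl

theorem askSym_mfold_of_subsingleton (m : ℕ) [Subsingleton M] [Subsingleton V]
    (θ : M →ₗ[ℤ] V →ₗ[ℤ] W) : askSym (mfold m θ) = 1 := by
  refine QQ_ext fun q => ?_
  have h1 := evalQ_askSym_mul (mfold m θ) q
  have : Unique (Fq q ⊗[ℤ] M) := uniqueOfSubsingleton 0
  have h2 : kerSum (bc (Fq q) (mfold m θ)) = 1 := by
    rw [kerSum_bc_mfold, finsum_eq_sum_of_fintype, Fintype.sum_unique, kerCard, Nat.card_unique,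
      one_pow]
  rw [h2, Module.finrank_zero_of_subsingleton, pow_zero, mul_one, Nat.cast_one] at h1
  rw [h1, map_one]

/-- Only the summand at `a = 0` changes, from `q ^ (d m)` to `q ^ (d m + m)` with `d` the rank of
`V`. The correction lies in `ℤ[q, q⁻¹]`, so a representation may be replaced by its extension when
spans are compared. -/
theorem askSym_mfold_extRep (m : ℕ) (θ : M →ₗ[ℤ] V →ₗ[ℤ] W) :
    askSym (mfold m (extRep θ)) = askSym (mfold m θ) +
      (qQ ^ m - 1) * (qQ ^ (Module.finrank ℤ V * m) * qInv ^ Module.finrank ℤ M) := by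
  classical
  refine QQ_ext fun q => ?_
  have := Fintype.ofFinite (Fq q ⊗[ℤ] M)
  have h : (kerSum (bc (Fq q) (mfold m (extRep θ))) : ℚ) = kerSum (bc (Fq q) (mfold m θ)) +
      ((q.1 : ℚ) ^ m - 1) * (q.1 : ℚ) ^ (Module.finrank ℤ V * m) := by
    have h0 : kerCard (bc (Fq q) θ) 0 = q.1 ^ Module.finrank ℤ V := by
      rw [kerCard, map_zero, LinearMap.ker_zero, ← card_tensor]
      exact Nat.card_congr (Equiv.subtypeUnivEquiv fun _ => trivial)
    rw [kerSum_bc_mfold, kerSum_bc_mfold, finsum_eq_sum_of_fintype, finsum_eq_sum_of_fintype,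
      ← Finset.add_sum_erase _ _ (Finset.mem_univ 0),
      ← Finset.add_sum_erase _ (fun a => kerCard (bc (Fq q) θ) a ^ m) (Finset.mem_univ 0)]
    have h1 : ∑ a ∈ Finset.univ.erase 0, kerCard (bc (Fq q) (extRep θ)) a ^ m =
        ∑ a ∈ Finset.univ.erase 0, kerCard (bc (Fq q) θ) a ^ m :=
      Finset.sum_congr rfl fun a ha => by
        rw [kerCard_bc_extRep, if_neg (Finset.ne_of_mem_erase ha), mul_one]
    rw [h1, kerCard_bc_extRep, if_pos rfl, h0, card_Fq]
    push_cast
    ring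
  rw [map_add, evalQ_askSym, evalQ_askSym, ask, ask, h, add_div, card_tensor]
  simp only [map_mul, map_sub, map_pow, map_one, evalQ_qQ, evalQ_qInv]
  push_cast
  rw [inv_pow]
  ring

theorem evalQ_transvOrbits (θ : M →ₗ[ℤ] V →ₗ[ℤ] W) (q : PP) :
    evalQ q (transvOrbits θ) = (q.1 : ℚ) ^ Module.finrank ℤ W * evalQ q (askSym θ) := by
  have h := card_transv (Fq q) θ
  rw [card_tensor, card_tensor] at h
  have h' := congrArg (Nat.cast : ℕ → ℚ) h
  push_cast at h'
  rw [← evalQ_askSym_mul] at h'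
  have e : evalQ q (transvOrbits θ) = Nat.card (Quotient (transvSetoid (Fq q) θ)) := by
    rw [transvOrbits, evalQ_algebraMap]
    simp [ofCount]
  rw [e]
  refine mul_right_cancel₀ (pow_ne_zero (Module.finrank ℤ M) q.ne_zero) ?_
  linear_combination h'

theorem evalQ_baerClasses (θ : M →ₗ[ℤ] M →ₗ[ℤ] W) (hθ : ∀ a, θ a a = 0) (q : PP) :
    evalQ q (baerClasses θ) = (q.1 : ℚ) ^ Module.finrank ℤ W * evalQ q (askSym θ) := by
  have h := card_conjClasses_baer (Fq q) θ hθ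
  rw [card_tensor, card_tensor] at h
  have h' := congrArg (Nat.cast : ℕ → ℚ) h
  push_cast at h'
  rw [← evalQ_askSym_mul] at h'
  have e : evalQ q (baerClasses θ) = Nat.card (ConjClasses (BaerPts (Fq q) θ)) := by
    rw [baerClasses, evalQ_algebraMap]
    simp [ofCount]
  rw [e]
  refine mul_right_cancel₀ (pow_ne_zero (Module.finrank ℤ M + Module.finrank ℤ W) q.ne_zero) ?_
  rw [pow_add]
  linear_combination h'

theorem evalQ_heisClasses (θ : M →ₗ[ℤ] V →ₗ[ℤ] W) (q : PP) :
    evalQ q (heisClasses θ) * (q.1 : ℚ) ^ (Module.finrank ℤ M + Module.finrank ℤ V) =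
      (q.1 : ℚ) ^ Module.finrank ℤ W * quadCard (bc (Fq q) θ) := by
  have h := card_conjClasses_heis (bc (Fq q) θ)
  rw [card_tensor, card_tensor, card_tensor] at h
  have h' := congrArg (Nat.cast : ℕ → ℚ) h
  push_cast at h'
  have e : evalQ q (heisClasses θ) = Nat.card (ConjClasses (Heis (bc (Fq q) θ))) := by
    rw [heisClasses, evalQ_algebraMap]
    simp [ofCount]
  rw [e]
  refine mul_right_cancel₀ (pow_ne_zero (Module.finrank ℤ W) q.ne_zero) ?_
  rw [pow_add]
  linear_combination h'

/-- The alternating module representation `(a, v) * (a', v') = v' * a - v * a'`. -/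
def altRep (θ : M →ₗ[ℤ] V →ₗ[ℤ] W) : (M × V) →ₗ[ℤ] (M × V) →ₗ[ℤ] W :=
  LinearMap.mk₂ ℤ (fun p p' => θ p.1 p'.2 - θ p'.1 p.2)
    (fun p p' r => by simp only [Prod.fst_add, Prod.snd_add, map_add, LinearMap.add_apply]; abel)
    (fun c p p' => by simp [smul_sub])
    (fun p p' r => by simp only [Prod.fst_add, Prod.snd_add, map_add, LinearMap.add_apply]; abel)
    (fun c p p' => by simp [smul_sub])

theorem bc_altRep (S : Type) [CommRing S] (θ : M →ₗ[ℤ] V →ₗ[ℤ] W) (p p' : S ⊗[ℤ] (M × V)) :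
    bc S (altRep θ) p p' =
      bc S θ (TensorProduct.prodRight ℤ S S M V p).1 (TensorProduct.prodRight ℤ S S M V p').2 -
      bc S θ (TensorProduct.prodRight ℤ S S M V p').1 (TensorProduct.prodRight ℤ S S M V p).2 := by
  induction p using TensorProduct.induction_on with
  | zero => simp
  | add a b ha hb =>
    simp only [map_add, LinearMap.add_apply, Prod.fst_add, Prod.snd_add, ha, hb]
    abel
  | tmul s a =>
    induction p' using TensorProduct.induction_on with
    | zero => simp
    | add x y hx hy =>
      simp only [map_add, LinearMap.add_apply, Prod.fst_add, Prod.snd_add, hx, hy]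
      abel
    | tmul t x =>
      rw [bc_tmul]
      simp only [TensorProduct.prodRight_tmul]
      rw [bc_tmul, bc_tmul, mul_comm t s, ← TensorProduct.tmul_sub]
      rfl

theorem kerSum_bc_altRep (S : Type) [CommRing S] [Finite S] (θ : M →ₗ[ℤ] V →ₗ[ℤ] W) :
    kerSum (bc S (altRep θ)) = quadCard (bc S θ) := by
  have : Finite (S ⊗[ℤ] (M × V)) := Module.finite_of_finite S
  rw [kerSum_eq_card, quadCard]
  let e := (TensorProduct.prodRight ℤ S S M V).toEquiv
  refine Nat.card_congr ((e.prodCongr e).subtypeEquiv fun p => ?_)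
  rw [bc_altRep, sub_eq_zero, eq_comm]
  exact Iff.rfl

/-- Commutation in `H_θ` is the vanishing of the alternating form on `M × V`, so class numbers of
Heisenberg groups are kernel averages of alternating representations. -/
theorem evalQ_heisClasses_eq_altRep (θ : M →ₗ[ℤ] V →ₗ[ℤ] W) (q : PP) :
    evalQ q (heisClasses θ) = (q.1 : ℚ) ^ Module.finrank ℤ W * evalQ q (askSym (altRep θ)) := by
  refine mul_right_cancel₀
    (pow_ne_zero (Module.finrank ℤ M + Module.finrank ℤ V) q.ne_zero) ?_
  rw [evalQ_heisClasses, mul_assoc, ← finrank_prod_int, evalQ_askSym_mul, kerSum_bc_altRep]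

/-- Class numbers of Heisenberg-like groups in terms of the dual module representation. -/
theorem evalQ_heisClasses_eq_dual {ι κ μ : Type} [Fintype ι] [Fintype κ] [Fintype μ]
    (bM : Module.Basis ι ℤ M) (bV : Module.Basis κ ℤ V) (bW : Module.Basis μ ℤ W)
    (θ : M →ₗ[ℤ] V →ₗ[ℤ] W) (q : PP) :
    (q.1 : ℚ) ^ Fintype.card κ * evalQ q (heisClasses θ) =
      (q.1 : ℚ) ^ (Fintype.card ι + Fintype.card μ) *
        evalQ q (askSym (mfold 2 (tform ℤ (dualConst (strConst bM bV bW θ))))) := by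
  set c := strConst bM bV bW θ
  have h1 := evalQ_heisClasses θ q
  have h2 : quadCard (bc (Fq q) θ) = quadCard (tform (Fq q) c) :=
    quadCard_congr _ _ (coords bM (Fq q)).toEquiv (coords bV (Fq q)).toEquiv
      (coords bW (Fq q)).toEquiv fun a x => coords_bc bM bV bW θ (Fq q) a x
  have h3 := congrArg (Nat.cast : ℕ → ℚ) (quadCard_tform (F := Fq q) c)
  have h4 := evalQ_askSym_mul (mfold 2 (tform ℤ (dualConst c))) q
  have h5 : kerSum (bc (Fq q) (mfold 2 (tform ℤ (dualConst c)))) =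
      ∑ᶠ φ : μ → Fq q, kerCard (tform (Fq q) (dualConst c)) φ ^ 2 := by
    rw [kerSum_bc_mfold]
    refine finsum_eq_of_bijective (coords (Pi.basisFun ℤ μ) (Fq q))
      (coords (Pi.basisFun ℤ μ) (Fq q)).bijective fun a => ?_
    congr 1
    refine Nat.card_congr ((coords (Pi.basisFun ℤ κ) (Fq q)).toEquiv.subtypeEquiv fun x => ?_)
    change bc (Fq q) (tform ℤ (dualConst c)) a x = 0 ↔ tform (Fq q) (dualConst c)
      (coords (Pi.basisFun ℤ μ) (Fq q) a) (coords (Pi.basisFun ℤ κ) (Fq q) x) = 0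
    have h6 := coords_bc (Pi.basisFun ℤ μ) (Pi.basisFun ℤ κ) (Pi.basisFun ℤ ι)
      (tform ℤ (dualConst c)) (Fq q) a x
    rw [strConst_tform] at h6
    rw [← h6, LinearEquiv.map_eq_zero_iff]
  rw [h2, Module.finrank_eq_card_basis bM, Module.finrank_eq_card_basis bV,
    Module.finrank_eq_card_basis bW] at h1
  rw [h5, Module.finrank_fintype_fun_eq_card] at h4
  rw [Nat.cast_mul, Nat.cast_mul, ← h4, Nat.card_fun, Nat.card_fun, card_Fq,
    Nat.card_eq_fintype_card, Nat.card_eq_fintype_card] at h3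
  push_cast at h3
  refine mul_right_cancel₀ (pow_ne_zero (Fintype.card ι) q.ne_zero) ?_
  rw [pow_add] at h1 ⊢
  linear_combination h1 + h3

end Values

theorem isCompl_range_ker_of_leftInverse {E E' : Type} [AddCommGroup E] [AddCommGroup E']
    (f : E →ₗ[ℤ] E') (r : E' →ₗ[ℤ] E) (h : ∀ x, r (f x) = x) :
    IsCompl (LinearMap.range f) (LinearMap.ker r) := by
  refine IsCompl.of_eq (Submodule.eq_bot_iff _ |>.mpr ?_) (Submodule.eq_top_iff'.mpr fun y => ?_)
  · rintro _ ⟨⟨x, rfl⟩, hx⟩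
    have hx : r (f x) = 0 := hx
    rw [h] at hx
    rw [hx, map_zero]
  · refine Submodule.mem_sup.mpr ⟨f (r y), ⟨_, rfl⟩, y - f (r y), ?_, by abel⟩
    rw [LinearMap.mem_ker, map_sub, h, sub_self]

/-- The cokernel is isomorphic to the kernel of the retraction, a submodule of a finite free
`ℤ`-module and hence free. -/
theorem immersive_of_leftInverse {M V W : Type} [AddCommGroup M] [AddCommGroup V] [AddCommGroup W]
    [Module.Free ℤ V] [Module.Finite ℤ V] [Module.Free ℤ W] [Module.Finite ℤ W]
    (θ : M →ₗ[ℤ] V →ₗ[ℤ] W) (r : (V →ₗ[ℤ] W) →ₗ[ℤ] M) (h : ∀ a, r (θ a) = a) : Immersive θ :=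
  ⟨Function.LeftInverse.injective h,
    Module.Free.of_equiv (Submodule.quotientEquivOfIsCompl _ _
      (isCompl_range_ker_of_leftInverse θ r h)).symm⟩

/-- Evaluation at `(0, 1)` followed by the projection to `M` recovers `a`, whatever `θ` is. -/
theorem immersive_extRep {M V W : Type} [AddCommGroup M] [AddCommGroup V] [AddCommGroup W]
    [Module.Free ℤ V] [Module.Finite ℤ V] [Module.Free ℤ W] [Module.Finite ℤ W]
    [Module.Free ℤ M] [Module.Finite ℤ M]
    (θ : M →ₗ[ℤ] V →ₗ[ℤ] W) : Immersive (extRep θ) :=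
  immersive_of_leftInverse _
    { toFun := fun f => (f (0, 1)).2, map_add' := fun _ _ => rfl, map_smul' := fun _ _ => rfl }
    fun a => by simp [extRep]

theorem immersive_of_subsingleton {M V W : Type} [AddCommGroup M] [AddCommGroup V]
    [AddCommGroup W] [Module.Free ℤ V] [Module.Finite ℤ V] [Module.Free ℤ W] [Module.Finite ℤ W]
    [Subsingleton M] (θ : M →ₗ[ℤ] V →ₗ[ℤ] W) : Immersive θ :=
  immersive_of_leftInverse _ 0 fun _ => Subsingleton.elim _ _

/-! ### Passage to matrices -/

section MatrixForm

variable {M V W : Type} [AddCommGroup M] [AddCommGroup V] [AddCommGroup W]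
  [Module.Free ℤ M] [Module.Finite ℤ M] [Module.Free ℤ V] [Module.Finite ℤ V]
  [Module.Free ℤ W] [Module.Finite ℤ W]

/-- The matrix form of a module representation. -/
noncomputable def matForm (θ : M →ₗ[ℤ] V →ₗ[ℤ] W) :
    M →ₗ[ℤ] (Fin (Module.finrank ℤ V) → ℤ) →ₗ[ℤ] (Fin (Module.finrank ℤ W) → ℤ) :=
  ((Module.finBasis ℤ V).equivFun.arrowCongr (Module.finBasis ℤ W).equivFun).toLinearMap ∘ₗ θ

theorem evalQ_askSym_matForm (θ : M →ₗ[ℤ] V →ₗ[ℤ] W) (q : PP) :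
    evalQ q (askSym (matForm θ)) = evalQ q (askSym θ) := by
  refine evalQ_askSym_congr _ _ rfl q ?_
  rw [kerSum_bc_eq_tform (Module.finBasis ℤ M) (Module.finBasis ℤ V) (Module.finBasis ℤ W),
    kerSum_bc_eq_tform (Module.finBasis ℤ M) (Pi.basisFun ℤ (Fin (Module.finrank ℤ V)))
      (Pi.basisFun ℤ (Fin (Module.finrank ℤ W)))]
  congr 2
  ext i j l
  simp only [strConst, Pi.basisFun_repr, Pi.basisFun_apply]
  change (Module.finBasis ℤ W).equivFun (θ _ ((Module.finBasis ℤ V).equivFun.symm _)) l = _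
  rw [show (Module.finBasis ℤ V).equivFun.symm (Pi.single j 1) = Module.finBasis ℤ V j by
    rw [LinearEquiv.symm_apply_eq]
    ext k
    simp [Pi.single_apply, eq_comm]]
  rfl

theorem immersive_matForm {θ : M →ₗ[ℤ] V →ₗ[ℤ] W} (h : Immersive θ) : Immersive (matForm θ) := by
  let e : (V →ₗ[ℤ] W) ≃ₗ[ℤ] ((Fin (Module.finrank ℤ V) → ℤ) →ₗ[ℤ] (Fin (Module.finrank ℤ W) → ℤ)) :=
    (Module.finBasis ℤ V).equivFun.arrowCongr (Module.finBasis ℤ W).equivFun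
  refine ⟨e.injective.comp h.1, ?_⟩
  have := h.2
  exact Module.Free.of_equiv (Submodule.Quotient.equiv (LinearMap.range θ)
    (LinearMap.range (matForm θ)) e (LinearMap.range_comp θ e.toLinearMap).symm)

end MatrixForm

/-! ### Comparison of the spans -/

section Algebras

variable (s : Deco) (m : ℕ)

theorem isSubalg_algA : IsSubalg (algA s m) := by
  refine isSubalg_laurentSpan ⟨{ M := PUnit, V := PUnit, W := PUnit, θ := 0 },
    (askSym_mfold_of_subsingleton m _).symm⟩ ?_
  rintro _ ⟨T, rfl⟩ _ ⟨T', rfl⟩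
  exact ⟨{ M := T.M × T'.M, V := T.V × T'.V, W := T.W × T'.W, θ := prodRep T.θ T'.θ },
    askSym_mfold_mul m _ _⟩

theorem algAimm_le_algA : algAimm s m ≤ algA s m := by
  refine laurentSpan_le ?_
  rintro _ ⟨T, -, rfl⟩
  exact proj_mem_laurentSpan ⟨T, rfl⟩

/-- The average for `θ` is that of its immersive extension minus a Laurent multiple of 1, and 1 is
the average of an immersive zero representation. -/
theorem algA_le_algAimm : algA s m ≤ algAimm s m := by
  refine laurentSpan_le ?_
  rintro _ ⟨T, rfl⟩
  rw [← add_sub_cancel_right (askSym (mfold m T.θ)), ← askSym_mfold_extRep, map_sub]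
  refine sub_mem (proj_mem_laurentSpan ⟨
    { M := T.M, V := T.V × ℤ, W := T.W × T.M, θ := extRep T.θ }, immersive_extRep _, rfl⟩) ?_
  rw [← mul_one ((qQ ^ m - 1) * _)]
  refine smul_mem_laurentSpan ?_ (proj_mem_laurentSpan ⟨
    { M := PUnit, V := PUnit, W := PUnit, θ := 0 }, immersive_of_subsingleton _, (askSym_mfold_of_subsingleton m _).symm⟩)
  rw [map_mul, map_sub, map_pow, map_one]
  exact mul_mem (sub_mem (pow_mem proj_qQ_mem m) (one_mem _)) (proj_qQ_pow_mul_qInv_pow_mem _ _)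

/-- This also gives the subalgebra property in the immersive case, without forming direct sums of
immersive representations. -/
theorem algAimm_eq_algA : algAimm s m = algA s m :=
  le_antisymm (algAimm_le_algA s m) (algA_le_algAimm s m)

theorem algA_le_algA_one : algA s m ≤ algA s 1 := by
  refine laurentSpan_le ?_
  rintro _ ⟨T, rfl⟩
  exact proj_mem_laurentSpan ⟨{ M := T.M, V := Fin m → T.V, W := Fin m → T.W, θ := mfold m T.θ },
    (askSym_mfold_one _).symm⟩

theorem isSubalg_algAalt : IsSubalg (algAalt s) := by
  refine isSubalg_laurentSpan ⟨{ M := PUnit, W := PUnit, θ := 0, alt := fun _ => rfl }, ?_⟩ ?_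
  · exact ((askSym_mfold_one _).symm.trans (askSym_mfold_of_subsingleton 1 _)).symm
  rintro _ ⟨T, rfl⟩ _ ⟨T', rfl⟩
  refine ⟨
    { M := T.M × T'.M
      W := T.W × T'.W
      θ := prodRep T.θ T'.θ
      alt := fun a => Prod.ext (T.alt _) (T'.alt _) }, ?_⟩
  rw [← askSym_mfold_one, ← askSym_mfold_one T'.θ, askSym_mfold_mul]
  exact askSym_mfold_one _

theorem algA_one_eq_transv :
    algA s 1 = laurentSpan s {x | ∃ T : MatRep, x = transvOrbits T.θ} := by
  refine le_antisymm (laurentSpan_le ?_) (laurentSpan_le ?_)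
  · rintro _ ⟨T, rfl⟩
    exact proj_mem_of_evalQ ⟨{ d := _, e := _, M := T.M, θ := matForm T.θ }, rfl⟩ 0 (Module.finrank ℤ (Fin (Module.finrank ℤ T.W) → ℤ)) fun q => by
      rw [evalQ_transvOrbits, pow_zero, one_mul, evalQ_askSym_matForm, askSym_mfold_one]
  · rintro _ ⟨T, rfl⟩
    exact proj_mem_of_evalQ ⟨{ M := T.M, V := _, W := _, θ := T.θ }, rfl⟩
      (Module.finrank ℤ (Fin T.e → ℤ)) 0 fun q => by
        rw [evalQ_transvOrbits, pow_zero, one_mul, askSym_mfold_one]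

theorem algAimm_one_eq_transv : algAimm s 1 =
    laurentSpan s {x | ∃ T : MatRep, Immersive T.θ ∧ x = transvOrbits T.θ} := by
  refine le_antisymm (laurentSpan_le ?_) (laurentSpan_le ?_)
  · rintro _ ⟨T, hT, rfl⟩
    exact proj_mem_of_evalQ ⟨{ d := _, e := _, M := T.M, θ := matForm T.θ }, immersive_matForm hT, rfl⟩ 0
      (Module.finrank ℤ (Fin (Module.finrank ℤ T.W) → ℤ)) fun q => by
        rw [evalQ_transvOrbits, pow_zero, one_mul, evalQ_askSym_matForm, askSym_mfold_one]
  · rintro _ ⟨T, hT, rfl⟩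
    exact proj_mem_of_evalQ ⟨{ M := T.M, V := _, W := _, θ := T.θ }, hT, rfl⟩
      (Module.finrank ℤ (Fin T.e → ℤ)) 0 fun q => by
        rw [evalQ_transvOrbits, pow_zero, one_mul, askSym_mfold_one]

theorem algAalt_eq_baer : algAalt s = laurentSpan s {x | ∃ T : AltRep, x = baerClasses T.θ} := by
  refine le_antisymm (laurentSpan_le ?_) (laurentSpan_le ?_)
  · rintro _ ⟨T, rfl⟩
    exact proj_mem_of_evalQ ⟨T, rfl⟩ 0 (Module.finrank ℤ T.W) fun q => by
      rw [evalQ_baerClasses T.θ T.alt, pow_zero, one_mul]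
  · rintro _ ⟨T, rfl⟩
    exact proj_mem_of_evalQ ⟨T, rfl⟩ (Module.finrank ℤ T.W) 0 fun q => by
      rw [evalQ_baerClasses T.θ T.alt, pow_zero, one_mul]

theorem algA_two_eq_heis : algA s 2 = laurentSpan s {x | ∃ T : FreeRep, x = heisClasses T.θ} := by
  refine le_antisymm (laurentSpan_le ?_) (laurentSpan_le ?_)
  · rintro _ ⟨T, rfl⟩
    let bM := Module.finBasis ℤ T.M
    let bV := Module.finBasis ℤ T.V
    let bW := Module.finBasis ℤ T.W
    let c := strConst bM bV bW T.θ
    -- The representation is the dual of `T.θ`. Since `dualConst` is an involution, its Heisenberg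
    -- class numbers give the second moment of the kernel sizes of `T.θ` itself.
    refine proj_mem_of_evalQ ⟨{ M := _ → ℤ, V := _ → ℤ, W := _ → ℤ, θ := tform ℤ (dualConst c) }, rfl⟩
      (Fintype.card (Fin (Module.finrank ℤ T.V))) (Fintype.card (Fin (Module.finrank ℤ T.W)) +
        Fintype.card (Fin (Module.finrank ℤ T.M))) fun q => ?_
    rw [evalQ_heisClasses_eq_dual (Pi.basisFun ℤ _) (Pi.basisFun ℤ _) (Pi.basisFun ℤ _),
      strConst_tform]
    congr 1
    change _ = evalQ q (askSym (mfold 2 (tform ℤ c)))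
    refine evalQ_askSym_congr _ _ ?_ q ?_
    · simp
    · rw [kerSum_bc_mfold, kerSum_bc_mfold]
      refine finsum_eq_of_bijective ((coords bM (Fq q)).trans
        (coords (Pi.basisFun ℤ _) (Fq q)).symm) (LinearEquiv.bijective _) fun a => ?_
      congr 1
      refine Nat.card_congr (((coords bV (Fq q)).trans
        (coords (Pi.basisFun ℤ _) (Fq q)).symm).toEquiv.subtypeEquiv fun x => ?_)
      change bc (Fq q) T.θ a x = 0 ↔ bc (Fq q) (tform ℤ c)
        ((coords (Pi.basisFun ℤ _) (Fq q)).symm (coords bM (Fq q) a))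
        ((coords (Pi.basisFun ℤ _) (Fq q)).symm (coords bV (Fq q) x)) = 0
      rw [← LinearEquiv.map_eq_zero_iff (coords bW (Fq q)), coords_bc bM bV bW,
        ← LinearEquiv.map_eq_zero_iff (coords (Pi.basisFun ℤ _) (Fq q)),
        coords_bc (Pi.basisFun ℤ _) (Pi.basisFun ℤ _) (Pi.basisFun ℤ _), strConst_tform,
        LinearEquiv.apply_symm_apply, LinearEquiv.apply_symm_apply]
  · rintro _ ⟨T, rfl⟩
    exact proj_mem_of_evalQ ⟨{ M := _ → ℤ, V := _ → ℤ, W := _ → ℤ, θ := tform ℤ _ }, rfl⟩ _ _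
      fun q => evalQ_heisClasses_eq_dual (Module.finBasis ℤ T.M) (Module.finBasis ℤ T.V)
        (Module.finBasis ℤ T.W) T.θ q

theorem algA_two_le_algAalt : algA s 2 ≤ algAalt s := by
  rw [algA_two_eq_heis]
  refine laurentSpan_le ?_
  rintro _ ⟨T, rfl⟩
  exact proj_mem_of_evalQ ⟨
    { M := T.M × T.V
      W := T.W
      θ := altRep T.θ
      alt := fun a => sub_self _ }, rfl⟩ (Module.finrank ℤ T.W) 0 fun q => by
      rw [evalQ_heisClasses_eq_altRep, pow_zero, one_mul]

end Algebras

end OrbitEnum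

namespace OrbitEnum

/-! ### Numbers of points of schemes -/

section Schemes

theorem evalQ_count (X : FTScheme) (q : PP) : evalQ q X.count = Nat.card (X.Pts (Fq q)) := by
  rw [FTScheme.count, evalQ_algebraMap]
  simp [ofCount]

/-- The product of two separated schemes of finite type. -/
noncomputable def FTScheme.prod (X Y : FTScheme) : FTScheme :=
  have e : specZIsTerminal.from
      (Limits.pullback (specZIsTerminal.from X.X) (specZIsTerminal.from Y.X)) =
      Limits.pullback.fst _ _ ≫ specZIsTerminal.from X.X := specZIsTerminal.hom_ext _ _
  { X := Limits.pullback (specZIsTerminal.from X.X) (specZIsTerminal.from Y.X)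
    sep := by
      have := X.sep
      have := Y.sep
      rw [e]
      infer_instance
    ft := by
      have := X.ft
      have := Y.ft
      rw [e]
      infer_instance
    qc := by
      have := X.qc
      have := Y.qc
      rw [e]
      infer_instance }

/-- The universal property of the fibre product over the terminal object `Spec ℤ`, applied to
`F_q`-points. -/
theorem FTScheme.count_prod (X Y : FTScheme) : (X.prod Y).count = X.count * Y.count := by
  refine QQ_ext fun q => ?_
  rw [map_mul, evalQ_count, evalQ_count, evalQ_count, ← Nat.cast_mul, ← Nat.card_prod]
  congr 1
  exact Nat.card_congr
    { toFun := fun φ => (φ ≫ Limits.pullback.fst _ _, φ ≫ Limits.pullback.snd _ _)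
      invFun := fun t => Limits.pullback.lift t.1 t.2 (specZIsTerminal.hom_ext _ _)
      left_inv := fun φ => Limits.pullback.hom_ext (Limits.pullback.lift_fst _ _ _)
        (Limits.pullback.lift_snd _ _ _)
      right_inv := fun t => Prod.ext (Limits.pullback.lift_fst _ _ _)
        (Limits.pullback.lift_snd _ _ _) }

/-- The affine scheme of a finitely generated ring. -/
noncomputable def specFT (A : Type) [CommRing A] [h : Algebra.FiniteType ℤ A] : FTScheme :=
  have e : specZIsTerminal.from (Spec (.of A)) =
      Spec.map (CommRingCat.ofHom (algebraMap ℤ A)) := specZIsTerminal.hom_ext _ _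
  { X := Spec (.of A)
    sep := by
      rw [e]
      infer_instance
    ft := by
      rw [e, HasRingHomProperty.Spec_iff (P := @LocallyOfFiniteType)]
      exact RingHom.finiteType_algebraMap.mpr h
    qc := by
      rw [e]
      infer_instance }

theorem card_specFT_pts (A : Type) [CommRing A] [Algebra.FiniteType ℤ A] (S : Type) [CommRing S] :
    Nat.card ((specFT A).Pts S) = Nat.card (A →+* S) :=
  Nat.card_congr
    { toFun := fun φ => (Spec.preimage φ).hom
      invFun := fun f => Spec.map (CommRingCat.ofHom f)
      left_inv := fun φ => Spec.map_preimage φ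
      right_inv := fun f => by simp }

theorem count_specFT_int : (specFT ℤ).count = 1 := by
  refine QQ_ext fun q => ?_
  have : Unique (ℤ →+* Fq q) := ⟨⟨Int.castRingHom _⟩, fun _ => RingHom.ext_int _ _⟩
  rw [evalQ_count, card_specFT_pts, Nat.card_unique, map_one, Nat.cast_one]

theorem isSubalg_algX (s : Deco) : IsSubalg (algX s) := by
  refine isSubalg_laurentSpan ⟨specFT ℤ, count_specFT_int.symm⟩ ?_
  rintro _ ⟨X, rfl⟩ _ ⟨Y, rfl⟩
  exact ⟨X.prod Y, (X.count_prod Y).symm⟩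

/-- The ideal of the scheme of pairs `(a, x)` with `x * a = 0`. -/
noncomputable def kerIdeal {ι κ μ : Type} [Fintype ι] [Fintype κ] (c : ι → κ → μ → ℤ) :
    Ideal (MvPolynomial (ι ⊕ κ) ℤ) :=
  Ideal.span (Set.range fun l =>
    tform (MvPolynomial (ι ⊕ κ) ℤ) c (fun i => MvPolynomial.X (Sum.inl i))
      (fun j => MvPolynomial.X (Sum.inr j)) l)

/-- The coordinate ring of the scheme of pairs `(a, x)` with `x * a = 0`. -/
abbrev KerRing {ι κ μ : Type} [Fintype ι] [Fintype κ] (c : ι → κ → μ → ℤ) : Type :=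
  MvPolynomial (ι ⊕ κ) ℤ ⧸ kerIdeal c

instance {ι κ μ : Type} [Fintype ι] [Fintype κ] (c : ι → κ → μ → ℤ) :
    @Algebra.FiniteType ℤ (KerRing c) _ _ (Ring.toIntAlgebra _) := by
  have h : @Algebra.FiniteType ℤ (KerRing c) _ _ (Ideal.Quotient.algebra ℤ) :=
    Algebra.FiniteType.of_surjective (Ideal.Quotient.mkₐ ℤ _) (Ideal.Quotient.mkₐ_surjective ℤ _)
  rwa [Subsingleton.elim (Ring.toIntAlgebra (KerRing c)) (Ideal.Quotient.algebra ℤ)]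

theorem card_kerRing_hom {ι κ μ : Type} [Fintype ι] [Fintype κ] (c : ι → κ → μ → ℤ) (S : Type)
    [CommRing S] [Finite S] : Nat.card (KerRing c →+* S) = kerSum (tform S c) := by
  rw [kerSum_eq_card]
  have hf : ∀ (f : MvPolynomial (ι ⊕ κ) ℤ →+* S) (l : μ),
      f (tform (MvPolynomial (ι ⊕ κ) ℤ) c (fun i => MvPolynomial.X (Sum.inl i))
        (fun j => MvPolynomial.X (Sum.inr j)) l) =
      tform S c (fun i => f (MvPolynomial.X (Sum.inl i)))
        (fun j => f (MvPolynomial.X (Sum.inr j))) l := fun f l => by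
    simp only [tform_apply, map_sum, map_mul, map_intCast]
  let P : (ι → S) × (κ → S) → MvPolynomial (ι ⊕ κ) ℤ →+* S := fun p =>
    MvPolynomial.eval₂Hom (Int.castRingHom S) (Sum.elim p.1 p.2)
  have hP : ∀ p : (ι → S) × (κ → S), tform S c p.1 p.2 = 0 →
      ∀ a ∈ kerIdeal c, P p a = 0 := by
    intro p hp
    have : kerIdeal c ≤ RingHom.ker (P p) := by
      refine Ideal.span_le.mpr ?_
      rintro _ ⟨l, rfl⟩
      change P p _ = 0
      rw [hf]
      simpa [P] using congrFun hp l
    exact fun a ha => this ha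
  refine Nat.card_congr
    { toFun := fun φ => ⟨(fun i => φ (Ideal.Quotient.mk _ (MvPolynomial.X (Sum.inl i))),
        fun j => φ (Ideal.Quotient.mk _ (MvPolynomial.X (Sum.inr j)))), funext fun l => ?_⟩
      invFun := fun p => Ideal.Quotient.lift _ (P p.1) (hP p.1 p.2)
      left_inv := fun φ => ?_
      right_inv := fun p => ?_ }
  · refine (hf (φ.comp (Ideal.Quotient.mk _)) l).symm.trans ?_
    exact (congrArg φ (Ideal.Quotient.eq_zero_iff_mem.mpr
      (Ideal.subset_span (Set.mem_range_self l)))).trans (map_zero φ)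
  · refine Ideal.Quotient.ringHom_ext (MvPolynomial.ringHom_ext (fun z => by simp) fun i => ?_)
    rcases i with i | j <;> simp [P]
  · refine Subtype.ext (Prod.ext (funext fun i => ?_) (funext fun j => ?_)) <;> simp [P]

theorem algA_one_le_algX (s : Deco) : algA s 1 ≤ algX s := by
  refine laurentSpan_le ?_
  rintro _ ⟨T, rfl⟩
  let c := strConst (Module.finBasis ℤ T.M) (Module.finBasis ℤ T.V) (Module.finBasis ℤ T.W) T.θ
  refine proj_mem_of_evalQ ⟨specFT (KerRing c), rfl⟩ 0 (Module.finrank ℤ T.M) fun q => ?_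
  rw [askSym_mfold_one, mul_comm, evalQ_askSym_mul, evalQ_count, card_specFT_pts, card_kerRing_hom,
    pow_zero, one_mul, kerSum_bc_eq_tform (Module.finBasis ℤ T.M) (Module.finBasis ℤ T.V)
      (Module.finBasis ℤ T.W)]

end Schemes

end OrbitEnum

namespace OrbitEnum

/-! ### Integral exponentials and logarithms -/

section ExpLog

open Polynomial
open scoped Nat

/-- The polynomial `exp (N! X)`, truncated after degree `N`; its coefficients are integers. -/
noncomputable def expZ (N : ℕ) : ℤ[X] :=
  ∑ k ∈ Finset.range (N + 1), C ((N ! ^ k / k ! : ℕ) : ℤ) * X ^ k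

/-- The polynomial `N! log (1 + X)`, truncated after degree `N`; its coefficients are integers. -/
noncomputable def logZ (N : ℕ) : ℤ[X] :=
  ∑ k ∈ Finset.range (N + 1), C ((-1) ^ (k + 1) * ((N ! / k : ℕ) : ℤ)) * X ^ k

/-- The reason for rescaling by `N !`: the natural division in the coefficients of `expZ` is exact.
-/
theorem factorial_dvd_factorial_pow {N k : ℕ} (h : k ≤ N) : k ! ∣ N ! ^ k := by
  rcases Nat.eq_zero_or_pos k with rfl | hk
  · simp
  · exact (Nat.factorial_dvd_factorial h).trans (dvd_pow_self _ hk.ne')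

theorem X_dvd_expZ_sub_one (N : ℕ) : X ∣ expZ N - 1 := by
  rw [X_dvd_iff, coeff_sub, expZ, finsetSum_coeff, Finset.sum_eq_single 0]
  · simp
  · intro b _ hb
    simp [coeff_X_pow, hb.symm]
  · simp

theorem X_dvd_logZ (N : ℕ) : X ∣ logZ N := by
  refine Finset.dvd_sum fun k _ => ?_
  -- For `k = 0` the coefficient contains `N ! / 0 = 0`, so `logZ` has no constant term.
  rcases Nat.eq_zero_or_pos k with rfl | hk
  · simp
  · exact Dvd.dvd.mul_left (dvd_pow_self _ hk.ne') _

/-- The differential equation of `exp (N! X)`; truncation spoils it only in the top term. -/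
theorem X_pow_dvd_derivative_expZ (N : ℕ) :
    X ^ N ∣ derivative (expZ N) - C (N ! : ℤ) * expZ N := by
  have h1 : derivative (expZ N) =
      ∑ k ∈ Finset.range N, C (N ! : ℤ) * (C ((N ! ^ k / k ! : ℕ) : ℤ) * X ^ k) := by
    rw [expZ, derivative_sum, Finset.sum_range_succ']
    simp only [pow_zero, mul_one, derivative_C, add_zero]
    refine Finset.sum_congr rfl fun k hk => ?_
    have hk' : k + 1 ≤ N := Finset.mem_range.mp hk
    rw [derivative_C_mul_X_pow, ← mul_assoc, ← C_mul, Nat.add_sub_cancel]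
    congr 2
    have h2 := Nat.div_mul_cancel (factorial_dvd_factorial_pow hk')
    have h3 := Nat.div_mul_cancel (factorial_dvd_factorial_pow (Nat.le_of_succ_le hk'))
    have : (N ! ^ (k + 1) / (k + 1)!) * (k + 1) = N ! * (N ! ^ k / k !) := by
      refine Nat.eq_of_mul_eq_mul_right (Nat.factorial_pos k) ?_
      calc _ = N ! ^ (k + 1) / (k + 1)! * (k + 1)! := by rw [Nat.factorial_succ]; ring
        _ = _ := by rw [h2, mul_assoc, h3, pow_succ, mul_comm]
    exact_mod_cast this
  rw [h1, expZ, Finset.sum_range_succ, mul_add, Finset.mul_sum, sub_add_cancel_left, ← mul_assoc]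
  exact (Dvd.intro_left _ rfl).neg_right

/-- The derivative of the truncated logarithm is `N!` times a finite geometric series. -/
theorem one_add_X_mul_derivative_logZ (N : ℕ) :
    (1 + X) * derivative (logZ N) = C (N ! : ℤ) * (1 - (-X) ^ N) := by
  have h1 : derivative (logZ N) = C (N ! : ℤ) * ∑ k ∈ Finset.range N, (-X) ^ k := by
    rw [logZ, derivative_sum, Finset.sum_range_succ', Finset.mul_sum]
    simp only [pow_zero, mul_one, derivative_C, add_zero]
    refine Finset.sum_congr rfl fun k hk => ?_
    have hk' : k + 1 ≤ N := Finset.mem_range.mp hk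
    have h2 : N ! / (k + 1) * (k + 1) = N ! :=
      Nat.div_mul_cancel (Nat.dvd_factorial k.succ_pos hk')
    rw [derivative_C_mul_X_pow, Nat.add_sub_cancel, neg_pow (X : ℤ[X])]
    have h3 : ((-1) ^ (k + 1 + 1) * ((N ! / (k + 1) : ℕ) : ℤ)) * ((k + 1 : ℕ) : ℤ) =
        (N ! : ℤ) * (-1) ^ k := by
      rw [mul_assoc, ← Nat.cast_mul, h2]
      ring
    rw [h3, C_mul, mul_assoc]
    simp
  rw [h1, mul_left_comm]
  congr 1
  have := mul_neg_geom_sum (-X : ℤ[X]) N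
  rw [sub_neg_eq_add] at this
  exact this

/-- Integration raises the order of vanishing by one, because the integers `d + 1` are not zero
divisors on `R`. -/
theorem X_pow_succ_dvd_of_derivative {R : Type*} [CommRing R] [Module.IsTorsionFree ℤ R]
    {N : ℕ} {p : R[X]} (h0 : p.coeff 0 = 0)
    (h : X ^ N ∣ derivative p) : X ^ (N + 1) ∣ p := by
  rw [X_pow_dvd_iff] at h ⊢
  intro d hd
  rcases d with - | d
  · exact h0
  · have h1 := h d (Nat.lt_of_succ_lt_succ hd)
    rw [coeff_derivative, ← Nat.cast_succ, ← nsmul_eq_mul', ← natCast_zsmul] at h1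
    exact (smul_eq_zero.mp h1).resolve_left (by exact_mod_cast d.succ_ne_zero)

/-- The two differential equations show that the derivative of the composite is the constant `N!²`
modulo `X ^ N`. One factor `N!` comes from the logarithm and one from the argument of the
exponential. -/
theorem X_pow_dvd_logZ_comp_expZ (N : ℕ) :
    X ^ (N + 1) ∣ (logZ N).comp (expZ N - 1) - C ((N ! : ℤ) ^ 2) * X := by
  refine X_pow_succ_dvd_of_derivative ?_ ?_
  · rw [← X_dvd_iff]
    refine dvd_sub ?_ (Dvd.intro_left _ rfl)
    obtain ⟨r, hr⟩ := X_dvd_logZ N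
    rw [hr, mul_comp, X_comp]
    exact (X_dvd_expZ_sub_one N).mul_right _
  · obtain ⟨r, hr⟩ := X_pow_dvd_derivative_expZ N
    obtain ⟨u, hu⟩ := X_dvd_expZ_sub_one N
    have h1 := congrArg (fun p => p.comp (expZ N - 1)) (one_add_X_mul_derivative_logZ N)
    simp only [mul_comp, add_comp, one_comp, X_comp, sub_comp, neg_comp, pow_comp, C_comp,
      add_sub_cancel] at h1
    rw [derivative_sub, derivative_comp, derivative_sub, derivative_one, sub_zero, derivative_C_mul,
      derivative_X, mul_one]
    have h2 : derivative (expZ N) = X ^ N * r + C (N ! : ℤ) * expZ N := by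
      rw [← hr, sub_add_cancel]
    have h3 : (-(expZ N - 1)) ^ N = X ^ N * (-u) ^ N := by
      rw [hu, ← mul_pow, mul_neg]
    refine ⟨r * (derivative (logZ N)).comp (expZ N - 1) - C (N ! : ℤ) ^ 2 * (-u) ^ N, ?_⟩
    rw [h2, C_pow]
    rw [h3] at h1
    linear_combination C (N ! : ℤ) * h1

variable {A : Type*} [Ring A]

/-- The truncation of `exp (N! Y)`. -/
noncomputable def expA (N : ℕ) (Y : A) : A := aeval Y (expZ N)

/-- The truncation of `N! log (1 + Y)`. -/
noncomputable def logA (N : ℕ) (Y : A) : A := aeval Y (logZ N)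

theorem map_expA {A' : Type*} [Ring A'] (f : A →+* A') (N : ℕ) (Y : A) :
    f (expA N Y) = expA N (f Y) := (aeval_algHom_apply f.toIntAlgHom Y (expZ N)).symm

theorem map_logA {A' : Type*} [Ring A'] (f : A →+* A') (N : ℕ) (Y : A) :
    f (logA N Y) = logA N (f Y) := (aeval_algHom_apply f.toIntAlgHom Y (logZ N)).symm

theorem expA_eq_sum (N : ℕ) (Y : A) :
    expA N Y = ∑ k ∈ Finset.range (N + 1), ((N ! ^ k / k ! : ℕ) : ℤ) • Y ^ k := by
  rw [expA, expZ, map_sum]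
  exact Finset.sum_congr rfl fun k _ => by simp

theorem exists_expA_sub_one_eq (N : ℕ) (Y : A) : ∃ Z, Commute Y Z ∧ expA N Y - 1 = Y * Z := by
  obtain ⟨r, hr⟩ := X_dvd_expZ_sub_one N
  refine ⟨aeval Y r, ?_, ?_⟩
  · have h := commute_X r
    have := h.map (aeval Y)
    rwa [aeval_X] at this
  · have := congrArg (aeval Y) hr
    rwa [map_sub, map_one, map_mul, aeval_X] at this

theorem exists_logA_eq (N : ℕ) (Y : A) : ∃ Z, logA N Y = Y * Z := by
  obtain ⟨r, hr⟩ := X_dvd_logZ N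
  refine ⟨aeval Y r, ?_⟩
  rw [logA, hr, map_mul, aeval_X]

theorem expA_sub_one_pow (N : ℕ) {Y : A} (hY : Y ^ (N + 1) = 0) : (expA N Y - 1) ^ (N + 1) = 0 := by
  obtain ⟨Z, hc, h⟩ := exists_expA_sub_one_eq N Y
  rw [h, hc.mul_pow, hY, zero_mul]

theorem logA_expA (N : ℕ) {Y : A} (hY : Y ^ (N + 1) = 0) :
    logA N (expA N Y - 1) = ((N ! : ℤ) ^ 2) • Y := by
  obtain ⟨r, hr⟩ := X_pow_dvd_logZ_comp_expZ N
  generalize (N ! : ℤ) ^ 2 = m at hr ⊢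
  have h := congrArg (aeval Y) hr
  rw [map_mul, map_pow, aeval_X, hY, zero_mul, map_sub, sub_eq_zero, aeval_comp, map_sub, map_one,
    map_mul, aeval_X, aeval_C] at h
  rw [logA, expA, h, zsmul_eq_mul]
  simp

theorem commute_aeval {Y Y' : A} (h : Commute Y Y') (p p' : ℤ[X]) :
    Commute (aeval Y p) (aeval Y' p') := by
  have h1 : Commute Y (aeval Y' p') := by
    induction p' using Polynomial.induction_on' with
    | add p q hp hq => rw [map_add]; exact hp.add_right hq
    | monomial n a =>
      rw [aeval_monomial]
      exact Commute.mul_right (Algebra.commutes' a Y).symm (h.pow_right n)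
  induction p using Polynomial.induction_on' with
  | add p q hp hq => rw [map_add]; exact hp.add_left hq
  | monomial n a =>
    rw [aeval_monomial]
    exact Commute.mul_left (Algebra.commutes' a _) (h1.pow_left n)

end ExpLog

/-! ### Exponentials of nilpotent matrices over a field -/

section FiniteField

open scoped Nat

variable {ι : Type} [Fintype ι] [DecidableEq ι] {F : Type} [Field F]

theorem expA_injOn {N : ℕ} (hN : (N ! : F) ≠ 0) {Y Y' : Matrix ι ι F} (hY : Y ^ (N + 1) = 0)
    (hY' : Y' ^ (N + 1) = 0) (h : expA N Y = expA N Y') : Y = Y' := by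
  have h1 := logA_expA N hY
  rw [h, logA_expA N hY', ← Int.cast_smul_eq_zsmul F, ← Int.cast_smul_eq_zsmul F] at h1
  refine (smul_right_injective _ ?_ h1).symm
  push_cast
  exact pow_ne_zero 2 hN

/-- By counting: `Y ↦ expA N Y - 1` is an injective self-map of the finite set of matrices with `Y ^
(N + 1) = 0`. -/
theorem exists_expA_eq [Finite F] {N : ℕ} (hN : (N ! : F) ≠ 0) {g : Matrix ι ι F}
    (hg : (g - 1) ^ (N + 1) = 0) : ∃ Y, Y ^ (N + 1) = 0 ∧ expA N Y = g := by
  let T := {Y : Matrix ι ι F // Y ^ (N + 1) = 0}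
  have : Finite (Matrix ι ι F) := inferInstanceAs (Finite (ι → ι → F))
  let f : T → T := fun Y => ⟨expA N Y.1 - 1, expA_sub_one_pow N Y.2⟩
  have hf : Function.Injective f := fun Y Y' h =>
    Subtype.ext (expA_injOn hN Y.2 Y'.2 (sub_left_injective (congrArg Subtype.val h)))
  obtain ⟨Y, hY⟩ := Finite.surjective_of_injective hf ⟨g - 1, hg⟩
  exact ⟨Y.1, Y.2, sub_left_injective (congrArg Subtype.val hY)⟩

/-- `expA N Y - 1` is a right multiple of `Y`, and through the logarithm `N!² Y` is a right multiple
of `expA N Y - 1`. The two matrices thus kill the same row vectors. -/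
theorem vecMul_expA_eq_iff {N : ℕ} (hN : (N ! : F) ≠ 0) {Y : Matrix ι ι F}
    (hY : Y ^ (N + 1) = 0) (v : ι → F) : v ᵥ* expA N Y = v ↔ v ᵥ* Y = 0 := by
  have h0 : v ᵥ* expA N Y = v ↔ v ᵥ* (expA N Y - 1) = 0 := by
    rw [Matrix.vecMul_sub, Matrix.vecMul_one, sub_eq_zero]
  rw [h0]
  constructor
  · intro h
    obtain ⟨Z, hZ⟩ := exists_logA_eq N (expA N Y - 1)
    have h1 := congrArg (fun B => v ᵥ* B) (hZ.symm.trans (logA_expA N hY))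
    simp only [← Matrix.vecMul_vecMul, h, Matrix.zero_vecMul] at h1
    rw [← Int.cast_smul_eq_zsmul F, Matrix.vecMul_smul, eq_comm, smul_eq_zero] at h1
    refine h1.resolve_left ?_
    push_cast
    exact pow_ne_zero 2 hN
  · intro h
    obtain ⟨Z, -, hZ⟩ := exists_expA_sub_one_eq N Y
    rw [hZ, ← Matrix.vecMul_vecMul, h, Matrix.zero_vecMul]

/-- Each of `expA N Y` and `N!² Y` is an integral polynomial in the other, and `N!²` is invertible.
-/
theorem commute_expA_iff {N : ℕ} (hN : (N ! : F) ≠ 0) {Y Y' : Matrix ι ι F}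
    (hY : Y ^ (N + 1) = 0) (hY' : Y' ^ (N + 1) = 0) :
    Commute (expA N Y) (expA N Y') ↔ Commute Y Y' := by
  refine ⟨fun h => ?_, fun h => commute_aeval h _ _⟩
  have h1 : Commute (logA N (expA N Y - 1)) (logA N (expA N Y' - 1)) :=
    commute_aeval ((h.sub_left (Commute.one_left _)).sub_right
      ((Commute.one_right _).sub_left (Commute.one_left _))) _ _
  have h2 : ((((N ! : ℤ) ^ 2 : ℤ)) : F) ≠ 0 := by
    push_cast
    exact pow_ne_zero 2 hN
  rw [logA_expA N hY, logA_expA N hY', ← Int.cast_smul_eq_zsmul F, ← Int.cast_smul_eq_zsmul F,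
    Commute.smul_left_iff₀ h2, Commute.smul_right_iff₀ h2] at h1
  exact h1

end FiniteField

end OrbitEnum

namespace OrbitEnum

/-! ### Tangent spaces of linear algebraic groups -/

section Tangent

variable {n : ℕ}

/-- Evaluation of a polynomial in the matrix entries at an arbitrary matrix. -/
noncomputable abbrev evalM (k : Type) [CommRing k] {S : Type} [CommRing S] [Algebra k S]
    (A : Matrix (Fin n) (Fin n) S) : MvPolynomial (Fin n × Fin n) k →ₐ[k] S :=
  MvPolynomial.aeval fun ij => A ij.1 ij.2

theorem map_evalM {k S S' : Type} [CommRing k] [CommRing S] [CommRing S'] [Algebra k S]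
    [Algebra k S'] (f : S →ₐ[k] S') (A : Matrix (Fin n) (Fin n) S)
    (p : MvPolynomial (Fin n × Fin n) k) : f (evalM k A p) = evalM k (A.map f) p := by
  rw [← AlgHom.comp_apply]
  congr 1
  apply MvPolynomial.algHom_ext
  intro ij
  simp

/-- The matrix `1 + εY` over the dual numbers. -/
noncomputable def oneAddEps {S : Type} [CommRing S] (Y : Matrix (Fin n) (Fin n) S) :
    Matrix (Fin n) (Fin n) (DualNumber S) := 1 + Y.map TrivSqZeroExt.inr

/-- The differential at the identity matrix. -/
noncomputable def differential (n : ℕ) :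
    MvPolynomial (Fin n × Fin n) ℚ →ₗ[ℚ] (Fin n × Fin n → ℚ) :=
  LinearMap.pi fun ij => (evalM ℚ (1 : Matrix (Fin n) (Fin n) ℚ)).toLinearMap ∘ₗ
    (MvPolynomial.pderiv (R := ℚ) ij).toLinearMap

theorem differential_apply (f : MvPolynomial (Fin n × Fin n) ℚ) (ij : Fin n × Fin n) :
    differential n f ij = evalM ℚ (1 : Matrix (Fin n) (Fin n) ℚ) (MvPolynomial.pderiv ij f) := rfl

theorem evalM_one {S : Type} [CommRing S] [Algebra ℚ S] (p : MvPolynomial (Fin n × Fin n) ℚ) :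
    evalM ℚ (1 : Matrix (Fin n) (Fin n) S) p =
      algebraMap ℚ S (evalM ℚ (1 : Matrix (Fin n) (Fin n) ℚ) p) := by
  have h := map_evalM (Algebra.ofId ℚ S) (1 : Matrix (Fin n) (Fin n) ℚ) p
  rw [Matrix.map_one _ (map_zero _) (map_one _)] at h
  exact h.symm

/-- The first-order Taylor expansion `f(1 + εY) = f(1) + ε df(Y)`; the product case is the Leibniz
rule. -/
theorem evalM_oneAddEps {S : Type} [CommRing S] [Algebra ℚ S] (Y : Matrix (Fin n) (Fin n) S)
    (f : MvPolynomial (Fin n × Fin n) ℚ) :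
    evalM ℚ (oneAddEps Y) f = TrivSqZeroExt.inl (evalM ℚ (1 : Matrix (Fin n) (Fin n) S) f) +
      TrivSqZeroExt.inr (∑ ij, algebraMap ℚ S (differential n f ij) * Y ij.1 ij.2) := by
  have hX : ∀ ij : Fin n × Fin n, oneAddEps Y ij.1 ij.2 =
      TrivSqZeroExt.inl ((1 : Matrix (Fin n) (Fin n) S) ij.1 ij.2) +
        TrivSqZeroExt.inr (Y ij.1 ij.2) := by
    intro ij
    by_cases h : ij.1 = ij.2 <;> simp [oneAddEps, Matrix.one_apply, h]
  induction f using MvPolynomial.induction_on with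
  | C z =>
    simp only [MvPolynomial.algHom_C, differential_apply, MvPolynomial.pderiv_C, map_zero, zero_mul,
      Finset.sum_const_zero, TrivSqZeroExt.inr_zero, add_zero]
    rfl
  | add p p' hp hp' =>
    simp only [map_add, hp, hp', Pi.add_apply, add_mul, Finset.sum_add_distrib,
      TrivSqZeroExt.inl_add, TrivSqZeroExt.inr_add]
    abel
  | mul_X p kl hp =>
    rw [map_mul, map_mul, hp, MvPolynomial.aeval_X, MvPolynomial.aeval_X, hX]
    have h1 : ∀ ij, algebraMap ℚ S (differential n (p * MvPolynomial.X kl) ij) =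
        algebraMap ℚ S (differential n p ij) * (1 : Matrix (Fin n) (Fin n) S) kl.1 kl.2 +
          evalM ℚ (1 : Matrix (Fin n) (Fin n) S) p * if ij = kl then 1 else 0 := by
      intro ij
      rw [differential_apply, differential_apply, ← evalM_one, ← evalM_one, Derivation.leibniz,
        MvPolynomial.pderiv_X, smul_eq_mul, smul_eq_mul, map_add, map_mul, map_mul,
        MvPolynomial.aeval_X, Pi.single_apply, apply_ite (evalM ℚ (1 : Matrix (Fin n) (Fin n) S)),
        map_one, map_zero]
      simp only [eq_comm (a := kl)]
      ring
    simp only [h1, add_mul, Finset.sum_add_distrib, mul_assoc, ite_mul, one_mul, zero_mul,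
      mul_ite, mul_zero, Finset.sum_ite_eq', Finset.mem_univ, if_true]
    ext
    · simp
    · simp only [TrivSqZeroExt.snd_mul, TrivSqZeroExt.snd_add, TrivSqZeroExt.fst_add,
        TrivSqZeroExt.fst_inl, TrivSqZeroExt.fst_inr, TrivSqZeroExt.snd_inl,
        TrivSqZeroExt.snd_inr, op_smul_eq_smul, smul_eq_mul]
      have h2 : ∑ x, algebraMap ℚ S (differential n p x) *
          ((1 : Matrix (Fin n) (Fin n) S) kl.1 kl.2 * Y x.1 x.2) =
          (1 : Matrix (Fin n) (Fin n) S) kl.1 kl.2 *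
            ∑ x, algebraMap ℚ S (differential n p x) * Y x.1 x.2 := by
        rw [Finset.mul_sum]
        exact Finset.sum_congr rfl fun x _ => by ring
      rw [h2]
      ring

namespace LinAlgGroup

variable (G : LinAlgGroup n)

/-- The matrix `A` is a point of `G`. -/
def HasPt {R : Type} [CommRing R] [Algebra ℚ R] (A : Matrix (Fin n) (Fin n) R) : Prop :=
  ∃ g ∈ G.pts R, (g : Matrix (Fin n) (Fin n) R) = A

/-- The matrix `Y` is tangent to `G` at the identity. -/
def IsTangent {R : Type} [CommRing R] [Algebra ℚ R] (Y : Matrix (Fin n) (Fin n) R) : Prop :=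
  ∀ f ∈ G.I, ∑ ij, algebraMap ℚ R (differential n f ij) * Y ij.1 ij.2 = 0

variable {G} {R : Type} [CommRing R] [Algebra ℚ R]

theorem HasPt.evalM_eq_zero {A : Matrix (Fin n) (Fin n) R} (h : G.HasPt A) :
    ∀ f ∈ G.I, evalM ℚ A f = 0 := by
  obtain ⟨g, hg, rfl⟩ := h
  exact hg

/-- Points of `G` are invertible matrices by definition; here invertibility is automatic and only
the equations remain. -/
theorem hasPt_of_isNilpotent {A : Matrix (Fin n) (Fin n) R} (hA : IsNilpotent (A - 1))
    (h : ∀ f ∈ G.I, evalM ℚ A f = 0) : G.HasPt A := by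
  have hu : IsUnit A := by
    have := hA.isUnit_one_add
    rwa [add_sub_cancel] at this
  exact ⟨hu.unit, h, rfl⟩

theorem HasPt.mul {A B : Matrix (Fin n) (Fin n) R} (hA : G.HasPt A) (hB : G.HasPt B) :
    G.HasPt (A * B) := by
  obtain ⟨g, hg, rfl⟩ := hA
  obtain ⟨h, hh, rfl⟩ := hB
  exact ⟨g * h, mul_mem hg hh, rfl⟩

theorem HasPt.pow {A : Matrix (Fin n) (Fin n) R} (hA : G.HasPt A) (m : ℕ) : G.HasPt (A ^ m) := by
  obtain ⟨g, hg, rfl⟩ := hA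
  exact ⟨g ^ m, pow_mem hg m, Units.val_pow_eq_pow_val g m⟩

theorem HasPt.map {R' : Type} [CommRing R'] [Algebra ℚ R'] (f : R →+* R')
    {A : Matrix (Fin n) (Fin n) R} (hA : G.HasPt A) : G.HasPt (A.map f) := by
  obtain ⟨g, hg, rfl⟩ := hA
  exact ⟨_, G.map_mem_pts f hg, rfl⟩

theorem evalM_one_eq_zero {f : MvPolynomial (Fin n × Fin n) ℚ} (hf : f ∈ G.I) :
    evalM ℚ (1 : Matrix (Fin n) (Fin n) R) f = 0 := G.one_mem' R f hf

theorem isTangent_iff {Y : Matrix (Fin n) (Fin n) R} :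
    G.IsTangent Y ↔ ∀ f ∈ G.I, evalM ℚ (oneAddEps Y) f = 0 := by
  refine forall₂_congr fun f hf => ?_
  rw [evalM_oneAddEps, evalM_one_eq_zero hf, TrivSqZeroExt.inl_zero, zero_add,
    ← TrivSqZeroExt.inr_zero R, TrivSqZeroExt.inr_injective.eq_iff]

theorem IsTangent.hasPt {Y : Matrix (Fin n) (Fin n) R} (h : G.IsTangent Y) :
    G.HasPt (oneAddEps Y) := by
  refine hasPt_of_isNilpotent ⟨2, ?_⟩ (isTangent_iff.mp h)
  rw [oneAddEps, add_sub_cancel_left, pow_two]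
  ext i j : 1
  simp [Matrix.mul_apply]

theorem IsTangent.map {R' : Type} [CommRing R'] [Algebra ℚ R'] (f : R →+* R')
    {Y : Matrix (Fin n) (Fin n) R} (h : G.IsTangent Y) : G.IsTangent (Y.map f) := by
  intro p hp
  have h1 := congrArg f (h p hp)
  rw [map_sum, map_zero] at h1
  rw [← h1]
  refine Finset.sum_congr rfl fun ij _ => ?_
  rw [map_mul, Matrix.map_apply, RingHom.map_rat_algebraMap]

theorem IsTangent.smul (r : R) {Y : Matrix (Fin n) (Fin n) R} (h : G.IsTangent Y) :
    G.IsTangent (r • Y) := by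
  intro p hp
  have h1 := congrArg (r * ·) (h p hp)
  simp only [mul_zero, Finset.mul_sum] at h1
  rw [← h1]
  exact Finset.sum_congr rfl fun ij _ => by rw [Matrix.smul_apply, smul_eq_mul]; ring

end LinAlgGroup

end Tangent

end OrbitEnum

namespace OrbitEnum

/-! ### Exponentials of tangent vectors -/

section TruncatedExp

open Polynomial
open scoped Nat

/-- The truncated exponential series. -/
noncomputable def texp {A : Type*} [Ring A] [Module ℚ A] (M : ℕ) (W : A) : A :=
  ∑ k ∈ Finset.range (M + 1), (k ! : ℚ)⁻¹ • W ^ k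

theorem map_texp {A A' : Type*} [Ring A] [Module ℚ A] [Ring A'] [Module ℚ A'] (f : A →+* A')
    (M : ℕ) (W : A) : f (texp M W) = texp M (f W) := by
  rw [texp, texp, map_sum]
  exact Finset.sum_congr rfl fun k _ => by rw [map_rat_smul, map_pow]

theorem texp_eq_exp {A : Type*} [Ring A] [Module ℚ A] {M j : ℕ} {W : A} (h : W ^ j = 0)
    (hj : j ≤ M + 1) : texp M W = IsNilpotent.exp W :=
  (IsNilpotent.exp_eq_sum (pow_eq_zero_of_le hj h)).symm

theorem texp_zero {A : Type*} [Ring A] [Module ℚ A] (M : ℕ) : texp M (0 : A) = 1 := by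
  rw [texp_eq_exp (j := 1) (pow_one _) (by omega), IsNilpotent.exp_zero]

variable {n : ℕ}

theorem smul_map_eq {S S' : Type} [CommRing S] [CommRing S'] (f : S →+* S') (s : S)
    (Y : Matrix (Fin n) (Fin n) S) : f.mapMatrix (s • Y) = f s • Y.map f := by
  ext i j
  simp

theorem mapMatrix_texp {S S' : Type} [CommRing S] [CommRing S'] [Algebra ℚ S] [Algebra ℚ S']
    (f : S →+* S') (M : ℕ) (W : Matrix (Fin n) (Fin n) S) :
    f.mapMatrix (texp M W) = texp M (f.mapMatrix W) :=
  map_texp (A := Matrix (Fin n) (Fin n) S) (A' := Matrix (Fin n) (Fin n) S') f.mapMatrix M W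

/-- In this form, multiplication by `1 + εY` shifts the argument of another exponential of a
multiple of `Y`. -/
theorem oneAddEps_eq_exp {S : Type} [CommRing S] [Algebra ℚ S] (Y : Matrix (Fin n) (Fin n) S) :
    oneAddEps Y = IsNilpotent.exp ((DualNumber.eps : DualNumber S) •
      Y.map (TrivSqZeroExt.inlHom S S)) := by
  have h2 : ((DualNumber.eps : DualNumber S) • Y.map (TrivSqZeroExt.inlHom S S)) ^ 2 = 0 := by
    rw [_root_.smul_pow, pow_two, DualNumber.eps_mul_eps, zero_smul]
  rw [IsNilpotent.exp_eq_sum h2, Finset.sum_range_succ, Finset.sum_range_one, oneAddEps]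
  simp only [Nat.factorial_zero, Nat.factorial_one, Nat.cast_one, inv_one, pow_zero, pow_one,
    one_smul]
  congr 1
  ext i j : 1
  rw [Matrix.map_apply, Matrix.smul_apply, Matrix.map_apply]
  ext <;> simp

namespace LinAlgGroup

variable {G : LinAlgGroup n} {R : Type} [CommRing R] [Algebra ℚ R]

theorem exists_truncation (R : Type) [CommRing R] [Algebra ℚ R] (j : ℕ) :
    ∃ (A : Type) (_ : CommRing A) (_ : Algebra ℚ A) (mk : R[X] →+* A),
      ∀ p, mk p = 0 ↔ X ^ j ∣ p :=
  ⟨R[X] ⧸ Ideal.span {(X : R[X]) ^ j}, inferInstance, inferInstance, Ideal.Quotient.mk _,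
    fun p => by rw [Ideal.Quotient.eq_zero_iff_mem, Ideal.mem_span_singleton]⟩

theorem hasPt_map_of_dvd {A : Type} [CommRing A] [Algebra ℚ A] {mk : R[X] →+* A} {j : ℕ}
    (hmk : ∀ p, mk p = 0 ↔ X ^ j ∣ p) {P : Matrix (Fin n) (Fin n) R[X]}
    (hn : IsNilpotent (P.map mk - 1)) (h : ∀ f ∈ G.I, X ^ j ∣ evalM ℚ P f) :
    G.HasPt (P.map mk) :=
  hasPt_of_isNilpotent hn fun f hf =>
    (map_evalM mk.toRatAlgHom P f).symm.trans ((hmk _).mpr (h f hf))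

theorem isNilpotent_texp_map {A : Type} [CommRing A] [Algebra ℚ A] {mk : R[X] →+* A} {j : ℕ}
    (hmk : ∀ p, mk p = 0 ↔ X ^ j ∣ p) (Y : Matrix (Fin n) (Fin n) R) {M : ℕ} (hj : j ≤ M + 1) :
    IsNilpotent ((texp M ((X : R[X]) • Y.map C)).map mk - 1) := by
  have h1 : (texp M ((X : R[X]) • Y.map C)).map mk =
      texp M (mk.mapMatrix ((X : R[X]) • Y.map C)) := mapMatrix_texp mk M _
  have h2 : (mk.mapMatrix ((X : R[X]) • Y.map C)) ^ j = 0 := by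
    rw [smul_map_eq, _root_.smul_pow, ← map_pow, (hmk _).mpr dvd_rfl, zero_smul]
  rw [h1, texp_eq_exp h2 hj]
  exact IsNilpotent.isNilpotent_exp_sub_one ⟨j, h2⟩

theorem isTorsionFree_int_of_rat (R : Type) [CommRing R] [Algebra ℚ R] :
    Module.IsTorsionFree ℤ R := by
  have : Module.IsTorsionFree ℚ R := inferInstance
  exact Module.IsTorsionFree.trans ℚ

/-- Put `F(X) = f(exp(XY))`. If all such `F` vanish modulo `X ^ j`, then `exp(XY)` is a point of `G`
over `R[X]/(X ^ j)`. Multiplying it by the point `1 + εY = exp(εY)` gives the point `exp((X + ε)Y)`,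
so `0 = F(X + ε) = F(X) + ε F'(X)` there. Hence `X ^ j` divides `F'`; as `F(0) = f(1) = 0`,
integration yields divisibility by `X ^ (j + 1)`. -/
theorem IsTangent.X_pow_dvd {Y : Matrix (Fin n) (Fin n) R} (hY : G.IsTangent Y) (M : ℕ) :
    ∀ j ≤ M + 1, ∀ f ∈ G.I, X ^ j ∣ evalM ℚ (texp M ((X : R[X]) • Y.map C)) f := by
  intro j
  induction j with
  | zero => exact fun _ f _ => by rw [pow_zero]; exact one_dvd _
  | succ j ih =>
    intro hj f hf
    have ih := ih (by omega)
    set P := texp M ((X : R[X]) • Y.map C) with hP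
    obtain ⟨A, _, _, mk, hmk⟩ := exists_truncation R j
    let inl : A →+* DualNumber A := TrivSqZeroExt.inlHom _ _
    have hpt0 : G.HasPt (P.map mk) :=
      hasPt_map_of_dvd hmk (isNilpotent_texp_map hmk Y (by omega)) ih
    have hpt1 : G.HasPt ((P.map mk).map inl) := hpt0.map inl
    have hpt2 : G.HasPt (oneAddEps ((Y.map C).map mk)) := ((hY.map C).map mk).hasPt
    set y' := ((Y.map C).map mk).map inl with hy'
    have e1 : (P.map mk).map inl = texp M (inl (mk X) • y') := by
      change inl.mapMatrix (mk.mapMatrix P) = _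
      rw [hP, mapMatrix_texp mk, mapMatrix_texp inl, smul_map_eq, smul_map_eq]
    have hX : (inl (mk X)) ^ j = 0 := by
      rw [← map_pow, ← map_pow, (hmk _).mpr dvd_rfl, map_zero]
    have hW1 : (inl (mk X) • y') ^ j = 0 := by rw [_root_.smul_pow, hX, zero_smul]
    have he : (DualNumber.eps : DualNumber A) ^ 2 = 0 := by
      rw [pow_two, DualNumber.eps_mul_eps]
    have hW2 : ((DualNumber.eps : DualNumber A) • y') ^ 2 =
        0 := by rw [_root_.smul_pow, he, zero_smul]
    -- From `X ^ j = 0` and `ε ^ 2 = 0` follows `(X + ε) ^ (j + 1) = 0`. As `j ≤ M`, truncation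
    -- after degree `M` loses nothing.
    have hW : ((inl (mk X) + DualNumber.eps) • y') ^ (j + 1) = 0 := by
      rw [_root_.smul_pow, (Commute.all _ _).add_pow_eq_zero_of_add_le_succ_of_pow_eq_zero hX he le_rfl,
        zero_smul]
    have hpt := hpt1.mul hpt2
    rw [e1, texp_eq_exp hW1 (by omega), oneAddEps_eq_exp,
      ← IsNilpotent.exp_add_of_commute
        (((Commute.refl y').smul_right DualNumber.eps).smul_left _) ⟨j, hW1⟩ ⟨2, hW2⟩, ← add_smul,
      ← texp_eq_exp hW hj] at hpt
    -- The substitution `X ↦ X + ε`, followed by reduction modulo `X ^ j`.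
    let t : R[X] →+* DualNumber A :=
      eval₂RingHom ((inl.comp mk).comp C) (inl (mk X) + DualNumber.eps)
    have e2 : t.mapMatrix P = texp M ((inl (mk X) + DualNumber.eps) • y') := by
      rw [hP, mapMatrix_texp, smul_map_eq]
      congr 2
      · exact eval₂_X _ _
      · ext a b : 1
        exact eval₂_C _ _
    have h1 : t (evalM ℚ P f) = 0 :=
      (map_evalM t.toRatAlgHom P f).trans
        ((congrArg (fun B => evalM ℚ B f) e2).trans (hpt.evalM_eq_zero f hf))
    generalize hF : evalM ℚ P f = F at h1
    have h2 : ∀ Q : R[X], (Q.map ((inl.comp mk).comp C)).eval (inl (mk X)) = inl (mk Q) := by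
      intro Q
      rw [Polynomial.eval_map, show inl (mk X) = (inl.comp mk) X from rfl, ← hom_eval₂, eval₂_C_X]
      rfl
    -- The Taylor expansion `F(X + ε) = F(X) + ε F'(X)`, valid because `ε² = 0`.
    have h3 : inl (mk F) + inl (mk (derivative F)) * DualNumber.eps = 0 := by
      rw [← h1, ← h2 F, ← h2 (derivative F), ← derivative_map,
        ← eval_add_of_sq_eq_zero _ _ _ he, Polynomial.eval_map]
      rfl
    have h4 := congrArg TrivSqZeroExt.snd h3
    have h5 : mk (derivative F) = 0 := by
      rw [TrivSqZeroExt.snd_add, TrivSqZeroExt.snd_mul, DualNumber.snd_eps, DualNumber.fst_eps,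
        TrivSqZeroExt.snd_zero] at h4
      simp only [inl, TrivSqZeroExt.inlHom_apply, TrivSqZeroExt.snd_inl, TrivSqZeroExt.fst_inl,
        smul_zero, add_zero, zero_add, smul_eq_mul, mul_one] at h4
      exact h4
    have := isTorsionFree_int_of_rat R
    refine X_pow_succ_dvd_of_derivative ?_ ((hmk _).mp h5)
    have h6 := map_evalM (evalRingHom (0 : R)).toRatAlgHom P f
    have h7 : P.map (evalRingHom (0 : R)).toRatAlgHom = 1 := by
      change (evalRingHom (0 : R)).mapMatrix P = 1
      rw [hP, mapMatrix_texp, smul_map_eq, coe_evalRingHom, eval_X, zero_smul, texp_zero]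
    rw [h7, evalM_one_eq_zero hf, hF] at h6
    rw [coeff_zero_eq_eval_zero]
    exact h6

/-- All points of `G` differ from the identity by a matrix whose `(N + 1)`-st power vanishes. -/
def UnipLe (G : LinAlgGroup n) (N : ℕ) : Prop :=
  ∀ (R : Type) [CommRing R] [Algebra ℚ R] (A : Matrix (Fin n) (Fin n) R),
    G.HasPt A → (A - 1) ^ (N + 1) = 0

/-- Since `exp(XY) - 1 = X(Y + XZ)`, its `(N + 1)`-st power has leading coefficient `Y ^ (N + 1)` in
degree `N + 1`. Working modulo `X ^ (N + 2)` retains exactly that coefficient. -/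
theorem IsTangent.pow_eq_zero {N : ℕ} (hG : G.UnipLe N) {Y : Matrix (Fin n) (Fin n) R}
    (hY : G.IsTangent Y) : Y ^ (N + 1) = 0 := by
  obtain ⟨A, _, _, mk, hmk⟩ := exists_truncation R (N + 2)
  set P := texp (N + 1) ((X : R[X]) • Y.map C) with hP
  have hpt : G.HasPt (P.map mk) :=
    hasPt_map_of_dvd hmk (isNilpotent_texp_map hmk Y (by omega)) (hY.X_pow_dvd (N + 1) (N + 2) le_rfl)
  have h1 := hG _ _ hpt
  obtain ⟨Z, hZ⟩ : ∃ Z, P - 1 = (X : R[X]) • (Y.map C + (X : R[X]) • Z) := by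
    refine ⟨∑ k ∈ Finset.range N, ((k + 2)! : ℚ)⁻¹ • ((X : R[X]) ^ k • (Y.map C) ^ (k + 2)), ?_⟩
    rw [hP, texp, Finset.sum_range_succ', Finset.sum_range_succ', smul_add, Finset.smul_sum,
      Finset.smul_sum]
    simp only [Nat.factorial_zero, Nat.factorial_one, Nat.cast_one, inv_one, pow_zero, zero_add,
      pow_one, one_smul, add_sub_cancel_right]
    rw [add_comm]
    congr 1
    refine Finset.sum_congr rfl fun k _ => ?_
    rw [smul_comm (X : R[X]) ((k + 2)! : ℚ)⁻¹, smul_comm (X : R[X]) ((k + 2)! : ℚ)⁻¹, smul_smul,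
      smul_smul, _root_.smul_pow]
    congr 2
    ring
  set Q := Y.map C + (X : R[X]) • Z with hQ
  have h2 : mk.mapMatrix ((X : R[X]) ^ (N + 1) • Q ^ (N + 1)) = 0 := by
    rw [← _root_.smul_pow, ← hZ, map_pow, map_sub, map_one]
    exact h1
  have h3 : Y = (evalRingHom (0 : R)).mapMatrix Q := by
    ext i j
    simp [hQ]
  rw [h3, ← map_pow]
  ext i j
  have h4 := congrFun (congrFun h2 i) j
  have h5 : mk ((X : R[X]) ^ (N + 1) * (Q ^ (N + 1)) i j) = 0 := h4
  have h6 := (hmk _).mp h5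
  have h7 := X_pow_dvd_iff.mp h6 (0 + (N + 1)) (by omega)
  rw [coeff_X_pow_mul] at h7
  exact (coeff_zero_eq_eval_zero _).symm.trans h7

theorem texp_eq_of_le {A : Type*} [Ring A] [Module ℚ A] {N M : ℕ} {W : A} (h : W ^ (N + 1) = 0)
    (hM : N ≤ M) : texp M W = texp N W := by
  rw [texp_eq_exp h le_rfl, texp_eq_exp h (by omega)]

/-- As `Y` is nilpotent, the truncation order may be raised at will, so the polynomial `f(exp(XY))`
is divisible by every power of `X` and is zero. Then `X` is specialised to `r`. -/
theorem IsTangent.evalM_texp {N : ℕ} (hG : G.UnipLe N) {Y : Matrix (Fin n) (Fin n) R}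
    (hY : G.IsTangent Y) (r : R) {f : MvPolynomial (Fin n × Fin n) ℚ} (hf : f ∈ G.I) :
    evalM ℚ (texp N (r • Y)) f = 0 := by
  have h0 : ((X : R[X]) • Y.map C) ^ (N + 1) = 0 := by
    have : (C : R →+* R[X]).mapMatrix Y ^ (N + 1) = 0 := by
      rw [← map_pow, hY.pow_eq_zero hG, map_zero]
    rw [_root_.smul_pow]
    exact (congrArg _ this).trans (smul_zero _)
  have h1 : evalM ℚ (texp N ((X : R[X]) • Y.map C)) f = 0 := by
    ext d
    have h2 := hY.X_pow_dvd (N + d) (N + d + 1) le_rfl f hf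
    rw [texp_eq_of_le h0 (by omega)] at h2
    exact X_pow_dvd_iff.mp h2 d (by omega)
  have h2 := map_evalM (evalRingHom r).toRatAlgHom (texp N ((X : R[X]) • Y.map C)) f
  rw [h1, map_zero] at h2
  have h3 : (texp N ((X : R[X]) • Y.map C)).map (evalRingHom r).toRatAlgHom = texp N (r • Y) := by
    change (evalRingHom r).mapMatrix _ = _
    rw [mapMatrix_texp, smul_map_eq]
    congr 2
    · simp
    · ext i j
      simp
  rw [← h3, ← h2]

theorem expA_eq_texp {A : Type*} [Ring A] [Algebra ℚ A] (N : ℕ) (Y : A) :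
    expA N Y = texp N ((N ! : ℚ) • Y) := by
  rw [expA_eq_sum, texp]
  refine Finset.sum_congr rfl fun k hk => ?_
  rw [_root_.smul_pow, smul_smul, ← Int.cast_smul_eq_zsmul ℚ]
  congr 1
  rw [Int.cast_natCast, Nat.cast_div (factorial_dvd_factorial_pow
    (Nat.le_of_lt_succ (Finset.mem_range.mp hk))) (by exact_mod_cast k.factorial_ne_zero)]
  push_cast
  rw [div_eq_inv_mul]

theorem IsTangent.hasPt_expA {N : ℕ} (hG : G.UnipLe N) {Y : Matrix (Fin n) (Fin n) R}
    (hY : G.IsTangent Y) : G.HasPt (expA N Y) := by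
  refine hasPt_of_isNilpotent ⟨N + 1, expA_sub_one_pow N (hY.pow_eq_zero hG)⟩ fun f hf => ?_
  rw [expA_eq_texp, ← algebraMap_smul R (N ! : ℚ) Y]
  exact hY.evalM_texp hG _ hf

end LinAlgGroup

end TruncatedExp

end OrbitEnum

namespace OrbitEnum

/-! ### Logarithms of points -/

section TruncatedLog

open Polynomial
open scoped Nat

/-- Both `exp(N! · N! log(1 + X))` and `(1 + X) ^ (N!²)` solve `(1 + X) u' = N!² u` with `u(0) = 1`,
the former modulo `X ^ N`. -/
theorem X_pow_dvd_expZ_comp_logZ (N : ℕ) :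
    X ^ (N + 1) ∣ (expZ N).comp (logZ N) - (1 + X) ^ (N ! ^ 2) := by
  set D := (expZ N).comp (logZ N) - (1 + X) ^ (N ! ^ 2) with hD
  have h0 : D.coeff 0 = 0 := by
    obtain ⟨r, hr⟩ := X_dvd_logZ N
    obtain ⟨u, hu⟩ := X_dvd_expZ_sub_one N
    rw [coeff_zero_eq_eval_zero, hD, eq_add_of_sub_eq hu, hr]
    simp
  have h1 : X ^ N ∣ (1 + X) * derivative D - C ((N ! : ℤ) ^ 2) * D := by
    obtain ⟨r, hr⟩ := X_pow_dvd_derivative_expZ N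
    obtain ⟨l, hl⟩ := X_dvd_logZ N
    have h2 := one_add_X_mul_derivative_logZ N
    have h3 := congrArg (fun p => p.comp (logZ N)) hr
    simp only [sub_comp, mul_comp, C_comp, pow_comp, X_comp] at h3
    have h4 : logZ N ^ N = X ^ N * l ^ N := by rw [hl, mul_pow]
    have h5 : (-X : ℤ[X]) ^ N = X ^ N * (-1) ^ N := by rw [neg_pow, mul_comm]
    have h6 : (1 + X : ℤ[X]) * derivative ((1 + X) ^ (N ! ^ 2)) =
        C ((N ! : ℤ) ^ 2) * (1 + X) ^ (N ! ^ 2) := by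
      obtain ⟨e, he⟩ : ∃ e, N ! ^ 2 = e + 1 :=
        ⟨_, (Nat.succ_pred_eq_of_pos (pow_pos N.factorial_pos 2)).symm⟩
      have he' : ((N ! : ℤ) ^ 2) = e + 1 := by exact_mod_cast he
      rw [he, he', derivative_pow_succ, derivative_add, derivative_one, derivative_X]
      simp only [map_add, map_one, map_natCast]
      ring
    refine ⟨C (N ! : ℤ) * (l ^ N * r.comp (logZ N)) - C (N ! : ℤ) * (-1) ^ N *
      (derivative (expZ N)).comp (logZ N), ?_⟩
    rw [hD, derivative_sub, derivative_comp, mul_sub, h6, C_pow]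
    rw [h4] at h3
    rw [h5] at h2
    linear_combination ((derivative (expZ N)).comp (logZ N)) * h2 + C (N ! : ℤ) * h3
  -- If `X ^ j` divides `D`, the equation makes it divide `(1 + X) D'`, hence `D'`, because `1 + X`
  -- is prime to `X`; integration gains one power.
  have key : ∀ j ≤ N + 1, X ^ j ∣ D := by
    intro j
    induction j with
    | zero => exact fun _ => by rw [pow_zero]; exact one_dvd _
    | succ j ih =>
      intro hj
      refine X_pow_succ_dvd_of_derivative h0 ?_
      have h2 : X ^ j ∣ (1 + X) * derivative D := by
        have := (dvd_add ((pow_dvd_pow X (Nat.le_of_succ_le_succ hj)).trans h1)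
          ((ih (by omega)).mul_left (C ((N ! : ℤ) ^ 2))))
        rwa [sub_add_cancel] at this
      refine IsCoprime.dvd_of_dvd_mul_left (IsCoprime.pow_left ?_) h2
      exact ⟨-1, 1, by ring⟩
  exact key _ le_rfl

theorem expA_logA {A : Type*} [Ring A] {N : ℕ} {Y : A} (hY : Y ^ (N + 1) = 0) :
    expA N (logA N Y) = (1 + Y) ^ (N ! ^ 2) := by
  obtain ⟨r, hr⟩ := X_pow_dvd_expZ_comp_logZ N
  have h := congrArg (aeval Y) hr
  rw [map_sub, aeval_comp, map_mul, map_pow, map_pow (aeval Y) X, aeval_X, hY, zero_mul, sub_eq_zero] at h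
  refine h.trans ?_
  simp

theorem logA_pow_eq_zero {A : Type*} [Ring A] {N : ℕ} {Y : A} (hY : Y ^ (N + 1) = 0) :
    logA N Y ^ (N + 1) = 0 := by
  obtain ⟨r, hr⟩ := X_dvd_logZ N
  rw [logA, ← map_pow, hr, mul_pow, map_mul, map_pow, aeval_X, hY, zero_mul]

/-- `R` may have zero divisors, so roots cannot be counted in it. Applying `ℚ`-linear functionals to
the coefficients reduces to polynomials over `ℚ` with infinitely many roots. -/
theorem eq_zero_of_eval_natCast {R : Type*} [CommRing R] [Algebra ℚ R] {p : R[X]}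
    (h : ∀ m : ℕ, p.eval (m : R) = 0) : p = 0 := by
  ext i
  rw [coeff_zero, ← Module.forall_dual_apply_eq_zero_iff ℚ]
  intro ψ
  let p' : ℚ[X] := ∑ i ∈ Finset.range (p.natDegree + 1), C (ψ (p.coeff i)) * X ^ i
  have h1 : p' = 0 := by
    refine eq_zero_of_infinite_isRoot _ (Set.infinite_of_injective_forall_mem
      (f := fun m : ℕ => (m : ℚ)) Nat.cast_injective fun m => ?_)
    have h2 := congrArg ψ (h m)
    rw [eval_eq_sum_range, map_sum, map_zero] at h2
    change p'.eval (m : ℚ) = 0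
    rw [← h2, eval_finsetSum]
    refine Finset.sum_congr rfl fun i _ => ?_
    rw [eval_mul, eval_C, eval_pow, eval_X, mul_comm (p.coeff i), ← Nat.cast_pow, ← Nat.cast_pow,
      ← nsmul_eq_mul, map_nsmul, nsmul_eq_mul, mul_comm]
  have h3 := congrArg (fun q => q.coeff i) h1
  simp only [p', finsetSum_coeff, coeff_C_mul, coeff_X_pow, coeff_zero] at h3
  by_cases hi : i < p.natDegree + 1
  · simpa [hi] using h3
  · rw [coeff_eq_zero_of_natDegree_lt (by omega), map_zero]

variable {n : ℕ}

namespace LinAlgGroup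

variable {G : LinAlgGroup n} {R : Type} [CommRing R] [Algebra ℚ R]

/-- With `Z = N! · logA N (A - 1)`, one has `exp(mZ) = A ^ (N!² m)`, a point of `G` for every
natural `m`. So each equation of `G` vanishes on `exp(mZ)` for all `m`, hence identically on
`exp(XZ)`. Substituting `X = ε` gives the point `1 + εZ`, and `N!` is divided out at the end. -/
theorem HasPt.isTangent_logA {N : ℕ} (hG : G.UnipLe N) {A : Matrix (Fin n) (Fin n) R}
    (hA : G.HasPt A) : G.IsTangent (logA N (A - 1)) := by
  have hA0 := hG R A hA
  set Y := logA N (A - 1) with hY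
  have hY0 : Y ^ (N + 1) = 0 := logA_pow_eq_zero hA0
  set Z := (N ! : ℚ) • Y with hZ
  have hZ0 : Z ^ (N + 1) = 0 := by rw [hZ, _root_.smul_pow, hY0, smul_zero]
  have hmap : ∀ {S : Type} [CommRing S] (f : R →+* S) (s : S), (s • Z.map f) ^ (N + 1) = 0 := by
    intro S _ f s
    have : f.mapMatrix Z ^ (N + 1) = 0 := by rw [← map_pow, hZ0, map_zero]
    rw [_root_.smul_pow]
    exact (congrArg _ this).trans (smul_zero _)
  have hexp : texp N Z = A ^ (N ! ^ 2) := by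
    rw [hZ, ← expA_eq_texp, expA_logA hA0, add_sub_cancel]
  set P := texp N ((X : R[X]) • Z.map C) with hP
  have hF : ∀ f ∈ G.I, evalM ℚ P f = 0 := by
    intro f hf
    refine eq_zero_of_eval_natCast fun m => ?_
    have h2 := map_evalM (evalRingHom (m : R)).toRatAlgHom P f
    have h3 : P.map (evalRingHom (m : R)).toRatAlgHom = A ^ (N ! ^ 2 * m) := by
      change (evalRingHom (m : R)).mapMatrix P = _
      have h4 : (evalRingHom (m : R)).mapMatrix ((X : R[X]) • Z.map C) = m • Z := by
        rw [smul_map_eq]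
        ext i j
        simp
      rw [hP, mapMatrix_texp, h4, pow_mul, ← hexp, texp_eq_exp hZ0 le_rfl,
        texp_eq_exp (j := N + 1) (by rw [_root_.smul_pow, hZ0, smul_zero]) le_rfl]
      clear h2
      clear h4
      induction m with
      | zero => rw [zero_smul, pow_zero, IsNilpotent.exp_zero]
      | succ m ih =>
        rw [succ_nsmul, pow_succ, ← ih, IsNilpotent.exp_add_of_commute
          ((Commute.refl Z).smul_left m) ⟨N + 1, by rw [_root_.smul_pow, hZ0, smul_zero]⟩
          ⟨N + 1, hZ0⟩]
    rw [h3, (hA.pow _).evalM_eq_zero f hf] at h2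
    exact h2
  have hZt : G.IsTangent Z := by
    refine isTangent_iff.mpr fun f hf => ?_
    let t : R[X] →+* DualNumber R := eval₂RingHom (TrivSqZeroExt.inlHom R R) DualNumber.eps
    have h1 : t.mapMatrix P = oneAddEps Z := by
      have h2 : t.mapMatrix ((X : R[X]) • Z.map C) =
          (DualNumber.eps : DualNumber R) • Z.map (TrivSqZeroExt.inlHom R R) := by
        rw [smul_map_eq]
        congr 1
        · exact eval₂_X _ _
        · ext a b : 1
          exact eval₂_C _ _
      rw [hP, mapMatrix_texp, h2, texp_eq_exp (hmap _ _) le_rfl, oneAddEps_eq_exp]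
    have h2 := map_evalM t.toRatAlgHom P f
    rw [hF f hf, map_zero] at h2
    exact (congrArg (fun B => evalM ℚ B f) h1).symm.trans h2.symm
  have h1 := hZt.smul (algebraMap ℚ R (N ! : ℚ)⁻¹)
  rwa [algebraMap_smul, hZ, smul_smul, inv_mul_cancel₀ (by exact_mod_cast N.factorial_ne_zero),
    one_smul] at h1

end LinAlgGroup

end TruncatedLog

end OrbitEnum

namespace OrbitEnum

/-! ### Saturated lattices of integral solutions -/

theorem exists_smul_eq_intCast {ι : Type*} [Fintype ι] (x : ι → ℚ) :
    ∃ N : ℤ, N ≠ 0 ∧ ∃ z : ι → ℤ, ∀ i, (z i : ℚ) = N * x i := by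
  obtain ⟨N, hN⟩ := IsLocalization.exist_integer_multiples_of_finite (nonZeroDivisors ℤ) x
  choose z hz using hN
  refine ⟨N, nonZeroDivisors.coe_ne_zero N, z, fun i => ?_⟩
  rw [← zsmul_eq_mul]
  exact hz i

/-- The solution set over `ℚ`-algebras of a system of homogeneous linear equations is parameterised
by an integral matrix with an integral left inverse. -/
theorem exists_integral_parametrisation {ι : Type} [Fintype ι] [DecidableEq ι]
    (D : Set (ι → ℚ)) : ∃ (k : ℕ) (B : Matrix ι (Fin k) ℤ) (C : Matrix (Fin k) ι ℤ), C * B = 1 ∧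
      ∀ (R : Type) [CommRing R] [Algebra ℚ R] (y : ι → R),
        (∀ d ∈ D, ∑ i, algebraMap ℚ R (d i) * y i = 0) ↔
          ∃ s : Fin k → R, y = B.map (Int.castRingHom R) *ᵥ s := by
  -- The lattice of integral solutions. A basis of it will form the columns of `B`.
  let L : Submodule ℤ (ι → ℤ) :=
    { carrier := {z | ∀ d ∈ D, ∑ i, d i * (z i : ℚ) = 0}
      zero_mem' := fun d _ => by simp
      add_mem' := fun {a b} ha hb d hd => by
        simp only [Pi.add_apply, Int.cast_add, mul_add, Finset.sum_add_distrib, ha d hd, hb d hd,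
          add_zero]
      smul_mem' := fun c a ha d hd => by
        simp only [Pi.smul_apply, smul_eq_mul, Int.cast_mul, mul_left_comm _ (c : ℚ),
          ← Finset.mul_sum, ha d hd, mul_zero] }
  have hsat : ∀ (c : ℤ) (z : ι → ℤ), c ≠ 0 → c • z ∈ L → z ∈ L := by
    intro c z hc h d hd
    have h1 := h d hd
    simp only [Pi.smul_apply, smul_eq_mul, Int.cast_mul, mul_left_comm _ (c : ℚ),
      ← Finset.mul_sum] at h1
    exact (mul_eq_zero.mp h1).resolve_left (by exact_mod_cast hc)
  have htf : Module.IsTorsionFree ℤ ((ι → ℤ) ⧸ L) := by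
    refine Module.isTorsionFree_iff_smul_eq_zero.mpr ?_
    intro c x hx
    obtain ⟨z, rfl⟩ := L.mkQ_surjective x
    by_cases hc : c = 0
    · exact Or.inl hc
    · right
      rw [← map_smul] at hx
      exact (Submodule.Quotient.mk_eq_zero L).mpr
        (hsat c z hc ((Submodule.Quotient.mk_eq_zero L).mp hx))
  have : Module.Free ℤ ((ι → ℤ) ⧸ L) := inferInstance
  -- `L` is saturated, so the quotient is free and splits off. The resulting projection `ρ` onto
  -- `L`, in coordinates, is the matrix `C`.
  obtain ⟨σ, hσ⟩ := Module.projective_lifting_property L.mkQ LinearMap.id L.mkQ_surjective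
  let ρ : (ι → ℤ) →ₗ[ℤ] L := (LinearMap.id - σ ∘ₗ L.mkQ).codRestrict L fun z => by
    rw [← Submodule.Quotient.mk_eq_zero L]
    change L.mkQ (z - σ (L.mkQ z)) = 0
    have := LinearMap.congr_fun hσ (L.mkQ z)
    rw [map_sub]
    exact sub_eq_zero.mpr this.symm
  have hρ : ∀ z : L, ρ z = z := fun z => by
    apply Subtype.ext
    change z.1 - σ (L.mkQ z.1) = z.1
    rw [(Submodule.Quotient.mk_eq_zero L).mpr z.2 |> fun h : L.mkQ z.1 = 0 => h, map_zero, sub_zero]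
  let b := Module.finBasis ℤ L
  let B : Matrix ι (Fin (Module.finrank ℤ L)) ℤ := Matrix.of fun i j => (b j).1 i
  let C : Matrix (Fin (Module.finrank ℤ L)) ι ℤ := Matrix.of fun j i => b.repr (ρ (Pi.single i 1)) j
  have hC : ∀ z : ι → ℤ, C *ᵥ z = b.repr (ρ z) := by
    intro z
    ext j
    have hz : z = ∑ i, z i • (Pi.single i 1 : ι → ℤ) := by
      ext i
      simp [Pi.single_apply]
    conv_rhs => rw [hz]
    simp only [map_sum, map_smul, Finsupp.coe_finsetSum, Finset.sum_apply, Finsupp.smul_apply,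
      smul_eq_mul, Matrix.mulVec, dotProduct, C, Matrix.of_apply, mul_comm]
  have hB : ∀ z ∈ L, B *ᵥ (C *ᵥ z) = z := by
    intro z hz
    rw [hC, hρ ⟨z, hz⟩]
    have := congrArg Subtype.val (b.sum_repr ⟨z, hz⟩)
    refine Eq.trans ?_ this
    ext i
    rw [Submodule.coe_sum, Finset.sum_apply]
    change ∑ j, (b j).1 i * b.repr ⟨z, hz⟩ j = ∑ j, b.repr ⟨z, hz⟩ j * (b j).1 i
    exact Finset.sum_congr rfl fun j _ => mul_comm _ _
  have hBL : ∀ j, (fun i => B i j) ∈ L := fun j => (b j).2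
  refine ⟨_, B, C, ?_, fun R _ _ y => ⟨fun hy => ⟨C.map (Int.castRingHom R) *ᵥ y, ?_⟩, ?_⟩⟩
  · ext j j'
    have h1 := congrFun (hC (b j').1) j
    rw [hρ, b.repr_self, Finsupp.single_apply] at h1
    rw [Matrix.one_apply]
    simp only [eq_comm (a := j)]
    exact h1
  · ext i
    let r : ι → ℚ := fun l => (((1 : Matrix ι ι ℤ) - B * C) i l : ℤ)
    have hr : ∀ z ∈ L, ∑ l, r l * (z l : ℚ) = 0 := by
      intro z hz
      have h1 : ((1 : Matrix ι ι ℤ) - B * C) *ᵥ z = 0 := by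
        rw [Matrix.sub_mulVec, Matrix.one_mulVec, ← Matrix.mulVec_mulVec, hB z hz, sub_self]
      have h2 := congrFun h1 i
      simp only [Matrix.mulVec, dotProduct, Pi.zero_apply] at h2
      have h3 := congrArg (Int.cast (R := ℚ)) h2
      rw [Int.cast_sum, Int.cast_zero] at h3
      rw [← h3]
      exact Finset.sum_congr rfl fun l _ => (Int.cast_mul _ _).symm
    -- The row `r` of `1 - B C` annihilates `L`. Were it outside the span of `D`, some functional
    -- vanishing on `D` but not on `r` would, after clearing denominators, be an element of `L` that
    -- `r` does not annihilate. So the equations in `D` imply `y = B C y` over every `ℚ`-algebra.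
    have hmem : r ∈ Submodule.span ℚ D := by
      by_contra hcon
      obtain ⟨f, hf, hle⟩ := Submodule.exists_le_ker_of_notMem hcon
      obtain ⟨N, hN, z, hz⟩ := exists_smul_eq_intCast fun l => f (Pi.single l 1)
      have hfx : ∀ x : ι → ℚ, ∑ l, x l * (z l : ℚ) = N * f x := by
        intro x
        have hx : x = ∑ i, x i • (Pi.single i 1 : ι → ℚ) := by
          ext i
          simp [Pi.single_apply]
        conv_rhs => rw [hx]
        rw [map_sum, Finset.mul_sum]
        refine Finset.sum_congr rfl fun l _ => ?_
        rw [hz, map_smul, smul_eq_mul]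
        ring
      have hzL : z ∈ L := fun d hd => by
        rw [hfx, LinearMap.mem_ker.mp (hle (Submodule.subset_span hd)), mul_zero]
      have h1 := hr z hzL
      rw [hfx] at h1
      exact hf ((mul_eq_zero.mp h1).resolve_left (by exact_mod_cast hN))
    have hsum : ∀ x ∈ Submodule.span ℚ D, ∑ l, algebraMap ℚ R (x l) * y l = 0 := by
      intro x hx
      induction hx using Submodule.span_induction with
      | mem d hd => exact hy d hd
      | zero => simp
      | add x x' _ _ hx hx' =>
        simp only [Pi.add_apply, map_add, add_mul, Finset.sum_add_distrib, hx, hx', add_zero]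
      | smul c x _ hx =>
        simp only [Pi.smul_apply, smul_eq_mul, map_mul, mul_assoc, ← Finset.mul_sum, hx, mul_zero]
    have h3 : ∑ l, algebraMap ℚ R (r l) * y l =
        (((1 : Matrix ι ι ℤ) - B * C).map (Int.castRingHom R) *ᵥ y) i := by
      simp only [Matrix.mulVec, dotProduct, r, Matrix.map_apply, map_intCast, eq_intCast]
    replace hsum := h3.symm.trans (hsum r hmem)
    have h4 : ((1 : Matrix ι ι ℤ) - B * C).map (Int.castRingHom R) =
        1 - B.map (Int.castRingHom R) * C.map (Int.castRingHom R) := by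
      change (Int.castRingHom R).mapMatrix _ = _
      rw [map_sub, map_one, ← Matrix.map_mul]
      rfl
    rw [h4, Matrix.sub_mulVec, Matrix.one_mulVec, ← Matrix.mulVec_mulVec, Pi.sub_apply,
      sub_eq_zero] at hsum
    exact hsum
  · rintro ⟨s, rfl⟩ d hd
    have h1 : ∀ j, ∑ i, algebraMap ℚ R (d i) * Int.castRingHom R (B i j) = 0 := by
      intro j
      have := congrArg (algebraMap ℚ R) (hBL j d hd)
      simpa using this
    simp only [Matrix.mulVec, dotProduct, Finset.mul_sum, Matrix.map_apply]
    rw [Finset.sum_comm]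
    simp only [← mul_assoc, ← Finset.sum_mul, h1, zero_mul, Finset.sum_const_zero]

end OrbitEnum

namespace OrbitEnum

/-! ### Points of closures of unipotent groups -/

section ClosurePoints

open scoped Nat

variable {n k : ℕ}

/-- The matrix whose entries are the integral linear forms in `s` with coefficients `B`. -/
def linMat {κ : Type} [Fintype κ] (B : Matrix (Fin n × Fin n) κ ℤ) {S : Type} [CommRing S]
    (s : κ → S) : Matrix (Fin n) (Fin n) S :=
  Matrix.of fun a b => (B.map (Int.castRingHom S) *ᵥ s) (a, b)

theorem linMat_apply {κ : Type} [Fintype κ] (B : Matrix (Fin n × Fin n) κ ℤ) {S : Type}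
    [CommRing S] (s : κ → S) (a b : Fin n) : linMat B s a b = ∑ j, (B (a, b) j : S) * s j := rfl

theorem mapMatrix_linMat {κ : Type} [Fintype κ] (B : Matrix (Fin n × Fin n) κ ℤ) {S S' : Type}
    [CommRing S] [CommRing S'] (f : S →+* S') (s : κ → S) :
    f.mapMatrix (linMat B s) = linMat B (fun j => f (s j)) := by
  ext a b
  rw [RingHom.mapMatrix_apply, Matrix.map_apply, linMat_apply, linMat_apply, map_sum]
  exact Finset.sum_congr rfl fun j _ => by rw [map_mul, map_intCast]

theorem linMat_smul {κ : Type} [Fintype κ] (B : Matrix (Fin n × Fin n) κ ℤ) {S : Type} [CommRing S]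
    (r : S) (s : κ → S) : linMat B (r • s) = r • linMat B s := by
  ext a b
  simp only [linMat, Matrix.mulVec_smul, Matrix.of_apply, Pi.smul_apply, Matrix.smul_apply]

theorem mulVec_linMat {B : Matrix (Fin n × Fin n) (Fin k) ℤ}
    {C : Matrix (Fin k) (Fin n × Fin n) ℤ} (h : C * B = 1) {S : Type} [CommRing S]
    (s : Fin k → S) :
    C.map (Int.castRingHom S) *ᵥ (fun ij => linMat B s ij.1 ij.2) = s := by
  change C.map (Int.castRingHom S) *ᵥ (B.map (Int.castRingHom S) *ᵥ s) = s
  rw [Matrix.mulVec_mulVec, ← Matrix.map_mul, h, Matrix.map_one _ (map_zero _) (map_one _),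
    Matrix.one_mulVec]

/-- The generic matrix. -/
noncomputable def genMat (n : ℕ) : Matrix (Fin n) (Fin n) (MvPolynomial (Fin n × Fin n) ℤ) :=
  Matrix.of fun a b => MvPolynomial.X (a, b)

theorem mapMatrix_genMat {S : Type} [CommRing S] (g : GL (Fin n) S) :
    (evalMat ℤ g).toRingHom.mapMatrix (genMat n) = g := by
  ext a b
  simp [genMat]

namespace LinAlgGroup

variable {G : LinAlgGroup n}

/-- The entries of `E` are integral polynomials in the ideal of the closure. Matrix identities over
`ℚ`-algebras are thereby transferred to arbitrary rings. -/
theorem mapMatrix_eq_zero_of_mem_closurePts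
    {E : Matrix (Fin n) (Fin n) (MvPolynomial (Fin n × Fin n) ℤ)}
    (hE : ∀ (R : Type) [CommRing R] [Algebra ℚ R], ∀ g ∈ G.pts R,
      (evalMat ℤ g).toRingHom.mapMatrix E = 0) {S : Type} [CommRing S] {g : GL (Fin n) S}
    (hg : g ∈ G.closurePts S) : (evalMat ℤ g).toRingHom.mapMatrix E = 0 := by
  ext a b
  exact hg (E a b) fun R _ _ g hg => congrFun (congrFun (hE R g hg) a) b

theorem exists_isTangent_iff (G : LinAlgGroup n) : ∃ (k : ℕ)
    (B : Matrix (Fin n × Fin n) (Fin k) ℤ) (C : Matrix (Fin k) (Fin n × Fin n) ℤ), C * B = 1 ∧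
      ∀ (R : Type) [CommRing R] [Algebra ℚ R] (Y : Matrix (Fin n) (Fin n) R),
        G.IsTangent Y ↔ ∃ s : Fin k → R, Y = linMat B s := by
  obtain ⟨k, B, C, h, h'⟩ := exists_integral_parametrisation (differential n '' G.I)
  refine ⟨k, B, C, h, fun R _ _ Y => ?_⟩
  have h1 := h' R fun ij => Y ij.1 ij.2
  rw [Set.forall_mem_image] at h1
  refine h1.trans (exists_congr fun s => ⟨fun e => ?_, fun e => ?_⟩)
  · ext a b
    exact congrFun e (a, b)
  · rw [e]
    rfl

section

variable {N : ℕ} {B : Matrix (Fin n × Fin n) (Fin k) ℤ}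
  {C : Matrix (Fin k) (Fin n × Fin n) ℤ}

/-- For independent variables `s` the identity holds over `ℚ[s]`, hence over its subring `ℤ[s]`, and
it specialises to every ring, of any characteristic. -/
theorem linMat_pow_eq_zero (hG : G.UnipLe N)
    (hB : ∀ (R : Type) [CommRing R] [Algebra ℚ R] (Y : Matrix (Fin n) (Fin n) R),
      G.IsTangent Y ↔ ∃ s : Fin k → R, Y = linMat B s)
    {S : Type} [CommRing S] (s : Fin k → S) :
    linMat B s ^ (N + 1) = 0 := by
  let s₀ : Fin k → MvPolynomial (Fin k) ℤ := MvPolynomial.X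
  have h0 : linMat B s₀ ^ (N + 1) = 0 := by
    have h1 : G.IsTangent ((MvPolynomial.map (Int.castRingHom ℚ)).mapMatrix (linMat B s₀)) :=
      (hB _ _).mpr ⟨_, mapMatrix_linMat B _ s₀⟩
    have h2 := h1.pow_eq_zero hG
    rw [← map_pow] at h2
    ext a b : 1
    exact MvPolynomial.map_injective _ (RingHom.injective_int _)
      ((congrFun (congrFun h2 a) b).trans (map_zero _).symm)
  have h1 := mapMatrix_linMat B (MvPolynomial.aeval s : _ →ₐ[ℤ] S).toRingHom s₀
  have h2 := congrArg (MvPolynomial.aeval s : _ →ₐ[ℤ] S).toRingHom.mapMatrix h0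
  rw [map_pow, h1, map_zero] at h2
  simpa [s₀] using h2

/-- The same passage from `ℚ[s]` to `ℤ[s]` to `S`; it applies because `expA` has integral
coefficients. -/
theorem exists_closurePts_eq_expA (hG : G.UnipLe N)
    (hB : ∀ (R : Type) [CommRing R] [Algebra ℚ R] (Y : Matrix (Fin n) (Fin n) R),
      G.IsTangent Y ↔ ∃ s : Fin k → R, Y = linMat B s)
    {S : Type} [CommRing S] (s : Fin k → S) :
    ∃ g ∈ G.closurePts S, (g : Matrix (Fin n) (Fin n) S) = expA N (linMat B s) := by
  have hu : IsUnit (expA N (linMat B s)) := by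
    have h : IsNilpotent (expA N (linMat B s) - 1) :=
      ⟨N + 1, expA_sub_one_pow N (linMat_pow_eq_zero hG hB s)⟩
    have := h.isUnit_one_add
    rwa [add_sub_cancel] at this
  refine ⟨hu.unit, fun f hf => ?_, rfl⟩
  let s₀ : Fin k → MvPolynomial (Fin k) ℤ := MvPolynomial.X
  have h0 : evalM ℤ (expA N (linMat B s₀)) f = 0 := by
    let ι : MvPolynomial (Fin k) ℤ →+* MvPolynomial (Fin k) ℚ :=
      MvPolynomial.map (Int.castRingHom ℚ)
    have h1 : G.IsTangent (ι.mapMatrix (linMat B s₀)) := (hB _ _).mpr ⟨_, mapMatrix_linMat B _ s₀⟩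
    obtain ⟨g, hg, hge⟩ := h1.hasPt_expA hG
    have h2 := hf _ g hg
    have h3 := map_evalM ι.toIntAlgHom (expA N (linMat B s₀)) f
    have h4 : (expA N (linMat B s₀)).map ι.toIntAlgHom = g :=
      (map_expA ι.mapMatrix N (linMat B s₀)).trans hge.symm
    rw [h4] at h3
    exact MvPolynomial.map_injective _ (RingHom.injective_int _)
      ((h3.trans h2).trans (map_zero _).symm)
  have h1 := map_evalM (MvPolynomial.aeval s : _ →ₐ[ℤ] S) (expA N (linMat B s₀)) f
  rw [h0, map_zero] at h1
  refine Eq.trans (congrArg (fun A => evalM ℤ A f) ?_) h1.symm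
  change expA N (linMat B s) =
    (MvPolynomial.aeval s : _ →ₐ[ℤ] S).toRingHom.mapMatrix (expA N (linMat B s₀))
  rw [map_expA, mapMatrix_linMat]
  simp [s₀]

theorem sub_one_pow_eq_zero (hG : G.UnipLe N) {S : Type} [CommRing S] {g : GL (Fin n) S}
    (hg : g ∈ G.closurePts S) : ((g : Matrix (Fin n) (Fin n) S) - 1) ^ (N + 1) = 0 := by
  have h := mapMatrix_eq_zero_of_mem_closurePts (E := (genMat n - 1) ^ (N + 1))
    (fun R _ _ g hg => by
      rw [map_pow, map_sub, map_one, mapMatrix_genMat]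
      exact hG R _ ⟨g, hg, rfl⟩) hg
  rwa [map_pow, map_sub, map_one, mapMatrix_genMat] at h

/-- The integral left inverse `C` makes the coordinates of the logarithm integral polynomials in the
matrix entries. That the logarithm is recovered from them is then an integral identity, valid on `G`
and so on its closure. -/
theorem exists_logA_eq_linMat (hG : G.UnipLe N) (hCB : C * B = 1)
    (hB : ∀ (R : Type) [CommRing R] [Algebra ℚ R] (Y : Matrix (Fin n) (Fin n) R),
      G.IsTangent Y ↔ ∃ s : Fin k → R, Y = linMat B s)
    {S : Type} [CommRing S] {g : GL (Fin n) S}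
    (hg : g ∈ G.closurePts S) :
    ∃ s : Fin k → S, logA N ((g : Matrix (Fin n) (Fin n) S) - 1) = linMat B s := by
  let L := logA N (genMat n - 1)
  let t : Fin k → MvPolynomial (Fin n × Fin n) ℤ :=
    C.map (Int.castRingHom _) *ᵥ fun ij => L ij.1 ij.2
  have hL : ∀ {S : Type} [CommRing S] (g : GL (Fin n) S),
      (evalMat ℤ g).toRingHom.mapMatrix L = logA N ((g : Matrix (Fin n) (Fin n) S) - 1) := by
    intro S _ g
    rw [map_logA, map_sub, map_one, mapMatrix_genMat]
  have ht : ∀ {S : Type} [CommRing S] (g : GL (Fin n) S),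
      (fun j => (evalMat ℤ g).toRingHom (t j)) = C.map (Int.castRingHom S) *ᵥ fun ij =>
        logA N ((g : Matrix (Fin n) (Fin n) S) - 1) ij.1 ij.2 := by
    intro S _ g
    rw [← hL g]
    ext j
    simp only [t, Matrix.mulVec, dotProduct, map_sum, map_mul, Matrix.map_apply,
      RingHom.mapMatrix_apply, eq_intCast, map_intCast]
  have h := mapMatrix_eq_zero_of_mem_closurePts (E := L - linMat B t)
    (fun R _ _ g hg => by
      obtain ⟨s, hs⟩ := (hB R _).mp (HasPt.isTangent_logA hG ⟨g, hg, rfl⟩)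
      rw [map_sub, hL, mapMatrix_linMat, ht, hs, mulVec_linMat hCB, sub_self]) hg
  rw [map_sub, hL, mapMatrix_linMat, sub_eq_zero] at h
  exact ⟨_, h⟩

end

/-- Over finite fields of sufficiently large characteristic, the points of the closure of a
unipotent group are parameterised by an affine space by means of the exponential map. -/
theorem exists_exp_parametrisation {N : ℕ} (hG : G.UnipLe N) : ∃ (k : ℕ)
    (B : Matrix (Fin n × Fin n) (Fin k) ℤ), ∀ (F : Type) [Field F] [Finite F], (N ! : F) ≠ 0 →
      (∀ s : Fin k → F, linMat B s ^ (N + 1) = 0) ∧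
        ∃ e : (Fin k → F) ≃ G.closurePts F,
          ∀ s, ((e s).1 : Matrix (Fin n) (Fin n) F) = expA N (linMat B s) := by
  obtain ⟨k, B, C, hCB, hB⟩ := G.exists_isTangent_iff
  refine ⟨k, B, fun F _ _ hF => ⟨linMat_pow_eq_zero hG hB, ?_⟩⟩
  have hF2 : ((N ! : ℤ) ^ 2 : F) ≠ 0 := by
    rw [Int.cast_natCast]
    exact pow_ne_zero 2 hF
  have hlog : ∀ s : Fin k → F, logA N (expA N (linMat B s) - 1) = linMat B (((N ! : ℤ) ^ 2 : F) • s) := by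
    intro s
    rw [logA_expA N (linMat_pow_eq_zero hG hB s), linMat_smul, ← Int.cast_smul_eq_zsmul F,
      Int.cast_pow]
  choose g hg hge using fun s : Fin k → F => exists_closurePts_eq_expA hG hB s
  refine ⟨Equiv.ofBijective (fun s => ⟨g s, hg s⟩) ⟨fun s s' h => ?_, fun ⟨h, hh⟩ => ?_⟩, hge⟩
  · have h1 : expA N (linMat B s) = expA N (linMat B s') := by
      rw [← hge, ← hge]
      exact congrArg (fun x : G.closurePts F => (x.1 : Matrix (Fin n) (Fin n) F)) h
    have h2 := hlog s
    rw [h1, hlog s'] at h2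
    have h3 := mulVec_linMat hCB (((N ! : ℤ) ^ 2 : F) • s)
    rw [← h2, mulVec_linMat hCB] at h3
    exact (smul_right_injective _ hF2 h3).symm
  -- Any `h` is the exponential of some nilpotent `Y`. Its logarithm `N!² Y` lies in the image of
  -- `linMat B`; hence so does `Y`.
  · obtain ⟨Y, hY, hYe⟩ := exists_expA_eq hF (sub_one_pow_eq_zero hG hh)
    obtain ⟨s, hs⟩ := exists_logA_eq_linMat hG hCB hB hh
    have h1 := logA_expA N hY
    rw [hYe, hs, ← Int.cast_smul_eq_zsmul F, Int.cast_pow] at h1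
    refine ⟨((N ! : ℤ) ^ 2 : F)⁻¹ • s, Subtype.ext (Units.ext ?_)⟩
    change ((g (((N ! : ℤ) ^ 2 : F)⁻¹ • s)) : Matrix (Fin n) (Fin n) F) = h
    rw [hge, linMat_smul, h1, smul_smul, inv_mul_cancel₀ hF2, one_smul, hYe]

/-- The exponent of nilpotency could depend on the point. The one for a generic point serves all,
since nilpotency is a set of integral equations in the matrix entries. -/
theorem IsUnip.exists_unipLe (hG : G.IsUnip) : ∃ N, G.UnipLe N := by
  obtain ⟨S, _, _, u, hu, hI⟩ := G.exists_generic
  obtain ⟨N, hN⟩ := hG S u hu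
  refine ⟨N, fun R _ _ A ⟨g, hg, hgA⟩ => pow_eq_zero_of_le N.le_succ ?_⟩
  have h1 : (evalMat ℤ u).toRingHom.mapMatrix ((genMat n - 1) ^ N) = 0 := by
    rwa [map_pow, map_sub, map_one, mapMatrix_genMat]
  have h2 : (evalMat ℤ g).toRingHom.mapMatrix ((genMat n - 1) ^ N) = 0 := by
    ext a b
    exact hI _ (congrFun (congrFun h1 a) b) R g hg
  rwa [map_pow, map_sub, map_one, mapMatrix_genMat, hgA] at h2

/-- `g - 1` is strictly upper triangular, so its characteristic polynomial is `X ^ n`, and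
Cayley–Hamilton applies. -/
theorem LeUni.isUnip (hG : G.LeUni) : G.IsUnip := by
  intro R _ _ g hg
  set M := (g : Matrix (Fin n) (Fin n) R) - 1 with hM
  have h0 : ∀ i j, j ≤ i → M i j = 0 := by
    intro i j hij
    rcases hij.lt_or_eq with h | rfl
    · rw [hM, Matrix.sub_apply, (hG R g hg i j).1 h, Matrix.one_apply_ne h.ne', sub_zero]
    · rw [hM, Matrix.sub_apply, (hG R g hg j j).2, Matrix.one_apply_eq, sub_self]
  have h1 : M.charpoly = Polynomial.X ^ n := by
    rw [Matrix.charpoly_of_isUpperTriangular M fun i j h => h0 i j (le_of_lt h)]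
    simp [h0]
  have h2 := Matrix.aeval_self_charpoly M
  rw [h1, map_pow, Polynomial.aeval_X] at h2
  exact ⟨n, h2⟩

end LinAlgGroup

end ClosurePoints

end OrbitEnum

namespace OrbitEnum

/-! ### Orbits and class numbers of unipotent groups as average sizes of kernels -/

section UnipotentCounts

open scoped Nat

variable {n k : ℕ}

theorem vecMul_linMat (B : Matrix (Fin n × Fin n) (Fin k) ℤ) {S : Type} [CommRing S]
    (s : Fin k → S) (v : Fin n → S) :
    v ᵥ* linMat B s = tform S (fun j a b => B (a, b) j) s v := by
  ext b
  simp only [Matrix.vecMul, dotProduct, linMat_apply, tform_apply, Finset.mul_sum]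
  rw [Finset.sum_comm]
  exact Finset.sum_congr rfl fun j _ => Finset.sum_congr rfl fun a _ => by ring

theorem linMat_mul_linMat_apply (B : Matrix (Fin n × Fin n) (Fin k) ℤ) {S : Type} [CommRing S]
    (s s' : Fin k → S) (a b : Fin n) : (linMat B s * linMat B s') a b =
      ∑ j, ∑ j', ((∑ c, B (a, c) j * B (c, b) j' : ℤ) : S) * (s j * s' j') := by
  simp only [Matrix.mul_apply, linMat_apply, Int.cast_sum, Finset.sum_mul]
  simp only [Finset.mul_sum]
  rw [Finset.sum_comm]
  refine Finset.sum_congr rfl fun j _ => ?_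
  rw [Finset.sum_comm]
  refine Finset.sum_congr rfl fun j' _ => Finset.sum_congr rfl fun c _ => ?_
  push_cast
  ring

/-- The structure constants of the commutator of matrices of linear forms. -/
def commConst (B : Matrix (Fin n × Fin n) (Fin k) ℤ) :
    Fin k → Fin k → Fin n × Fin n → ℤ := fun j j' ab =>
  ∑ c, B (ab.1, c) j * B (c, ab.2) j' - ∑ c, B (ab.1, c) j' * B (c, ab.2) j

theorem tform_commConst (B : Matrix (Fin n × Fin n) (Fin k) ℤ) {S : Type} [CommRing S]
    (s s' : Fin k → S) : tform S (commConst B) s s' = fun ab =>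
      (linMat B s * linMat B s' - linMat B s' * linMat B s) ab.1 ab.2 := by
  ext ab
  rw [Matrix.sub_apply, linMat_mul_linMat_apply, linMat_mul_linMat_apply, tform_apply,
    Finset.sum_comm (s := Finset.univ) (t := Finset.univ) (f := fun j j' =>
      ((∑ c, B (ab.1, c) j * B (c, ab.2) j' : ℤ) : S) * (s' j * s j')), ← Finset.sum_sub_distrib]
  refine Finset.sum_congr rfl fun j _ => ?_
  rw [← Finset.sum_sub_distrib]
  refine Finset.sum_congr rfl fun j' _ => ?_
  rw [commConst, Int.cast_sub]
  ring

theorem natCast_ne_zero_of_gcd_eq_one {q : PP} {a : ℕ} (h : Nat.gcd q.1 a = 1) :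
    (a : Fq q) ≠ 0 := by
  intro h0
  have h1 : Nat.minFac q.1 ∣ a := (CharP.cast_eq_zero_iff (Fq q) (Nat.minFac q.1) a).mp h0
  have h2 := Nat.dvd_gcd (Nat.minFac_dvd q.1) h1
  rw [h] at h2
  exact (Nat.minFac_prime q.2.ne_one).one_lt.ne' (Nat.dvd_one.mp h2)

theorem finite_GL (q : PP) : Finite (GL (Fin n) (Fq q)) :=
  have : Finite (Matrix (Fin n) (Fin n) (Fq q)) := inferInstanceAs (Finite (Fin n → Fin n → Fq q))
  Finite.of_injective _ Units.val_injective

theorem card_fun_Fq (q : PP) (κ : Type) [Fintype κ] :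
    Nat.card (κ → Fq q) = q.1 ^ Fintype.card κ := by
  rw [Nat.card_fun, card_Fq, Nat.card_eq_fintype_card]

namespace LinAlgGroup

theorem evalQ_orbits_mul (G : LinAlgGroup n) {q : PP} {κ : Type} [Fintype κ]
    (e : (κ → Fq q) ≃ G.closurePts (Fq q)) :
    evalQ q G.orbits * (q.1 : ℚ) ^ Fintype.card κ =
      Nat.card {p : (κ → Fq q) × (Fin n → Fq q) //
        p.2 ᵥ* ((e p.1).1 : Matrix (Fin n) (Fin n) (Fq q)) = p.2} := by
  have := finite_GL (n := n) q
  have h := card_quotient_mul_card (orbitSetoid (G.closurePts (Fq q)))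
    (fun (g : G.closurePts (Fq q)) v => v ᵥ* (g.1 : Matrix (Fin n) (Fin n) (Fq q)))
    (fun v => Matrix.vecMul_one v)
    (fun g h v => by
      rw [Matrix.vecMul_vecMul]
      rfl)
    (fun v w => ⟨fun ⟨g, hg, h⟩ => ⟨⟨g, hg⟩, h⟩, fun ⟨g, h⟩ => ⟨g.1, g.2, h⟩⟩)
  rw [← Nat.card_congr e, card_fun_Fq] at h
  have h1 : evalQ q G.orbits = Nat.card (Quotient (orbitSetoid (G.closurePts (Fq q)))) := by
    rw [orbits, evalQ_algebraMap]
    simp [ofCount]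
  rw [h1, ← Nat.cast_pow, ← Nat.cast_mul, h]
  congr 1
  exact Nat.card_congr ((e.prodCongr (Equiv.refl _)).subtypeEquiv fun p => Iff.rfl).symm

theorem evalQ_classes_mul (G : LinAlgGroup n) {q : PP} {κ : Type} [Fintype κ]
    (e : (κ → Fq q) ≃ G.closurePts (Fq q)) :
    evalQ q G.classes * (q.1 : ℚ) ^ Fintype.card κ =
      Nat.card {p : (κ → Fq q) × (κ → Fq q) //
        Commute ((e p.1).1 : Matrix (Fin n) (Fin n) (Fq q)) (e p.2).1} := by
  have := finite_GL (n := n) q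
  have h := card_comm_eq_card_conjClasses_mul_card (G.closurePts (Fq q))
  rw [← Nat.card_congr e, card_fun_Fq] at h
  have h1 : evalQ q G.classes = Nat.card (ConjClasses (G.closurePts (Fq q))) := by
    rw [classes, evalQ_algebraMap]
    simp [ofCount]
  rw [h1, ← Nat.cast_pow, ← Nat.cast_mul, ← h]
  congr 1
  refine Nat.card_congr ((e.prodCongr e).subtypeEquiv fun p => ?_).symm
  refine ⟨fun h => Subtype.ext (Units.ext h), fun h => ?_⟩
  exact congrArg (fun x : G.closurePts (Fq q) => (x.1 : Matrix (Fin n) (Fin n) (Fq q))) h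

variable {G : LinAlgGroup n}

/-- In Burnside's lemma, the vectors fixed by `exp Y` are those killed by `Y`. The characteristics
dividing `N !` are the ones discarded. -/
theorem IsUnip.proj_orbits_mem (hG : G.IsUnip) : Deco.flat.proj G.orbits ∈ algA .flat 1 := by
  obtain ⟨N, hN⟩ := hG.exists_unipLe
  obtain ⟨k, B, h⟩ := exists_exp_parametrisation hN
  let c : Fin k → Fin n → Fin n → ℤ := fun j a b => B (a, b) j
  refine proj_mem_of_evalQ_flat (t := askSym (tform ℤ c))
    ⟨⟨_, _, _, tform ℤ c⟩, (askSym_mfold_one _).symm⟩ 0 0 N ! N.factorial_pos fun q hq => ?_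
  have hq' := natCast_ne_zero_of_gcd_eq_one hq
  obtain ⟨h0, e, he⟩ := h (Fq q) hq'
  rw [pow_zero, one_mul, one_mul]
  refine mul_right_cancel₀ (pow_ne_zero (Fintype.card (Fin k)) q.ne_zero) ?_
  rw [G.evalQ_orbits_mul e, ← Module.finrank_fintype_fun_eq_card ℤ, evalQ_askSym_mul,
    kerSum_bc_tform, kerSum_eq_card]
  congr 1
  refine Nat.card_congr (Equiv.subtypeEquivRight fun p => ?_)
  rw [he, vecMul_expA_eq_iff hq' (h0 _), vecMul_linMat]

/-- Commuting pairs in the group correspond to commuting pairs of tangent matrices. The commutator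
takes values in all `n × n` matrices, so closure of the tangent space under brackets is not needed.
-/
theorem IsUnip.proj_classes_mem (hG : G.IsUnip) : Deco.flat.proj G.classes ∈ algAalt .flat := by
  obtain ⟨N, hN⟩ := hG.exists_unipLe
  obtain ⟨k, B, h⟩ := exists_exp_parametrisation hN
  refine proj_mem_of_evalQ_flat (t := askSym (tform ℤ (commConst B)))
    ⟨⟨_, _, tform ℤ (commConst B), fun s => ?_⟩, rfl⟩ 0 0 N ! N.factorial_pos fun q hq => ?_
  · rw [tform_commConst, sub_self]
    rfl
  have hq' := natCast_ne_zero_of_gcd_eq_one hq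
  obtain ⟨h0, e, he⟩ := h (Fq q) hq'
  rw [pow_zero, one_mul, one_mul]
  refine mul_right_cancel₀ (pow_ne_zero (Fintype.card (Fin k)) q.ne_zero) ?_
  rw [G.evalQ_classes_mul e, ← Module.finrank_fintype_fun_eq_card ℤ, evalQ_askSym_mul,
    kerSum_bc_tform, kerSum_eq_card]
  congr 1
  refine Nat.card_congr (Equiv.subtypeEquivRight fun p => ?_)
  rw [he, he, commute_expA_iff hq' (h0 _) (h0 _), tform_commConst, commute_iff_eq, ← sub_eq_zero]
  exact ⟨fun h => by rw [h]; rfl, fun h => Matrix.ext fun a b => congrFun h (a, b)⟩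

end LinAlgGroup

end UnipotentCounts

end OrbitEnum

namespace OrbitEnum

/-! ### Linearly parameterised groups -/

section LinearGroupsOver

variable {n : ℕ}

/-- A group of matrices `1 + Y`, with `Y` in a linear space of matrices defined over `ℤ` which is
parameterised by some of its entries. -/
structure LinearSubgroup (n : ℕ) (κ : Type) [Fintype κ] : Type where
  B : Matrix (Fin n × Fin n) κ ℤ
  p : κ → Fin n × Fin n
  linMat_p : ∀ (S : Type) [CommRing S] (s : κ → S) (j : κ), linMat B s (p j).1 (p j).2 = s j
  mul : ∀ (S : Type) [CommRing S] (s s' : κ → S), ∃ s'' : κ → S,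
    (1 + linMat B s) * (1 + linMat B s') = 1 + linMat B s''
  inv : ∀ (S : Type) [CommRing S] (s : κ → S), ∃ s' : κ → S,
    (1 + linMat B s) * (1 + linMat B s') = 1

namespace LinearSubgroup

variable {κ : Type} [Fintype κ] (L : LinearSubgroup n κ)

/-- The equations of a linearly parameterised group. -/
noncomputable def eqns : Matrix (Fin n) (Fin n) (MvPolynomial (Fin n × Fin n) ℤ) :=
  genMat n - 1 - linMat L.B fun j => (genMat n - 1) (L.p j).1 (L.p j).2

theorem mapMatrix_eqns {S : Type} [CommRing S] (A : Matrix (Fin n) (Fin n) S) :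
    (evalM ℤ A).toRingHom.mapMatrix L.eqns =
      A - 1 - linMat L.B fun j => (A - 1) (L.p j).1 (L.p j).2 := by
  have h1 : (evalM ℤ A).toRingHom.mapMatrix (genMat n - 1) = A - 1 := by
    rw [map_sub, map_one]
    congr 1
    ext a b
    simp [genMat]
  rw [eqns, map_sub, h1, mapMatrix_linMat]
  congr 2
  ext j
  exact congrFun (congrFun h1 _) _

theorem mapMatrix_eqns_eq_zero_iff {S : Type} [CommRing S] (A : Matrix (Fin n) (Fin n) S) :
    (evalM ℤ A).toRingHom.mapMatrix L.eqns = 0 ↔ ∃ s : κ → S, A = 1 + linMat L.B s := by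
  rw [mapMatrix_eqns]
  constructor
  · intro h
    refine ⟨fun j => (A - 1) (L.p j).1 (L.p j).2, ?_⟩
    rw [← sub_eq_zero.mp h, add_sub_cancel]
  · rintro ⟨s, rfl⟩
    simp only [add_sub_cancel_left, L.linMat_p, sub_self]

/-- The polynomials that vanish on a linearly parameterised group. -/
def ideal : Ideal (MvPolynomial (Fin n × Fin n) ℚ) where
  carrier := {f | ∀ (R : Type) [CommRing R] [Algebra ℚ R] (s : κ → R),
    evalM ℚ (1 + linMat L.B s) f = 0}
  zero_mem' := fun _ _ _ _ => map_zero _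
  add_mem' := fun {f f'} hf hf' R _ _ s => by rw [map_add, hf, hf', add_zero]
  smul_mem' := fun c f hf R _ _ s => by rw [smul_eq_mul, map_mul, hf, mul_zero]

theorem eval_ideal_iff {R : Type} [CommRing R] [Algebra ℚ R] (A : Matrix (Fin n) (Fin n) R) :
    (∀ f ∈ L.ideal, evalM ℚ A f = 0) ↔ ∃ s : κ → R, A = 1 + linMat L.B s := by
  refine ⟨fun h => ?_, ?_⟩
  · have hmap : ∀ {R : Type} [CommRing R] [Algebra ℚ R] (A : Matrix (Fin n) (Fin n) R)
        (f : MvPolynomial (Fin n × Fin n) ℤ),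
        evalM ℚ A (MvPolynomial.map (algebraMap ℤ ℚ) f) = evalM ℤ A f :=
      fun A f => MvPolynomial.aeval_map_algebraMap _ _ _
    rw [← mapMatrix_eqns_eq_zero_iff]
    ext a b
    refine (hmap A (L.eqns a b)).symm.trans (h _ fun R' _ _ s => ?_)
    rw [hmap]
    exact congrFun (congrFun ((L.mapMatrix_eqns_eq_zero_iff (1 + linMat L.B s)).mpr ⟨s, rfl⟩) a) b
  · rintro ⟨s, rfl⟩ f hf
    exact hf R s

/-- The linear algebraic group attached to a linearly parameterised group. -/
def toGroup : LinAlgGroup n where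
  I := L.ideal
  one_mem' := fun R _ _ => (L.eval_ideal_iff (1 : Matrix (Fin n) (Fin n) R)).mpr ⟨0, by
    have : linMat L.B (0 : κ → R) = 0 := by
      ext a b
      simp [linMat_apply]
    rw [this, add_zero]⟩
  mul_mem' := fun R _ _ g h hg hh => by
    obtain ⟨s, hs⟩ := (L.eval_ideal_iff _).mp hg
    obtain ⟨s', hs'⟩ := (L.eval_ideal_iff _).mp hh
    obtain ⟨s'', h''⟩ := L.mul R s s'
    refine (L.eval_ideal_iff _).mpr ⟨s'', ?_⟩
    rw [Units.val_mul, hs, hs', h'']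
  inv_mem' := fun R _ _ g hg => by
    obtain ⟨s, hs⟩ := (L.eval_ideal_iff _).mp hg
    obtain ⟨s', h'⟩ := L.inv R s
    rw [← hs] at h'
    exact (L.eval_ideal_iff _).mpr ⟨s', Units.inv_eq_of_mul_eq_one_right h'⟩

theorem mem_pts_iff {R : Type} [CommRing R] [Algebra ℚ R] (g : GL (Fin n) R) :
    g ∈ L.toGroup.pts R ↔ ∃ s : κ → R, (g : Matrix (Fin n) (Fin n) R) = 1 + linMat L.B s :=
  L.eval_ideal_iff _

theorem exists_unit {S : Type} [CommRing S] (s : κ → S) :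
    ∃ g : GL (Fin n) S, (g : Matrix (Fin n) (Fin n) S) = 1 + linMat L.B s := by
  obtain ⟨s', h⟩ := L.inv S s
  exact ⟨⟨_, _, h, mul_eq_one_comm.mp h⟩, rfl⟩

/-- The defining equations are integral, and the generic element over `ℤ[κ]` embeds into `ℚ[κ]`.
Passing to the closure therefore changes nothing in any characteristic. -/
theorem mem_closurePts_iff {S : Type} [CommRing S] (g : GL (Fin n) S) :
    g ∈ L.toGroup.closurePts S ↔ ∃ s : κ → S, (g : Matrix (Fin n) (Fin n) S) = 1 + linMat L.B s := by
  constructor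
  · intro h
    rw [← mapMatrix_eqns_eq_zero_iff]
    exact LinAlgGroup.mapMatrix_eq_zero_of_mem_closurePts (fun R _ _ g hg =>
      (L.mapMatrix_eqns_eq_zero_iff _).mpr ((L.mem_pts_iff g).mp hg)) h
  · rintro ⟨s, hs⟩ f hf
    let s₀ : κ → MvPolynomial κ ℤ := MvPolynomial.X
    have hmap : ∀ {S S' : Type} [CommRing S] [CommRing S'] (u : S →+* S') (s : κ → S),
        (1 + linMat L.B s).map u.toIntAlgHom = 1 + linMat L.B fun j => u (s j) := by
      intro S S' _ _ u s
      rw [← mapMatrix_linMat, ← map_one u.mapMatrix, ← map_add]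
      rfl
    have h0 : evalM ℤ (1 + linMat L.B s₀) f = 0 := by
      let ι : MvPolynomial κ ℤ →+* MvPolynomial κ ℚ := MvPolynomial.map (Int.castRingHom ℚ)
      obtain ⟨u, hu⟩ := L.exists_unit fun j => ι (s₀ j)
      have h2 := hf _ u ((L.mem_pts_iff u).mpr ⟨_, hu⟩)
      have h3 := map_evalM ι.toIntAlgHom (1 + linMat L.B s₀) f
      rw [hmap, ← hu] at h3
      exact MvPolynomial.map_injective _ (RingHom.injective_int _)
        ((h3.trans h2).trans (map_zero _).symm)
    let u : MvPolynomial κ ℤ →+* S := (MvPolynomial.aeval s : _ →ₐ[ℤ] S).toRingHom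
    have h1 := map_evalM (MvPolynomial.aeval s : _ →ₐ[ℤ] S) (1 + linMat L.B s₀) f
    rw [h0, map_zero] at h1
    refine Eq.trans (congrArg (fun A => evalM ℤ A f) ?_) h1.symm
    rw [hs]
    refine Eq.trans ?_ (hmap u s₀).symm
    congr 2
    ext j
    simp [s₀, u]

theorem exists_equiv (S : Type) [CommRing S] : ∃ e : (κ → S) ≃ L.toGroup.closurePts S,
    ∀ s, ((e s).1 : Matrix (Fin n) (Fin n) S) = 1 + linMat L.B s := by
  choose g hg using fun s : κ → S => L.exists_unit s
  refine ⟨Equiv.ofBijective (fun s => ⟨g s, (L.mem_closurePts_iff _).mpr ⟨s, hg s⟩⟩)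
    ⟨fun s s' h => ?_, fun ⟨h, hh⟩ => ?_⟩, hg⟩
  · have h1 : linMat L.B s = linMat L.B s' := by
      refine add_left_cancel (a := 1) ?_
      rw [← hg, ← hg]
      exact congrArg (fun x : L.toGroup.closurePts S => (x.1 : Matrix (Fin n) (Fin n) S)) h
    ext j
    rw [← L.linMat_p S s, h1, L.linMat_p]
  · obtain ⟨s, hs⟩ := (L.mem_closurePts_iff _).mp hh
    exact ⟨s, Subtype.ext (Units.ext ((hg s).trans hs.symm))⟩

end LinearSubgroup

end LinearGroupsOver

end OrbitEnum

namespace OrbitEnum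

/-! ### Realising module representations by unipotent groups -/

section Realisation

variable {n : ℕ} {κ ν : Type} [Fintype κ] [Fintype ν] [DecidableEq ν]

/-- The matrix whose entries are given linear forms. -/
def entMat (E : ν → ν → κ → ℤ) {S : Type} [CommRing S] (s : κ → S) : Matrix ν ν S :=
  Matrix.of fun a b => ∑ j, (E a b j : S) * s j

theorem one_add_linMat_eq (ε : ν ≃ Fin n) (E : ν → ν → κ → ℤ) {S : Type} [CommRing S]
    (s : κ → S) :
    1 + linMat (Matrix.of fun (ab : Fin n × Fin n) j => E (ε.symm ab.1) (ε.symm ab.2) j) s =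
      (1 + entMat E s).submatrix ε.symm ε.symm := by
  change _ = (1 : Matrix ν ν S).submatrix ε.symm ε.symm + (entMat E s).submatrix ε.symm ε.symm
  rw [Matrix.submatrix_one_equiv]
  rfl

/-- The linearly parameterised group given by the linear forms `E`. -/
def LinearSubgroup.ofEntries (ε : ν ≃ Fin n) (E : ν → ν → κ → ℤ) (p : κ → ν × ν)
    (hp : ∀ (S : Type) [CommRing S] (s : κ → S) (j : κ), entMat E s (p j).1 (p j).2 = s j)
    (hmul : ∀ (S : Type) [CommRing S] (s s' : κ → S), ∃ s'' : κ → S,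
      (1 + entMat E s) * (1 + entMat E s') = 1 + entMat E s'')
    (hinv : ∀ (S : Type) [CommRing S] (s : κ → S), ∃ s' : κ → S,
      (1 + entMat E s) * (1 + entMat E s') = 1) : LinearSubgroup n κ where
  B := Matrix.of fun ab j => E (ε.symm ab.1) (ε.symm ab.2) j
  p := fun j => (ε (p j).1, ε (p j).2)
  linMat_p := fun S _ s j => by
    rw [linMat_apply, ← hp S s j]
    simp [entMat]
  mul := fun S _ s s' => by
    obtain ⟨s'', h⟩ := hmul S s s'
    exact ⟨s'', by rw [one_add_linMat_eq, one_add_linMat_eq, Matrix.submatrix_mul_equiv, h,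
      one_add_linMat_eq]⟩
  inv := fun S _ s => by
    obtain ⟨s', h⟩ := hinv S s
    exact ⟨s', by rw [one_add_linMat_eq, one_add_linMat_eq, Matrix.submatrix_mul_equiv, h,
      Matrix.submatrix_one_equiv]⟩

section Transvections

variable {r d e : ℕ} (c : Fin r → Fin d → Fin e → ℤ)

/-- The entries of the matrices `[0, a; 0, 0]`. -/
def transvEntries : Fin d ⊕ Fin e → Fin d ⊕ Fin e → Fin r → ℤ
  | .inl i, .inr l, j => c j i l
  | .inl _, .inl _, _ => 0
  | .inr _, _, _ => 0

theorem transv_mul {S : Type} [CommRing S] (s s' : Fin r → S) :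
    (1 + entMat (transvEntries c) s) * (1 + entMat (transvEntries c) s') =
      1 + entMat (transvEntries c) (s + s') := by
  have h1 : entMat (transvEntries c) s * entMat (transvEntries c) s' = 0 := by
    ext (i | l) (i' | l') <;>
      simp [Matrix.mul_apply, Fintype.sum_sum_type, entMat, transvEntries]
  have h2 : entMat (transvEntries c) (s + s') =
      entMat (transvEntries c) s + entMat (transvEntries c) s' := by
    ext a b
    simp [entMat, mul_add, Finset.sum_add_distrib]
  rw [add_mul, mul_add, mul_add, h1, h2]
  simp [add_comm, add_left_comm]

theorem entMat_zero (E : ν → ν → κ → ℤ) {S : Type} [CommRing S] :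
    entMat E (0 : κ → S) = 0 := by
  ext a b
  simp [entMat]

/-- The group of matrices `[1, a; 0, 1]`. -/
def transvGroup (i₀ : Fin d) (l : Fin r → Fin e)
    (h : ∀ j j', c j i₀ (l j') = if j = j' then 1 else 0) : LinearSubgroup (d + e) (Fin r) :=
  .ofEntries finSumFinEquiv (transvEntries c) (fun j => (.inl i₀, .inr (l j)))
    (fun S _ s j => by simp [entMat, transvEntries, h])
    (fun S _ s s' => ⟨s + s', transv_mul c s s'⟩)
    (fun S _ s => ⟨-s, by rw [transv_mul, add_neg_cancel, entMat_zero, add_zero]⟩)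

variable (i₀ : Fin d) (l : Fin r → Fin e) (h : ∀ j j', c j i₀ (l j') = if j = j' then 1 else 0)

theorem one_add_linMat_transv {S : Type} [CommRing S] (s : Fin r → S) :
    1 + linMat (transvGroup c i₀ l h).B s =
      (1 + entMat (transvEntries c) s).submatrix finSumFinEquiv.symm finSumFinEquiv.symm :=
  one_add_linMat_eq _ _ _

theorem leUni_transvGroup : (transvGroup c i₀ l h).toGroup.LeUni := by
  intro R _ _ g hg a b
  obtain ⟨s, hs⟩ := (LinearSubgroup.mem_pts_iff _ g).mp hg
  rw [hs, one_add_linMat_transv]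
  constructor
  · intro hab
    induction a using Fin.addCases with
    | left i =>
      induction b using Fin.addCases with
      | left i' =>
        have : i ≠ i' := by
          rintro rfl
          exact lt_irrefl _ hab
        simp [entMat, transvEntries, this]
      | right l' => exact absurd hab (by simp [Fin.lt_def]; omega)
    | right l =>
      induction b using Fin.addCases with
      | left i' => simp [entMat, transvEntries]
      | right l' =>
        have : l ≠ l' := by
          rintro rfl
          exact lt_irrefl _ hab
        simp [entMat, transvEntries, this]
  · induction a using Fin.addCases with
    | left i => simp [entMat, transvEntries]
    | right l => simp [entMat, transvEntries]

theorem isComm_transvGroup : (transvGroup c i₀ l h).toGroup.IsComm := by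
  intro R _ _ g hg g' hg'
  obtain ⟨s, hs⟩ := (LinearSubgroup.mem_pts_iff _ g).mp hg
  obtain ⟨s', hs'⟩ := (LinearSubgroup.mem_pts_iff _ g').mp hg'
  refine Units.ext ?_
  rw [Units.val_mul, Units.val_mul, hs, hs', one_add_linMat_transv, one_add_linMat_transv,
    Matrix.submatrix_mul_equiv, Matrix.submatrix_mul_equiv, transv_mul, transv_mul, add_comm s]

theorem vecMul_transv_eq_iff {S : Type} [CommRing S] (s : Fin r → S) (x : Fin d → S)
    (y : Fin e → S) :
    Fin.append x y ᵥ* (1 + linMat (transvGroup c i₀ l h).B s) = Fin.append x y ↔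
      tform S c s x = 0 := by
  rw [Matrix.vecMul_add, Matrix.vecMul_one, add_eq_left]
  have h1 : linMat (transvGroup c i₀ l h).B s =
      (entMat (transvEntries c) s).submatrix finSumFinEquiv.symm finSumFinEquiv.symm := rfl
  have h2 : Fin.append x y ᵥ* linMat (transvGroup c i₀ l h).B s =
      Fin.append 0 (tform S c s x) := by
    rw [h1]
    ext b
    induction b using Fin.addCases with
    | left i => simp [Matrix.vecMul, dotProduct, Fin.sum_univ_add, entMat, transvEntries]
    | right l =>
      simp only [Matrix.vecMul, dotProduct, Fin.sum_univ_add, entMat, transvEntries, tform_apply,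
        Matrix.submatrix_apply, finSumFinEquiv_symm_apply_castAdd,
        finSumFinEquiv_symm_apply_natAdd, Fin.append_left, Fin.append_right, Matrix.of_apply,
        Int.cast_zero, zero_mul, Finset.sum_const_zero, mul_zero, add_zero, Finset.mul_sum]
      rw [Finset.sum_comm]
      exact Finset.sum_congr rfl fun j _ => Finset.sum_congr rfl fun i _ => by ring
  rw [h2]
  constructor
  · intro h
    ext l
    have := congrFun h (Fin.natAdd d l)
    rwa [Fin.append_right] at this
  · intro h
    rw [h]
    ext b
    induction b using Fin.addCases <;> simp

theorem evalQ_orbits_transvGroup (q : PP) :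
    evalQ q (transvGroup c i₀ l h).toGroup.orbits * (q.1 : ℚ) ^ r =
      (q.1 : ℚ) ^ e * kerSum (tform (Fq q) c) := by
  obtain ⟨g, hg⟩ := (transvGroup c i₀ l h).exists_equiv (Fq q)
  have h1 := LinAlgGroup.evalQ_orbits_mul _ g
  rw [Fintype.card_fin] at h1
  rw [h1, kerSum_eq_card]
  have h2 := card_fun_Fq q (Fin e)
  rw [Fintype.card_fin] at h2
  rw [← Nat.cast_pow, ← h2, ← Nat.cast_mul, ← Nat.card_prod]
  congr 1
  refine Nat.card_congr ?_
  refine Equiv.trans ?_ (Equiv.prodComm _ _)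
  exact
    { toFun := fun p => (⟨(p.1.1, fun i => p.1.2 (Fin.castAdd e i)), by
        have h3 := p.2
        rw [hg, ← Fin.append_castAdd_natAdd (f := p.1.2), vecMul_transv_eq_iff] at h3
        exact h3⟩, fun i => p.1.2 (Fin.natAdd d i))
      invFun := fun t => ⟨(t.1.1.1, Fin.append t.1.1.2 t.2), by
        rw [hg, vecMul_transv_eq_iff]
        exact t.1.2⟩
      left_inv := fun p => Subtype.ext (Prod.ext rfl Fin.append_castAdd_natAdd)
      right_inv := fun t => by
        refine Prod.ext (Subtype.ext (Prod.ext rfl ?_)) ?_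
        · ext i
          exact Fin.append_left _ _ _
        · ext i
          exact Fin.append_right _ _ _ }

end Transvections

end Realisation

end OrbitEnum

namespace OrbitEnum

/-! ### Baer groups as unipotent groups -/

section BaerRealisation

variable {m w : ℕ} (c : Fin m → Fin m → Fin w → ℤ)

/-- The structure constants of the Baer cocycle of an alternating bilinear map. -/
def cocycleConst : Fin m → Fin m → Fin w → ℤ := fun i j l => if j < i then c i j l else 0

/-- An alternating form is its strictly lower triangular part minus the transpose of that part. No
division by 2 occurs, so the formula also serves characteristic 2. -/
theorem tform_cocycleConst_sub (hc : ∀ a, tform ℤ c a a = 0) {S : Type} [CommRing S]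
    (a a' : Fin m → S) :
    tform S (cocycleConst c) a a' - tform S (cocycleConst c) a' a = tform S c a a' := by
  have h1 : ∀ i l, c i i l = 0 := by
    intro i l
    have h := tform_single (R := ℤ) c i i l
    rw [hc, Int.cast_id] at h
    exact h.symm
  have h2 : ∀ i j l, c i j l + c j i l = 0 := by
    intro i j l
    have h := congrFun (hc (Pi.single i 1 + Pi.single j 1)) l
    simp only [map_add, LinearMap.add_apply, Pi.add_apply, tform_single, Int.cast_id, h1,
      Pi.zero_apply] at h
    linarith
  ext l
  rw [Pi.sub_apply, tform_apply, tform_apply, tform_apply, Finset.sum_comm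
    (f := fun i j => (cocycleConst c i j l : S) * (a' i * a j)), ← Finset.sum_sub_distrib]
  refine Finset.sum_congr rfl fun i _ => ?_
  rw [← Finset.sum_sub_distrib]
  refine Finset.sum_congr rfl fun j _ => ?_
  rw [cocycleConst, cocycleConst]
  rcases lt_trichotomy i j with h | rfl | h
  · rw [if_neg h.not_gt, if_pos h, eq_neg_of_add_eq_zero_left (h2 j i l)]
    push_cast
    ring
  · simp [h1]
  · rw [if_pos h, if_neg h.not_gt]
    push_cast
    ring

/-- The index set of the matrices `[1, a, y; 0, 1, b; 0, 0, 1]`. -/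
abbrev BaerIndex (m w : ℕ) : Type := Unit ⊕ (Fin m ⊕ Fin w)

/-- The entries of the matrices `[0, a, y; 0, 0, b(a); 0, 0, 0]`. -/
def baerEntries : BaerIndex m w → BaerIndex m w → Fin m ⊕ Fin w → ℤ
  | .inl _, .inr b, j => if b = j then 1 else 0
  | .inr (.inl i), .inr (.inr l), .inl j => cocycleConst c i j l
  | _, _, _ => 0

/-- The vector `(0, y)`. -/
def inrVec (m : ℕ) {w : ℕ} {S : Type} [CommRing S] (y : Fin w → S) : Fin m ⊕ Fin w → S :=
  Sum.elim (fun _ => 0) y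

theorem inrVec_comp_inl {S : Type} [CommRing S] (y : Fin w → S) :
    inrVec m y ∘ Sum.inl = 0 := rfl

theorem inrVec_zero {S : Type} [CommRing S] : inrVec m (0 : Fin w → S) = 0 := by
  ext (i | l) <;> rfl

/-- The product of the Baer group. -/
def baerOp {S : Type} [CommRing S] (s s' : Fin m ⊕ Fin w → S) : Fin m ⊕ Fin w → S :=
  s + s' + inrVec m (tform S (cocycleConst c) (s ∘ Sum.inl) (s' ∘ Sum.inl))

theorem entMat_add {κ ν : Type} [Fintype κ] (E : ν → ν → κ → ℤ) {S : Type} [CommRing S]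
    (s s' : κ → S) : entMat E (s + s') = entMat E s + entMat E s' := by
  ext a b
  simp [entMat, mul_add, Finset.sum_add_distrib]

theorem entMat_inl_inr {S : Type} [CommRing S] (s : Fin m ⊕ Fin w → S) (u : Unit)
    (j : Fin m ⊕ Fin w) : entMat (baerEntries c) s (.inl u) (.inr j) = s j := by
  simp only [entMat, Matrix.of_apply, baerEntries, Int.cast_ite, Int.cast_one, Int.cast_zero,
    ite_mul, one_mul, zero_mul, Finset.sum_ite_eq, Finset.mem_univ, if_true]

theorem entMat_inl {S : Type} [CommRing S] (s : Fin m ⊕ Fin w → S) (x : BaerIndex m w) (u : Unit) :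
    entMat (baerEntries c) s x (.inl u) = 0 := by
  rcases x with u' | i | l <;> simp [entMat, baerEntries]

theorem entMat_inr_inr {S : Type} [CommRing S] (s : Fin m ⊕ Fin w → S) (l : Fin w)
    (x : BaerIndex m w) : entMat (baerEntries c) s (.inr (.inr l)) x = 0 := by
  rcases x with u' | i | l <;> simp [entMat, baerEntries]

theorem entMat_inr_inl {S : Type} [CommRing S] (s : Fin m ⊕ Fin w → S) (x : Fin m ⊕ Fin w)
    (i : Fin m) : entMat (baerEntries c) s (.inr x) (.inr (.inl i)) = 0 := by
  rcases x with i | l <;> simp [entMat, baerEntries]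

theorem entMat_inl_inr_inr {S : Type} [CommRing S] (s : Fin m ⊕ Fin w → S) (i : Fin m)
    (l : Fin w) : entMat (baerEntries c) s (.inr (.inl i)) (.inr (.inr l)) =
      ∑ j, (cocycleConst c i j l : S) * s (.inl j) := by
  simp [entMat, baerEntries]

/-- Only paths through the middle indices `Fin m` contribute. The row `a` meets the column `b(a')`,
which leaves the cocycle `β(a, a')` in the last entries of the top row. -/
theorem entMat_mul_entMat {S : Type} [CommRing S] (s s' : Fin m ⊕ Fin w → S) :
    entMat (baerEntries c) s * entMat (baerEntries c) s' = entMat (baerEntries c)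
      (inrVec m (tform S (cocycleConst c) (s ∘ Sum.inl) (s' ∘ Sum.inl))) := by
  ext x y
  rw [Matrix.mul_apply, Fintype.sum_sum_type, Fintype.sum_sum_type]
  simp only [entMat_inl, entMat_inr_inr, zero_mul, mul_zero, Finset.sum_const_zero, zero_add,
    add_zero]
  rcases y with u | i | l
  · simp only [entMat_inl, mul_zero, Finset.sum_const_zero]
  · simp only [entMat_inr_inl, mul_zero, Finset.sum_const_zero]
    rcases x with u | x
    · rw [entMat_inl_inr]
      rfl
    · rw [entMat_inr_inl]
  · rcases x with u | i | l'
    · simp only [entMat_inl_inr, entMat_inl_inr_inr, Finset.mul_sum]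
      change _ = tform S (cocycleConst c) (s ∘ Sum.inl) (s' ∘ Sum.inl) l
      exact Finset.sum_congr rfl fun i _ => Finset.sum_congr rfl fun j _ => mul_left_comm _ _ _
    · simp [entMat_inr_inl, entMat_inl_inr_inr, inrVec]
    · simp [entMat_inr_inr]

theorem one_add_entMat_mul {S : Type} [CommRing S] (s s' : Fin m ⊕ Fin w → S) :
    (1 + entMat (baerEntries c) s) * (1 + entMat (baerEntries c) s') =
      1 + entMat (baerEntries c) (baerOp c s s') := by
  rw [baerOp, entMat_add, entMat_add, ← entMat_mul_entMat, add_mul, mul_add, mul_add]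
  simp [add_assoc, add_left_comm]

/-- The inverse in the Baer group. -/
def baerInv {S : Type} [CommRing S] (s : Fin m ⊕ Fin w → S) : Fin m ⊕ Fin w → S :=
  -s + inrVec m (tform S (cocycleConst c) (s ∘ Sum.inl) (s ∘ Sum.inl))

theorem baerOp_baerInv {S : Type} [CommRing S] (s : Fin m ⊕ Fin w → S) :
    baerOp c s (baerInv c s) = 0 := by
  have h : baerInv c s ∘ Sum.inl = -(s ∘ Sum.inl) := by
    ext i
    simp [baerInv, inrVec]
  rw [baerOp, h, map_neg, baerInv]
  ext (i | l) <;> simp [inrVec]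

/-- The group of matrices `[1, a, y; 0, 1, b(a); 0, 0, 1]`. -/
noncomputable def baerGroup : LinearSubgroup (Fintype.card (BaerIndex m w)) (Fin m ⊕ Fin w) :=
  .ofEntries (Fintype.equivFin _) (baerEntries c) (fun j => (.inl (), .inr j))
    (fun S _ s j => entMat_inl_inr c s () j)
    (fun S _ s s' => ⟨_, one_add_entMat_mul c s s'⟩)
    (fun S _ s => ⟨baerInv c s, by
      rw [one_add_entMat_mul, baerOp_baerInv, entMat_zero, add_zero]⟩)

theorem one_add_linMat_mul {S : Type} [CommRing S] (s s' : Fin m ⊕ Fin w → S) :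
    (1 + linMat (baerGroup c).B s) * (1 + linMat (baerGroup c).B s') =
      1 + linMat (baerGroup c).B (baerOp c s s') := by
  have h : ∀ s : Fin m ⊕ Fin w → S, 1 + linMat (baerGroup c).B s = (1 + entMat (baerEntries c) s).submatrix
      (Fintype.equivFin _).symm (Fintype.equivFin _).symm :=
    fun s => one_add_linMat_eq (Fintype.equivFin _) (baerEntries c) (S := S) s
  rw [h, h, h, Matrix.submatrix_mul_equiv, one_add_entMat_mul]

theorem one_add_linMat_injective {S : Type} [CommRing S] {s s' : Fin m ⊕ Fin w → S}
    (h : 1 + linMat (baerGroup c).B s = 1 + linMat (baerGroup c).B s') : s = s' := by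
  ext j
  rw [← (baerGroup c).linMat_p S s j, add_left_cancel h, (baerGroup c).linMat_p]

theorem isUnip_baerGroup : (baerGroup c).toGroup.IsUnip := by
  intro R _ _ g hg
  obtain ⟨s, hs⟩ := (LinearSubgroup.mem_pts_iff _ g).mp hg
  have h0 : linMat (baerGroup c).B s = Matrix.reindexRingEquiv R (Fintype.equivFin _)
      (entMat (baerEntries c) s) := rfl
  refine ⟨3, ?_⟩
  rw [hs, add_sub_cancel_left, h0, ← map_pow, pow_succ, pow_two, entMat_mul_entMat,
    entMat_mul_entMat]
  rw [inrVec_comp_inl, map_zero, LinearMap.zero_apply, inrVec_zero, entMat_zero, map_zero]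

/-- A commutator has trivial `a`-component, so the cocycle vanishes against it and multiplication by
it is plain addition. -/
theorem classLeTwo_baerGroup : (baerGroup c).toGroup.ClassLeTwo := by
  intro R _ _ g hg h hh k hk
  have key : ∀ g ∈ (baerGroup c).toGroup.pts R, ∃ s : Fin m ⊕ Fin w → R,
      (g : Matrix _ _ R) = 1 + linMat (baerGroup c).B s ∧
      ((g⁻¹ : GL _ R) : Matrix _ _ R) = 1 + linMat (baerGroup c).B (baerInv c s) := by
    intro g hg
    obtain ⟨s, hs⟩ := (LinearSubgroup.mem_pts_iff _ g).mp hg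
    refine ⟨s, hs, Units.inv_eq_of_mul_eq_one_right ?_⟩
    rw [hs, one_add_linMat_mul, baerOp_baerInv]
    ext a b
    simp [linMat_apply]
  obtain ⟨s, hs, hs'⟩ := key g hg
  obtain ⟨t, ht, ht'⟩ := key h hh
  obtain ⟨u, hu, -⟩ := key k hk
  refine Units.ext ?_
  simp only [Units.val_mul, hs, hs', ht, ht', hu, one_add_linMat_mul]
  have h1 : ∀ x y : Fin m ⊕ Fin w → R, baerOp c x y ∘ Sum.inl = x ∘ Sum.inl + y ∘ Sum.inl := by
    intro x y
    ext i
    simp [baerOp, inrVec]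
  have h2 : ∀ x : Fin m ⊕ Fin w → R, baerInv c x ∘ Sum.inl = -(x ∘ Sum.inl) := by
    intro x
    ext i
    simp [baerInv, inrVec]
  generalize hz : baerOp c (baerOp c (baerOp c s t) (baerInv c s)) (baerInv c t) = z
  have h3 : z ∘ Sum.inl = 0 := by
    rw [← hz, h1, h1, h1, h2, h2]
    abel
  rw [baerOp, baerOp, h3, map_zero, LinearMap.zero_apply, map_zero, add_comm z]

theorem commute_iff_tform (hc : ∀ a, tform ℤ c a a = 0) {S : Type} [CommRing S]
    (s s' : Fin m ⊕ Fin w → S) :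
    Commute (1 + linMat (baerGroup c).B s) (1 + linMat (baerGroup c).B s') ↔
      tform S c (s ∘ Sum.inl) (s' ∘ Sum.inl) = 0 := by
  rw [commute_iff_eq, one_add_linMat_mul, one_add_linMat_mul, ← tform_cocycleConst_sub c hc,
    sub_eq_zero]
  constructor
  · intro h
    have h1 := one_add_linMat_injective c h
    rw [baerOp, baerOp, add_comm s'] at h1
    ext l
    exact congrFun (add_left_cancel h1) (Sum.inr l)
  · intro h
    rw [baerOp, baerOp, h, add_comm s]

theorem evalQ_classes_baerGroup (hc : ∀ a, tform ℤ c a a = 0) (q : PP) :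
    evalQ q (baerGroup c).toGroup.classes * (q.1 : ℚ) ^ m =
      (q.1 : ℚ) ^ w * kerSum (tform (Fq q) c) := by
  obtain ⟨g, hg⟩ := (baerGroup c).exists_equiv (Fq q)
  have h1 := LinAlgGroup.evalQ_classes_mul _ g
  have h2 := card_fun_Fq q (Fin w)
  rw [Fintype.card_fin] at h2
  have h3 : Nat.card {p : (Fin m ⊕ Fin w → Fq q) × (Fin m ⊕ Fin w → Fq q) //
      Commute (g p.1).1.1 (g p.2).1.1} =
      kerSum (tform (Fq q) c) * (q.1 ^ w * q.1 ^ w) := by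
    rw [kerSum_eq_card, ← h2, ← Nat.card_prod, ← Nat.card_prod]
    exact Nat.card_congr
      { toFun := fun p => (⟨(p.1.1 ∘ Sum.inl, p.1.2 ∘ Sum.inl), by
          have h3 := p.2
          rw [hg, hg, commute_iff_tform c hc] at h3
          exact h3⟩, (p.1.1 ∘ Sum.inr, p.1.2 ∘ Sum.inr))
        invFun := fun t => ⟨(Sum.elim t.1.1.1 t.2.1, Sum.elim t.1.1.2 t.2.2), by
          rw [hg, hg, commute_iff_tform c hc]
          exact t.1.2⟩
        left_inv := fun p => Subtype.ext (Prod.ext (Sum.elim_comp_inl_inr _)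
          (Sum.elim_comp_inl_inr _))
        right_inv := fun t => rfl }
  have h4 : (q.1 : ℚ) ^ Fintype.card (Fin m ⊕ Fin w) = (q.1 : ℚ) ^ (m + w) := by simp
  rw [h3, h4] at h1
  push_cast at h1
  refine mul_right_cancel₀ (pow_ne_zero w q.ne_zero) ?_
  rw [mul_assoc, ← pow_add, h1]
  ring

end BaerRealisation

end OrbitEnum

namespace OrbitEnum

/-! ### Orbits and class numbers of unipotent groups -/

section Unipotent

/-- In the extension, the row of the additional basis vector of `V × ℤ` is the identity on `M`. The
parameters then occur as entries of the matrices, as a linearly parameterised group requires. -/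
theorem proj_askSym_extRep_mem {M V W : Type} [AddCommGroup M] [AddCommGroup V] [AddCommGroup W]
    [Module.Free ℤ M] [Module.Finite ℤ M] [Module.Free ℤ V] [Module.Finite ℤ V]
    [Module.Free ℤ W] [Module.Finite ℤ W] (θ : M →ₗ[ℤ] V →ₗ[ℤ] W) :
    Deco.flat.proj (askSym (mfold 1 (extRep θ))) ∈ laurentSpan .flat
      {x | ∃ (n : ℕ) (G : LinAlgGroup n), G.LeUni ∧ G.IsComm ∧ x = G.orbits} := by
  let bM := Module.finBasis ℤ M
  let bV := (Module.finBasis ℤ V).prod (Module.Basis.singleton Unit ℤ)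
  let bW := (Module.finBasis ℤ W).prod bM
  let bV' := bV.reindex (Fintype.equivFin _)
  let bW' := bW.reindex (Fintype.equivFin _)
  let c := strConst bM bV' bW' (extRep θ)
  have hc : ∀ j j', c j (Fintype.equivFin _ (Sum.inr ())) (Fintype.equivFin _ (Sum.inr j')) =
      if j = j' then 1 else 0 := by
    intro j j'
    simp [c, strConst, bV', bW', bV, bW, extRep, Finsupp.single_apply]
  refine proj_mem_of_evalQ ⟨_, _, leUni_transvGroup c _ (fun j => Fintype.equivFin _ (Sum.inr j)) hc,
    isComm_transvGroup c _ _ hc, rfl⟩ 0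
    (Fintype.card (Fin (Module.finrank ℤ W) ⊕ Fin (Module.finrank ℤ M))) fun q => ?_
  refine mul_right_cancel₀ (pow_ne_zero (Module.finrank ℤ M) q.ne_zero) ?_
  rw [pow_zero, one_mul, evalQ_orbits_transvGroup, askSym_mfold_one, mul_assoc, evalQ_askSym_mul,
    kerSum_bc_eq_tform bM bV' bW']

theorem algA_flat_le_orbits : algA .flat 1 ≤ laurentSpan .flat
    {x | ∃ (n : ℕ) (G : LinAlgGroup n), G.LeUni ∧ G.IsComm ∧ x = G.orbits} := by
  refine laurentSpan_le ?_
  rintro _ ⟨T, rfl⟩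
  rw [← add_sub_cancel_right (askSym (mfold 1 T.θ)), ← askSym_mfold_extRep, map_sub]
  refine sub_mem (proj_askSym_extRep_mem T.θ) ?_
  -- Only averages of extensions are available as orbit numbers. For zero modules the extension has
  -- average `1 + (q - 1) = q`, so 1 is `q⁻¹` times a generator.
  have h1 : (1 : QQ) = qInv * askSym (mfold 1 (extRep (0 : PUnit →ₗ[ℤ] PUnit →ₗ[ℤ] PUnit))) := by
    rw [askSym_mfold_extRep, askSym_mfold_of_subsingleton, Module.finrank_zero_of_subsingleton,
      zero_mul, pow_zero, pow_zero, mul_one, mul_one, pow_one, add_sub_cancel, mul_comm,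
      qQ_mul_qInv]
  have h2 : Deco.flat.proj 1 ∈ laurentSpan .flat
      {x | ∃ (n : ℕ) (G : LinAlgGroup n), G.LeUni ∧ G.IsComm ∧ x = G.orbits} := by
    rw [h1]
    exact smul_mem_laurentSpan proj_qInv_mem (proj_askSym_extRep_mem _)
  rw [← mul_one ((qQ ^ 1 - 1) * _)]
  refine smul_mem_laurentSpan ?_ h2
  rw [map_mul, map_sub, map_pow, map_one]
  exact mul_mem (sub_mem (pow_mem proj_qQ_mem 1) (one_mem _)) (proj_qQ_pow_mul_qInv_pow_mem _ _)

theorem orbits_le_algA_flat : laurentSpan .flat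
    {x | ∃ (n : ℕ) (G : LinAlgGroup n), G.LeUni ∧ x = G.orbits} ≤ algA .flat 1 := by
  refine laurentSpan_le ?_
  rintro _ ⟨n, G, hG, rfl⟩
  exact hG.isUnip.proj_orbits_mem

theorem orbits_comm_le_orbits : laurentSpan .flat
      {x | ∃ (n : ℕ) (G : LinAlgGroup n), G.LeUni ∧ G.IsComm ∧ x = G.orbits} ≤
    laurentSpan .flat {x | ∃ (n : ℕ) (G : LinAlgGroup n), G.LeUni ∧ x = G.orbits} := by
  refine laurentSpan_le ?_
  rintro _ ⟨n, G, hG, -, rfl⟩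
  exact proj_mem_laurentSpan ⟨n, G, hG, rfl⟩

theorem algAalt_flat_le_classes : algAalt .flat ≤ laurentSpan .flat
    {x | ∃ (n : ℕ) (G : LinAlgGroup n), G.IsUnip ∧ G.ClassLeTwo ∧ x = G.classes} := by
  refine laurentSpan_le ?_
  rintro _ ⟨T, rfl⟩
  let bM := Module.finBasis ℤ T.M
  let bW := Module.finBasis ℤ T.W
  let c := strConst bM bM bW T.θ
  -- Every coordinate vector over `ℤ` comes from some `1 ⊗ a`, where `T.alt` applies.
  have hc : ∀ a, tform ℤ c a a = 0 := by
    intro a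
    obtain ⟨a, rfl⟩ := (coords bM ℤ).surjective a
    obtain ⟨a, rfl⟩ := (TensorProduct.lid ℤ T.M).symm.surjective a
    rw [TensorProduct.lid_symm_apply]
    change tform ℤ c (coords bM ℤ (1 ⊗ₜ a)) (coords bM ℤ (1 ⊗ₜ a)) = 0
    rw [← coords_bc bM bM bW, bc_tmul, T.alt, TensorProduct.tmul_zero, map_zero]
  refine proj_mem_of_evalQ ⟨_, _, isUnip_baerGroup c, classLeTwo_baerGroup c, rfl⟩ 0
    (Module.finrank ℤ T.W) fun q => ?_
  refine mul_right_cancel₀ (pow_ne_zero (Module.finrank ℤ T.M) q.ne_zero) ?_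
  rw [pow_zero, one_mul, evalQ_classes_baerGroup c hc, mul_assoc, evalQ_askSym_mul,
    kerSum_bc_eq_tform bM bM bW]

theorem classes_le_algAalt_flat : laurentSpan .flat
    {x | ∃ (n : ℕ) (G : LinAlgGroup n), G.IsUnip ∧ x = G.classes} ≤ algAalt .flat := by
  refine laurentSpan_le ?_
  rintro _ ⟨n, G, hG, rfl⟩
  exact hG.proj_classes_mem

theorem classes_classLeTwo_le_classes : laurentSpan .flat
      {x | ∃ (n : ℕ) (G : LinAlgGroup n), G.IsUnip ∧ G.ClassLeTwo ∧ x = G.classes} ≤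
    laurentSpan .flat {x | ∃ (n : ℕ) (G : LinAlgGroup n), G.IsUnip ∧ x = G.classes} := by
  refine laurentSpan_le ?_
  rintro _ ⟨n, G, hG, -, rfl⟩
  exact proj_mem_laurentSpan ⟨n, G, hG, rfl⟩

end Unipotent

end OrbitEnum

theorem mainTheorem4 :
    (∀ s : Deco,
      -- all modules involved are `ℤ[q, q⁻¹]`-subalgebras of `𝒬*`
      ((∀ m : ℕ, IsSubalg (algA s m) ∧ IsSubalg (algAimm s m)) ∧
        IsSubalg (algAalt s) ∧ IsSubalg (algX s)) ∧
      (∀ m : ℕ, 1 ≤ m →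
        algAimm s m ≤ algA s m ∧ algA s m ≤ algA s 1 ∧ algA s 1 ≤ algX s) ∧
      algA s 1 = laurentSpan s {x | ∃ T : MatRep, x = transvOrbits T.θ} ∧
      algAimm s 1 = laurentSpan s {x | ∃ T : MatRep, Immersive T.θ ∧ x = transvOrbits T.θ} ∧
      algA s 2 = laurentSpan s {x | ∃ T : FreeRep, x = heisClasses T.θ} ∧
      algAalt s = laurentSpan s {x | ∃ T : AltRep, x = baerClasses T.θ} ∧
      algA s 2 ≤ algAalt s) ∧
    (algA .flat 1 = laurentSpan .flat
        {x | ∃ (n : ℕ) (G : LinAlgGroup n), G.LeUni ∧ x = G.orbits} ∧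
      algA .flat 1 = laurentSpan .flat
        {x | ∃ (n : ℕ) (G : LinAlgGroup n), G.LeUni ∧ G.IsComm ∧ x = G.orbits}) ∧
    (algAalt .flat = laurentSpan .flat
        {x | ∃ (n : ℕ) (G : LinAlgGroup n), G.IsUnip ∧ x = G.classes} ∧
      algAalt .flat = laurentSpan .flat
        {x | ∃ (n : ℕ) (G : LinAlgGroup n), G.IsUnip ∧ G.ClassLeTwo ∧ x = G.classes}) :=
  ⟨fun s => ⟨⟨fun m => ⟨isSubalg_algA s m, algAimm_eq_algA s m ▸ isSubalg_algA s m⟩,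
      isSubalg_algAalt s, isSubalg_algX s⟩,
    fun m _ => ⟨algAimm_le_algA s m, algA_le_algA_one s m, algA_one_le_algX s⟩,
    algA_one_eq_transv s, algAimm_one_eq_transv s, algA_two_eq_heis s, algAalt_eq_baer s,
    algA_two_le_algAalt s⟩,
  ⟨le_antisymm (algA_flat_le_orbits.trans orbits_comm_le_orbits) orbits_le_algA_flat,
    le_antisymm algA_flat_le_orbits (orbits_comm_le_orbits.trans orbits_le_algA_flat)⟩,
  le_antisymm (algAalt_flat_le_classes.trans classes_classLeTwo_le_classes) classes_le_algAalt_flat,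
  le_antisymm algAalt_flat_le_classes
    (classes_classLeTwo_le_classes.trans classes_le_algAalt_flat)⟩
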